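/- Let $\Gamma$ be a finite simple connected undirected graph with vertex set $V_\Gamma$, edge set $E_\Gamma$ and shortest path metric $d_\Gamma$. **Definitions.** $\Gamma$ is *modular* if for all vertices $x,y,z$ there is a vertex $m$ with $d_\Gamma(a,m)+d_\Gamma(m,b)=d_\Gamma(a,b)$ for each of the pairs $(a,b)=(x,y),(y,z),(z,x)$. For an orientation $o$ of $\Gamma$, write $p\swarrow q$ if $pq$ is an edge oriented from $q$ to $p$; $o$ is *admissible* if for every 4-cycle with edges $uv,vv',v'u',u'u$ one has $u\swarrow v$ if and only if $u'\swarrow v'$. $\Gamma$ is *orientable* if it has an admissible orientation. Two edges are *projective* if they are joined by a sequence of edges in which any two consecutive edges belong to a common 4-cycle and share no vertex; an *orbit* is an equivalence class of this relation on $E_\Gamma$. A function $h:E_\Gamma\to\mathbf R$ is *orbit-invariant* if it is constant on each orbit, and *positive* if $h(e)>0$ for all $e\in E_\Gamma$. For a positive $h$, $d_{\Gamma,h}$ denotes the shortest path metric with respect to the edge-length $h$; $d_{\Gamma,1}=d_\Gamma$ is the case of unit lengths. Let $V\supseteq V_\Gamma$ be a finite set with $V\setminus V_\Gamma=\{1,\dots,n\}$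 and let $c:\binom V2\to\mathbf Q_+$ be a nonnegative cost. A *location* is $\rho=(\rho_1,\dots,\rho_n)\in (V_\Gamma)^n$, and $$(c\cdot d_{\Gamma,h})(\rho):=\sum_{s\in V_\Gamma}\sum_{1\le j\le n}c(sj)\,d_{\Gamma,h}(s,\rho_j)+\sum_{1\le i<j\le n}c(ij)\,d_{\Gamma,h}(\rho_i,\rho_j).$$ $\mathbf{Multifac}[\Gamma,h;V,c]$ is the problem of minimizing $(c\cdot d_{\Gamma,h})(\rho)$ over all locations $\rho$. Let $o$ be an admissible orientation, and let $\preceq$ be the reflexive transitive closure of $\swarrow$ (if $\Gamma$ is modular, this is a partial order). A pair $(p,q)$ of vertices is *Boolean* if $p=q$, or some cube subgraph of $\Gamma$, oriented by $o$, is the Hasse diagram of a Boolean lattice with minimum $p$ and maximum $q$. Put $\mathcal L_p^+:=\{q:(p,q)\text{ Boolean}\}$, ordered by $\preceq$, and $\mathcal L_p^-:=\{q:(q,p)\text{ Boolean}\}$, ordered by the reverse of $\preceq$; $p$ is the minimum element of both. For an orbit $Q$, let $\mathcal L_p^\pm|Q$ be the set of those $q\in\mathcal L_p^\pm$ for which every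 shortest path from $p$ to $q$ in the covering graph (undirected Hasse diagram) of the poset $\mathcal L_p^\pm$ has all its edges in $Q$. A location $\rho'$ is a *neighbor* of $\rho$ if $\rho'_i\in\mathcal L^+_{\rho_i}$ for all $i$ (forward) or $\rho'_i\in\mathcal L^-_{\rho_i}$ for all $i$ (backward). It is a *$Q$-neighbor* of $\rho$ if $\rho'_i\in\mathcal L^+_{\rho_i}|Q$ for all $i$ or $\rho'_i\in\mathcal L^-_{\rho_i}|Q$ for all $i$. **Theorem.** Let $\Gamma$ be an orientable modular graph with an admissible orientation $o$ and a positive orbit-invariant function $h$, and let $V,n,c$ be as above. For a location $\rho$, the following conditions are equivalent: 1. $\rho$ is optimal to $\mathbf{Multifac}[\Gamma,h;V,c]$. 2. $\rho$ is optimal to $\mathbf{Multifac}[\Gamma,1;V,c]$. 3. $(c\cdot d_{\Gamma,h})(\rho)\le(c\cdot d_{\Gamma,h})(\rho')$ for every neighbor $\rho'$ of $\rho$. 4. $(c\cdot d_{\Gamma,1})(\rho)\le(c\cdot d_{\Gamma,1})(\rho')$ for every neighbor $\rho'$ of $\rho$. 5. For every orbit $Q$ and every $Q$-neighbor $\rho'$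 of $\rho$, $(c\cdot d_{\Gamma,1})(\rho)\le(c\cdot d_{\Gamma,1})(\rho')$. -/

import Mathlib

namespace Multifac

variable {V : Type*}

/-- The shortest path metric `d_{G,h}` for the edge-length `h`. Only the values of `h` on edges
of `G` matter; the unit length is `fun _ => 1`. -/
noncomputable def wdist (G : SimpleGraph V) (h : Sym2 V → ℝ) (p q : V) : ℝ :=
  ⨅ w : G.Walk p q, (w.edges.map h).sum

/-- `z` lies in the metric interval `I(x, y)` of the graph metric. -/
def InInterval (G : SimpleGraph V) (x y z : V) : Prop :=
  G.dist x z + G.dist z y = G.dist x y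

/-- A (connected) graph is modular if every triple of vertices has a median. -/
def IsModular (G : SimpleGraph V) : Prop :=
  ∀ x y z : V, ∃ m : V, InInterval G x y m ∧ InInterval G y z m ∧ InInterval G z x m

/-- `u, v, v', u'` are, in this cyclic order, the vertices of a 4-cycle with edges
`uv, vv', v'u', u'u`. -/
def IsFourCycle (G : SimpleGraph V) (u v v' u' : V) : Prop :=
  G.Adj u v ∧ G.Adj v v' ∧ G.Adj v' u' ∧ G.Adj u' u ∧ u ≠ v' ∧ v ≠ u'

/-- An orientation of `G`: `o p q` means that `pq` is an edge oriented from `q` to `p`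
(so `p` is the lower end); every edge is oriented in exactly one of the two ways. -/
structure IsOrientation (G : SimpleGraph V) (o : V → V → Prop) : Prop where
  adj : ∀ p q, o p q → G.Adj p q
  total : ∀ p q, G.Adj p q → o p q ∨ o q p
  asymm : ∀ p q, o p q → ¬ o q p

/-- An orientation is admissible if opposite edges of 4-cycles have the same direction. -/
structure IsAdmissible (G : SimpleGraph V) (o : V → V → Prop) : Prop
    extends IsOrientation G o where
  fourCycle : ∀ u v v' u', IsFourCycle G u v v' u' → (o u v ↔ o u' v')

/-- `e` and `e'` belong to a common 4-cycle and share no vertex. -/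
def Opposite (G : SimpleGraph V) (e e' : Sym2 V) : Prop :=
  ∃ u v v' u', IsFourCycle G u v v' u' ∧ e = s(u, v) ∧ e' = s(u', v')

/-- `e` and `e'` are joined by a sequence of successively opposite edges. -/
def Projective (G : SimpleGraph V) (e e' : Sym2 V) : Prop :=
  Relation.ReflTransGen (Opposite G) e e'

/-- An orbit is an equivalence class of the projectivity relation on the edge set. -/
def IsOrbit (G : SimpleGraph V) (Q : Set (Sym2 V)) : Prop :=
  ∃ e ∈ G.edgeSet, Q = {e' | e' ∈ G.edgeSet ∧ Projective G e e'}

/-- `h` takes the same value on edges of the same orbit. -/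
def OrbitInvariant (G : SimpleGraph V) (h : Sym2 V → ℝ) : Prop :=
  ∀ Q, IsOrbit G Q → ∀ e ∈ Q, ∀ e' ∈ Q, h e = h e'

/-- `(p, q)` is a Boolean pair: some cube subgraph, with the orientation induced by `o`, is the
Hasse diagram of a Boolean lattice with minimum `p` and maximum `q`. The cube is given by an
injective labelling of its vertices by the subsets of a `k`-element set; `k = 0` gives the
pairs `(p, p)`. -/
def BooleanPair (o : V → V → Prop) (p q : V) : Prop :=
  ∃ (k : ℕ) (f : Finset (Fin k) → V), Function.Injective f ∧
    (∀ (S : Finset (Fin k)) (i : Fin k), i ∉ S → o (f S) (f (insert i S))) ∧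
    f ∅ = p ∧ f Finset.univ = q

/-- The set `L⁺_p` of all `q` such that `(p, q)` is Boolean. -/
def upper (o : V → V → Prop) (p : V) : Set V := {q | BooleanPair o p q}

/-- The set `L⁻_p` of all `q` such that `(q, p)` is Boolean. -/
def lower (o : V → V → Prop) (p : V) : Set V := {q | BooleanPair o q p}

/-- The order on vertices generated by the orientation. -/
def Preceq (o : V → V → Prop) (p q : V) : Prop := Relation.ReflTransGen o p q

/-- `b` covers `a` in the set `L` ordered by `Preceq o`. -/
def Covers (o : V → V → Prop) (L : Set V) (a b : V) : Prop :=
  a ∈ L ∧ b ∈ L ∧ Preceq o a b ∧ a ≠ b ∧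
    ∀ c ∈ L, Preceq o a c → Preceq o c b → c = a ∨ c = b

/-- The covering graph (undirected Hasse diagram) of `L` ordered by `Preceq o`, or equally by the
reverse order. Vertices outside `L` are isolated. -/
def coveringGraph (o : V → V → Prop) (L : Set V) : SimpleGraph V where
  Adj a b := Covers o L a b ∨ Covers o L b a
  symm := ⟨fun _ _ hab => hab.symm⟩
  loopless := ⟨fun _ haa => haa.elim (fun hc => hc.2.2.2.1 rfl) (fun hc => hc.2.2.2.1 rfl)⟩

/-- For a set `L` with minimum element `z` (in the order of `L`) and an edge set `U`, the set
`L|U` of all `q ∈ L` such that every shortest path from `z` to `q` in the covering graph of `L`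
has all its edges in `U`. -/
def restrict (o : V → V → Prop) (L : Set V) (z : V) (U : Set (Sym2 V)) : Set V :=
  {q | q ∈ L ∧ ∀ w : (coveringGraph o L).Walk z q,
    w.length = (coveringGraph o L).dist z q → ∀ e ∈ w.edges, e ∈ U}

/-- The set `L⁺_p|Q`. -/
def upperRestrict (o : V → V → Prop) (p : V) (Q : Set (Sym2 V)) : Set V :=
  restrict o (upper o p) p (Q ∩ (coveringGraph o (upper o p)).edgeSet)

/-- The set `L⁻_p|Q`. -/
def lowerRestrict (o : V → V → Prop) (p : V) (Q : Set (Sym2 V)) : Set V :=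
  restrict o (lower o p) p (Q ∩ (coveringGraph o (lower o p)).edgeSet)

/-- `ρ'` is a (forward or backward) neighbor of the location `ρ`. -/
def IsNeighbor (o : V → V → Prop) {n : ℕ} (ρ ρ' : Fin n → V) : Prop :=
  (∀ i, ρ' i ∈ upper o (ρ i)) ∨ (∀ i, ρ' i ∈ lower o (ρ i))

/-- `ρ'` is a (forward or backward) `Q`-neighbor of the location `ρ`. -/
def IsQNeighbor (o : V → V → Prop) (Q : Set (Sym2 V)) {n : ℕ} (ρ ρ' : Fin n → V) : Prop :=
  (∀ i, ρ' i ∈ upperRestrict o (ρ i) Q) ∨ (∀ i, ρ' i ∈ lowerRestrict o (ρ i) Q)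

/-- The multifacility location function `c · d_{G,h}`. The ground set is the disjoint union of
the vertex set and the set of the `n` new facilities. The values of `c` on the diagonal and on
pairs of vertices play no role. -/
noncomputable def cost [Fintype V] (G : SimpleGraph V) (h : Sym2 V → ℝ) {n : ℕ}
    (c : Sym2 (V ⊕ Fin n) → ℚ≥0) (ρ : Fin n → V) : ℝ :=
  (∑ s : V, ∑ j : Fin n, (c s(Sum.inl s, Sum.inr j) : ℝ) * wdist G h s (ρ j)) +
    ∑ i : Fin n, ∑ j ∈ Finset.Ioi i,
      (c s(Sum.inr i, Sum.inr j) : ℝ) * wdist G h (ρ i) (ρ j)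

/-- `ρ` minimizes `c · d_{G,h}` over all locations. -/
def IsOptimal [Fintype V] (G : SimpleGraph V) (h : Sym2 V → ℝ) {n : ℕ}
    (c : Sym2 (V ⊕ Fin n) → ℚ≥0) (ρ : Fin n → V) : Prop :=
  ∀ ρ' : Fin n → V, cost G h c ρ ≤ cost G h c ρ'

end Multifac

/-! The core is a local-to-global principle: for any metric `D` additive along geodesics of Γ
(`GeoMetric`), a location that no neighbor improves is optimal (`local_optimal`).

Locally the vertex order is modular. Geodesics between comparable vertices are monotone, and
principal filters and ideals are gated. Hence pairs bounded below have meets, pairs bounded above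
have joins, pairwise bounded triples are bounded, and opposite sides of a meet-join square are
equally long for `D`. A pair is Boolean exactly when its upper end is the join of the atoms of the
interval (`booleanPair_iff`); this lattice-theoretic form is the one used throughout.

The location function then has two convexity properties. If α and β lie above z, the meet together
with a weighted family of fractional joins costs at most as much as α and β (`joinLip`). If α lies
below z and β above, with Boolean pairs, a weighted family of Boolean intervals [x, y] through z
does the same (`intervalLip`). The families consist of maximizers of (1 - t) A + t B as t runs over
[0, 1], and the weights are lengths of the cells on which a maximizer persists. Uncrossing makes the
maximizers monotone in the data, and telescoping the slopes of the value function gives the exact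
constant. Different base vertices are joined by moving the base along a geodesic, with gates as
intermediate data.

With these inequalities a peak on a path of neighboring locations can be bypassed strictly below its
height (`peak`). Lowering the height of a path from ρ to a better location as far as possible leaves
a path that improves on ρ in its first step.

Changing h is a separate matter. Opposite sides of 4-cycles have equal length, so every geodesic of
Γ is shortest for h, and the metric for h is a positive combination of the metrics of orbit
indicators. A Q-neighbor changes only the Q-summand, and every neighbor projects to a Q-neighbor
without changing the Q-summand. Neighbor optimality thus splits into one condition per orbit, in
which h does not occur. -/

namespace Multifac

/-! ### Metric properties of modular graphs -/

variable {V : Type*} {G : SimpleGraph V} {o : V → V → Prop}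

/-- A connected modular graph with an admissible orientation. -/
structure OrientedModular (G : SimpleGraph V) (o : V → V → Prop) : Prop where
  conn : G.Connected
  mod : IsModular G
  adm : IsAdmissible G o

/-- The reversed orientation. -/
def rev (o : V → V → Prop) : V → V → Prop := fun p q => o q p

theorem preceq_rev {a b : V} : Preceq (rev o) a b ↔ Preceq o b a :=
  Relation.reflTransGen_swap

namespace OrientedModular

variable (M : OrientedModular G o)
include M

theorem reverse : OrientedModular G (rev o) where
  conn := M.conn
  mod := M.mod
  adm :=
    { adj := fun p q h => (M.adm.adj q p h).symm
      total := fun p q h => (M.adm.total p q h).symm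
      asymm := fun p q h => M.adm.asymm q p h
      fourCycle := fun u v v' u' h =>
        M.adm.fourCycle v u u' v' ⟨h.1.symm, h.2.2.2.1.symm, h.2.2.1.symm, h.2.1.symm,
          h.2.2.2.2.2, h.2.2.2.2.1⟩ }

theorem triangle (x y z : V) : G.dist x z ≤ G.dist x y + G.dist y z :=
  M.conn.dist_triangle

theorem eq_of_dist {x y : V} (h : G.dist x y = 0) : x = y :=
  M.conn.dist_eq_zero_iff.1 h

/-- Modular graphs are bipartite: a median of u, v, x lies between the adjacent vertices u and v, so
it is one of them. -/
theorem dist_adj {u v : V} (h : G.Adj u v) (x : V) :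
    G.dist x u = G.dist x v + 1 ∨ G.dist x v = G.dist x u + 1 := by
  obtain ⟨m, h1, h2, h3⟩ := M.mod u v x
  have huv := SimpleGraph.dist_eq_one_iff_adj.2 h
  unfold InInterval at *
  have hc := G.dist_comm (u := u) (v := x)
  rcases Nat.eq_zero_or_pos (G.dist u m) with h0 | h0
  · obtain rfl := M.eq_of_dist h0
    rw [G.dist_comm (u := v) (v := u), G.dist_comm (u := v) (v := x)] at h2
    omega
  · have : G.dist m v = 0 := by omega
    obtain rfl := M.eq_of_dist this
    rw [G.dist_comm (u := m) (v := u)] at h3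
    omega

theorem dist_adj' {u v : V} (h : G.Adj u v) (x : V) :
    G.dist u x = G.dist v x + 1 ∨ G.dist v x = G.dist u x + 1 := by
  rw [G.dist_comm (u := u), G.dist_comm (u := v)]; exact M.dist_adj h x

theorem dist_two {x u w : V} (hu : G.Adj x u) (hw : G.Adj x w) (hne : u ≠ w) :
    G.dist u w = 2 := by
  have h1 := M.dist_adj hw u
  have h2 := SimpleGraph.dist_eq_one_iff_adj.2 hu.symm
  have h3 : G.dist u w ≠ 0 := fun h => hne (M.eq_of_dist h)
  omega

/-- The quadrangle condition. -/
theorem quadrangle {v x u w : V} (hu : G.Adj x u) (hw : G.Adj x w) (hne : u ≠ w)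
    (h1 : G.dist v u + 1 = G.dist v x) (h2 : G.dist v w + 1 = G.dist v x) :
    ∃ y, G.Adj u y ∧ G.Adj w y ∧ G.dist v y + 2 = G.dist v x := by
  obtain ⟨m, i1, i2, i3⟩ := M.mod u w v
  have h := M.dist_two hu hw hne
  unfold InInterval at *
  have e1 := G.dist_comm (u := u) (v := m)
  have e2 := G.dist_comm (u := w) (v := m)
  have e3 := G.dist_comm (u := v) (v := m)
  have e4 := G.dist_comm (u := v) (v := w)
  refine ⟨m, SimpleGraph.dist_eq_one_iff_adj.1 ?_, SimpleGraph.dist_eq_one_iff_adj.1 ?_, ?_⟩ <;>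
    omega

theorem exists_step {x v : V} (hne : x ≠ v) : ∃ u, G.Adj x u ∧ G.dist v u + 1 = G.dist v x := by
  obtain ⟨p, hp⟩ := M.conn.exists_walk_length_eq_dist x v
  cases p with
  | nil => exact absurd rfl hne
  | @cons _ u _ h p =>
    refine ⟨u, h, ?_⟩
    have := G.dist_le p
    rw [SimpleGraph.Walk.length_cons] at hp
    have h2 := M.dist_adj' h v
    rw [G.dist_comm (u := v), G.dist_comm (u := v)]
    omega

end OrientedModular

/-! ### Gated sets -/

/-- `K` is gated: every vertex has a gate in `K`. -/
def Gated (G : SimpleGraph V) (K : Set V) : Prop :=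
  ∀ v, ∃ g ∈ K, ∀ x ∈ K, G.dist v x = G.dist v g + G.dist g x

namespace OrientedModular

variable (M : OrientedModular G o)
include M

/-- A set in which every vertex can be reached from the vertex `z` and which contains the common
neighbors of any two of its vertices at distance two is gated. -/
theorem gated_of_local {K : Set V} {z : V} (hz : z ∈ K)
    (hK : ∀ x ∈ K, ∃ w : G.Walk z x, ∀ y ∈ w.support, y ∈ K)
    (hloc : ∀ x ∈ K, ∀ y ∈ K, G.dist x y = 2 → ∀ w, G.Adj x w → G.Adj w y → w ∈ K) :
    Gated G K := by
  classical
  have hKc : (G.induce K).Preconnected := by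
    have key : ∀ x : K, (G.induce K).Reachable ⟨z, hz⟩ x := by
      rintro ⟨x, hx⟩
      obtain ⟨w, hw⟩ := hK x hx
      exact ⟨w.induce K hw⟩
    exact fun x y => (key x).symm.trans (key y)
  have hKconn : (G.induce K).Connected := { preconnected := hKc, nonempty := ⟨⟨z, hz⟩⟩ }
  have main : ∀ (v : V) (g : K), (∀ x : K, G.dist v g ≤ G.dist v x) → ∀ (n : ℕ) (x : K),
      (G.induce K).dist g x = n → G.dist v x = G.dist v g + n := by
    intro v g hg n
    induction n using Nat.strong_induction_on with
    | _ n ih =>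
      intro x hx
      rcases Nat.eq_zero_or_pos n with rfl | hn
      · obtain rfl := hKconn.dist_eq_zero_iff.1 hx
        rfl
      obtain ⟨p, hp⟩ := hKconn.exists_walk_length_eq_dist x g
      rw [SimpleGraph.dist_comm, hx] at hp
      cases p with
      | nil => simp at hp; omega
      | @cons _ y _ h p =>
        rw [SimpleGraph.Walk.length_cons] at hp
        have hxy : G.Adj x.1 y.1 := h
        have hy1 := (G.induce K).dist_le p
        have hy2 := hKconn.dist_triangle (u := g) (v := y) (w := x)
        have hyx := SimpleGraph.dist_eq_one_iff_adj.2 h.symm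
        rw [SimpleGraph.dist_comm] at hy1
        have hy : (G.induce K).dist g y = n - 1 := by omega
        have hvy := ih (n - 1) (by omega) y hy
        have hd := M.dist_adj hxy v
        have hgx := hg x
        by_contra hne
        have hvx : G.dist v x + 1 = G.dist v y := by omega
        cases p with
        | nil => simp at hp; omega
        | @cons _ u _ h' p =>
          rw [SimpleGraph.Walk.length_cons] at hp
          have hyu : G.Adj y.1 u.1 := h'
          have hu1 := (G.induce K).dist_le p
          have hu2 := hKconn.dist_triangle (u := g) (v := u) (w := y)
          have huy := SimpleGraph.dist_eq_one_iff_adj.2 h'.symm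
          rw [SimpleGraph.dist_comm] at hu1
          have hu : (G.induce K).dist g u = n - 2 := by omega
          have hvu := ih (n - 2) (by omega) u hu
          have hxu : x.1 ≠ u.1 := by
            intro e
            have : x = u := Subtype.ext e
            subst this
            omega
          -- Both x and u are one step closer to v than y. Their common neighbor w lies in K at
          -- induced distance n - 1 from g, like y, yet it is two steps closer to v than y, against
          -- the induction hypothesis.
          obtain ⟨w, hw1, hw2, hw3⟩ := M.quadrangle hxy.symm hyu hxu hvx (by omega)
          have hwK : w ∈ K := hloc x x.2 u u.2 (M.dist_two hxy.symm hyu hxu) w hw1 hw2.symm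
          have hwu : (G.induce K).Adj u ⟨w, hwK⟩ := hw2
          have hwx : (G.induce K).Adj ⟨w, hwK⟩ x := hw1.symm
          have t1 := hKconn.dist_triangle (u := g) (v := u) (w := ⟨w, hwK⟩)
          have t2 := hKconn.dist_triangle (u := g) (v := ⟨w, hwK⟩) (w := x)
          rw [SimpleGraph.dist_eq_one_iff_adj.2 hwu] at t1
          rw [SimpleGraph.dist_eq_one_iff_adj.2 hwx] at t2
          have := ih _ (by omega) ⟨w, hwK⟩ rfl
          simp only at this
          omega
  intro v
  obtain ⟨g, hg⟩ : ∃ g : K, ∀ x : K, G.dist v g ≤ G.dist v x := by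
    have : Nonempty K := ⟨⟨z, hz⟩⟩
    exact ⟨Function.argmin (fun x : K => G.dist v x),
      fun x => Function.argmin_le (fun x : K => G.dist v x) x⟩
  refine ⟨g, g.2, fun x hx => ?_⟩
  have h1 := main v g hg _ ⟨x, hx⟩ rfl
  -- With v = g the same count identifies induced distances from g with distances in the whole
  -- graph.
  have h2 := main g g (fun x => by simp) _ ⟨x, hx⟩ rfl
  simp only [SimpleGraph.dist_self, zero_add] at h1 h2
  rw [h1, h2]

end OrientedModular

/-! ### The order generated by the orientation -/

/-- Directed paths with a given number of edges. -/
inductive DirPath (o : V → V → Prop) : ℕ → V → V → Prop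
  | refl (p : V) : DirPath o 0 p p
  | tail {k : ℕ} {p q r : V} : DirPath o k p q → o q r → DirPath o (k + 1) p r

theorem preceq_iff_dirPath {p q : V} : Preceq o p q ↔ ∃ k, DirPath o k p q := by
  constructor
  · intro h
    induction h with
    | refl => exact ⟨0, .refl p⟩
    | tail _ h ih => exact ⟨_, ih.choose_spec.tail h⟩
  · rintro ⟨k, h⟩
    induction h with
    | refl => exact .refl
    | tail _ h ih => exact ih.tail h

theorem Preceq.refl (p : V) : Preceq o p p := Relation.ReflTransGen.refl

theorem Preceq.trans {p q r : V} (h : Preceq o p q) (h' : Preceq o q r) : Preceq o p r :=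
  Relation.ReflTransGen.trans h h'

theorem Preceq.of_edge {p q : V} (h : o p q) : Preceq o p q := Relation.ReflTransGen.single h

namespace OrientedModular

variable (M : OrientedModular G o)
include M

/-- If the last edge of a directed path returned towards p, a quadrangle would carry it one vertex
back. The result is a directed path of the previous length ending two steps too close to p. -/
theorem dist_dirPath : ∀ (k : ℕ) (p q : V), DirPath o k p q → G.dist p q = k := by
  intro k
  induction k using Nat.strong_induction_on with
  | _ k ih =>
    intro p r h
    cases h with
    | refl => simp
    | @tail k _ q _ hpq hqr =>
      have e1 := ih k (by omega) p q hpq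
      have hqr' := M.adm.adj _ _ hqr
      have hd := M.dist_adj hqr' p
      by_contra hne
      have hr : G.dist p r + 1 = G.dist p q := by omega
      cases hpq with
      | refl => simp at hr
      | @tail k _ q' _ hpq' hq' =>
        have e2 := ih k (by omega) p q' hpq'
        have hq'' := M.adm.adj _ _ hq'
        have hne' : q' ≠ r := by
          rintro rfl
          exact M.adm.asymm _ _ hq' hqr
        obtain ⟨w, hw1, hw2, hw3⟩ := M.quadrangle hq''.symm hqr' hne' (by omega) hr
        have hqw : q ≠ w := by
          rintro rfl
          omega
        have : o q' w := (M.adm.fourCycle q r w q' ⟨hqr', hw2, hw1.symm, hq'', hqw, hne'.symm⟩).1 hqr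
        have := ih _ (by omega) p w (hpq'.tail this)
        omega

theorem dist_add_of_preceq {p q r : V} (h : Preceq o p q) (h' : Preceq o q r) :
    InInterval G p r q := by
  obtain ⟨k, hk⟩ := preceq_iff_dirPath.1 h
  obtain ⟨l, hl⟩ := preceq_iff_dirPath.1 h'
  have : DirPath o (k + l) p r := by
    clear M h h'
    induction hl with
    | refl => exact hk
    | tail _ e ih => exact (ih hk).tail e
  unfold InInterval
  rw [M.dist_dirPath _ _ _ hk, M.dist_dirPath _ _ _ hl, M.dist_dirPath _ _ _ this]

theorem antisymm {p q : V} (h : Preceq o p q) (h' : Preceq o q p) : p = q := by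
  have := M.dist_add_of_preceq h h'
  unfold InInterval at this
  rw [G.dist_self] at this
  exact M.eq_of_dist (by omega)

/-- Compare r with the last vertex of a directed path from p to q: if they differ, a quadrangle
transports the orientation from that path to r. This makes all geodesics between comparable vertices
monotone. -/
theorem step_preceq : ∀ (n : ℕ) (p q r : V), Preceq o p q → G.dist p q = n → G.Adj q r →
    G.dist p r + 1 = n → o r q ∧ Preceq o p r := by
  intro n
  induction n with
  | zero => intro p q r _ _ _ h; omega
  | succ n ih =>
    intro p q r hpq hn hqr hr
    rcases Relation.ReflTransGen.cases_tail hpq with rfl | ⟨q1, h1, h2⟩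
    · simp at hn
    have e := M.dist_add_of_preceq h1 (.of_edge h2)
    have hadj := M.adm.adj _ _ h2
    rw [InInterval, SimpleGraph.dist_eq_one_iff_adj.2 hadj] at e
    by_cases hne : q1 = r
    · subst hne
      exact ⟨h2, h1⟩
    obtain ⟨y, hy1, hy2, hy3⟩ := M.quadrangle (v := p) hadj.symm hqr hne (by omega) (by omega)
    obtain ⟨hy4, hy5⟩ := ih p q1 y h1 (by omega) hy1 (by omega)
    have hyq : y ≠ q := by
      rintro rfl
      omega
    have c1 : o r q := (M.adm.fourCycle y q1 q r ⟨hy1.symm, hadj, hqr, hy2, hyq, hne⟩).1 hy4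
    have c2 : o y r :=
      (M.adm.fourCycle q1 q r y ⟨hadj, hqr, hy2, hy1.symm, hne, hyq.symm⟩).1 h2
    exact ⟨c1, hy5.trans (.of_edge c2)⟩

theorem preceq_of_inInterval {p q z : V} (h : Preceq o p q) (hz : InInterval G p q z) :
    Preceq o p z ∧ Preceq o z q := by
  obtain ⟨n, hn⟩ : ∃ n, G.dist z q = n := ⟨_, rfl⟩
  induction n generalizing q with
  | zero =>
    obtain rfl := M.eq_of_dist hn
    exact ⟨h, .refl _⟩
  | succ n ih =>
    have hne : q ≠ z := by
      rintro rfl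
      simp at hn
    obtain ⟨u, hu1, hu2⟩ := M.exists_step hne
    unfold InInterval at hz
    have t1 := M.triangle p z u
    have t2 := M.triangle p u q
    have := SimpleGraph.dist_eq_one_iff_adj.2 hu1.symm
    obtain ⟨c1, c2⟩ := M.step_preceq _ p q u h rfl hu1 (by omega)
    obtain ⟨d1, d2⟩ := ih c2 (by unfold InInterval; omega) (by omega)
    exact ⟨d1, d2.trans (.of_edge c1)⟩

theorem edge_iff {p q : V} : o p q ↔ G.Adj p q ∧ Preceq o p q := by
  constructor
  · exact fun h => ⟨M.adm.adj _ _ h, .of_edge h⟩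
  · rintro ⟨h1, h2⟩
    refine (M.step_preceq _ p q p h2 rfl h1.symm ?_).1
    rw [G.dist_self, SimpleGraph.dist_eq_one_iff_adj.2 h1]

/-- A directed path realizes every comparable pair inside the interval. -/
theorem exists_walk_between {z x : V} (h : Preceq o z x) :
    ∃ w : G.Walk z x, ∀ y ∈ w.support, Preceq o z y ∧ Preceq o y x := by
  induction h with
  | refl => exact ⟨.nil, by simp [Preceq.refl]⟩
  | @tail b c hb hc ih =>
    obtain ⟨w, hw⟩ := ih
    refine ⟨w.concat (M.adm.adj _ _ hc), fun y hy => ?_⟩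
    rw [SimpleGraph.Walk.support_concat, List.mem_append, List.mem_singleton] at hy
    rcases hy with hy | rfl
    · exact ⟨(hw y hy).1, (hw y hy).2.trans (.of_edge hc)⟩
    · exact ⟨Preceq.trans hb (.of_edge hc), .refl _⟩

/-- Two vertices with a common lower neighbor have no other one. -/
theorem lower_unique {x y m w : V} (hne : x ≠ y) (h1 : o m x) (h2 : o m y) (h3 : o w x)
    (h4 : o w y) : m = w := by
  by_contra hmw
  exact M.adm.asymm _ _ h4 ((M.adm.fourCycle m x w y ⟨M.adm.adj _ _ h1, (M.adm.adj _ _ h3).symm,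
    M.adm.adj _ _ h4, (M.adm.adj _ _ h2).symm, hmw, hne⟩).1 h1)

/-- By the local criterion the only doubtful case is a common lower neighbor w of x and y. -/
theorem upSet_gated (z : V) : Gated G {x | Preceq o z x} := by
  refine M.gated_of_local (z := z) (Preceq.refl z) (fun x hx => ?_) ?_
  · obtain ⟨w, hw⟩ := M.exists_walk_between hx
    exact ⟨w, fun y hy => (hw y hy).1⟩
  · intro x hx y hy hd w hxw hwy
    have hx' : Preceq o z x := hx
    have hy' : Preceq o z y := hy
    rcases M.adm.total _ _ hxw with h1 | h1
    · exact hx'.trans (.of_edge h1)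
    rcases M.adm.total _ _ hwy with h2 | h2
    swap
    · exact hy'.trans (.of_edge h2)
    -- The median lies above z and is itself a common lower neighbor of x and y, so it equals w.
    obtain ⟨m, i1, i2, i3⟩ := M.mod z x y
    obtain ⟨a1, a2⟩ := M.preceq_of_inInterval hx' i1
    have i3' : InInterval G z y m := by
      unfold InInterval at *
      rw [G.dist_comm (u := z) (v := y), ← i3, G.dist_comm (u := z), G.dist_comm (u := y), add_comm]
    obtain ⟨b1, b2⟩ := M.preceq_of_inInterval hy' i3'
    have hncomp : ∀ {x y : V}, o w x → o w y → G.dist x y = 2 → ¬ Preceq o x y := by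
      intro x y h1 h2 hd h
      have := M.dist_add_of_preceq (.of_edge h1) h
      rw [InInterval, SimpleGraph.dist_eq_one_iff_adj.2 (M.adm.adj _ _ h1),
        SimpleGraph.dist_eq_one_iff_adj.2 (M.adm.adj _ _ h2)] at this
      omega
    have hmx : G.dist x m ≠ 0 := by
      intro h
      obtain rfl := M.eq_of_dist h
      exact hncomp h1 h2 hd b2
    have hmy : G.dist m y ≠ 0 := by
      intro h
      obtain rfl := M.eq_of_dist h
      exact hncomp h2 h1 (by rw [G.dist_comm]; exact hd) a2
    unfold InInterval at i2
    have e1 : o m x := M.edge_iff.2 ⟨(SimpleGraph.dist_eq_one_iff_adj.1 (by omega)).symm, a2⟩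
    have e2 : o m y := M.edge_iff.2 ⟨SimpleGraph.dist_eq_one_iff_adj.1 (by omega), b2⟩
    have hne : x ≠ y := by
      rintro rfl
      simp at hd
    obtain rfl := M.lower_unique hne e1 e2 h1 h2
    exact a1

theorem downSet_gated (z : V) : Gated G {x | Preceq o x z} := by
  have := M.reverse.upSet_gated z
  simpa only [preceq_rev] using this

/-- Gated sets are convex. -/
theorem mem_of_gated {K : Set V} (hK : Gated G K) {x y w : V} (hx : x ∈ K) (hy : y ∈ K)
    (hw : InInterval G x y w) : w ∈ K := by
  obtain ⟨g, hg, h⟩ := hK w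
  have h1 := h x hx
  have h2 := h y hy
  have t := M.triangle x g y
  unfold InInterval at hw
  rw [G.dist_comm (u := x) (v := g)] at t
  rw [G.dist_comm (u := x) (v := w)] at hw
  have : w = g := M.eq_of_dist (by omega)
  exact this ▸ hg

end OrientedModular

/-! ### Meets, joins and the modular law -/

/-- `m` is the greatest common lower bound of `a` and `b`. -/
def IsInf (o : V → V → Prop) (a b m : V) : Prop :=
  Preceq o m a ∧ Preceq o m b ∧ ∀ n, Preceq o n a → Preceq o n b → Preceq o n m

/-- `j` is the least common upper bound of `a` and `b`. -/
def IsSup (o : V → V → Prop) (a b j : V) : Prop :=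
  Preceq o a j ∧ Preceq o b j ∧ ∀ n, Preceq o a n → Preceq o b n → Preceq o j n

theorem isInf_rev {a b m : V} : IsInf (rev o) a b m ↔ IsSup o a b m := by
  simp only [IsInf, IsSup, preceq_rev]

theorem isSup_rev {a b m : V} : IsSup (rev o) a b m ↔ IsInf o a b m := by
  simp only [IsInf, IsSup, preceq_rev]

theorem IsInf.symm {a b m : V} (h : IsInf o a b m) : IsInf o b a m :=
  ⟨h.2.1, h.1, fun n h1 h2 => h.2.2 n h2 h1⟩

theorem IsSup.symm {a b m : V} (h : IsSup o a b m) : IsSup o b a m :=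
  ⟨h.2.1, h.1, fun n h1 h2 => h.2.2 n h2 h1⟩

namespace OrientedModular

variable (M : OrientedModular G o)
include M

theorem isInf_unique {a b m m' : V} (h : IsInf o a b m) (h' : IsInf o a b m') : m = m' :=
  M.antisymm (h'.2.2 m h.1 h.2.1) (h.2.2 m' h'.1 h'.2.1)

/-- The meet is the gate of b in the ideal of a: for every common lower bound n the gate lies on a
geodesic from n to b, and such geodesics are monotone. -/
theorem exists_inf' {a b z : V} (ha : Preceq o z a) (hb : Preceq o z b) :
    ∃ m, IsInf o a b m ∧ InInterval G a b m := by
  obtain ⟨m, hm, h⟩ := M.downSet_gated a b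
  have key : ∀ n, Preceq o n a → Preceq o n b → Preceq o n m ∧ Preceq o m b := by
    intro n h1 h2
    have := h n h1
    refine M.preceq_of_inInterval h2 ?_
    unfold InInterval
    rw [G.dist_comm (u := n) (v := m), G.dist_comm (u := n) (v := b), G.dist_comm (u := m) (v := b)]
    omega
  refine ⟨m, ⟨hm, (key z ha hb).2, fun n h1 h2 => (key n h1 h2).1⟩, ?_⟩
  have := h a (Preceq.refl a)
  unfold InInterval
  rw [G.dist_comm (u := a) (v := m), G.dist_comm (u := a) (v := b), G.dist_comm (u := m) (v := b)]
  omega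

theorem exists_inf {a b z : V} (ha : Preceq o z a) (hb : Preceq o z b) : ∃ m, IsInf o a b m :=
  (M.exists_inf' ha hb).imp fun _ h => h.1

theorem exists_sup {a b z : V} (ha : Preceq o a z) (hb : Preceq o b z) : ∃ m, IsSup o a b m := by
  obtain ⟨m, h⟩ := M.reverse.exists_inf (preceq_rev.2 ha) (preceq_rev.2 hb)
  exact ⟨m, isInf_rev.1 h⟩

theorem inInterval_inf {a b m : V} (h : IsInf o a b m) : InInterval G a b m := by
  obtain ⟨m', h1, h2⟩ := M.exists_inf' h.1 h.2.1
  rwa [M.isInf_unique h h1]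

theorem inInterval_sup {a b m : V} (h : IsSup o a b m) : InInterval G a b m :=
  M.reverse.inInterval_inf (isInf_rev.2 h)

/-- Three pairwise bounded elements are bounded. -/
theorem triple_bounded {x y w a b c : V} (hxa : Preceq o x a) (hya : Preceq o y a)
    (hyb : Preceq o y b) (hwb : Preceq o w b) (hwc : Preceq o w c) (hxc : Preceq o x c) :
    ∃ u, Preceq o x u ∧ Preceq o y u ∧ Preceq o w u := by
  -- Each of x, y, w lies below two of a, b, c; its filter is convex, so it contains their median.
  obtain ⟨u, h1, h2, h3⟩ := M.mod a b c
  exact ⟨u, M.mem_of_gated (M.upSet_gated x) hxc hxa h3, M.mem_of_gated (M.upSet_gated y) hya hyb h1,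
    M.mem_of_gated (M.upSet_gated w) hwb hwc h2⟩

end OrientedModular

/-- A metric that is additive along the geodesics of `G`. -/
structure GeoMetric (G : SimpleGraph V) (D : V → V → ℝ) : Prop where
  self : ∀ p, D p p = 0
  symm : ∀ p q, D p q = D q p
  triangle : ∀ p q r, D p r ≤ D p q + D q r
  pos : ∀ p q, p ≠ q → 0 < D p q
  add : ∀ x y z, InInterval G x y z → D x z + D z y = D x y

theorem OrientedModular.geoMetric_dist (M : OrientedModular G o) :
    GeoMetric G (fun p q => (G.dist p q : ℝ)) where
  self := by simp
  symm p q := by rw [G.dist_comm]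
  triangle p q r := by exact_mod_cast M.triangle p q r
  pos p q h := by exact_mod_cast M.conn.pos_dist_of_ne h
  add x y z h := by exact_mod_cast h

namespace GeoMetric

variable {D : V → V → ℝ} (hD : GeoMetric G D)
include hD

theorem nonneg (p q : V) : 0 ≤ D p q := by
  by_cases h : p = q
  · rw [h, hD.self]
  · exact (hD.pos p q h).le

theorem eq_of_zero {p q : V} (h : D p q = 0) : p = q := by
  by_contra hne
  exact (hD.pos p q hne).ne' h

variable (M : OrientedModular G o)
include M

theorem chain {p q r : V} (h : Preceq o p q) (h' : Preceq o q r) : D p q + D q r = D p r :=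
  hD.add _ _ _ (M.dist_add_of_preceq h h')

/-- Both m and j lie between a and b, while a and b lie between m and j; additivity along these four
geodesics gives the equality. -/
theorem modular {a b m j : V} (hm : IsInf o a b m) (hj : IsSup o a b j) :
    D m a = D b j := by
  have h1 := hD.add _ _ _ (M.inInterval_inf hm)
  have h2 := hD.add _ _ _ (M.inInterval_sup hj)
  have h3 := hD.chain M hm.1 hj.1
  have h4 := hD.chain M hm.2.1 hj.2.1
  rw [hD.symm a m] at h1
  rw [hD.symm j b] at h2
  linarith

end GeoMetric

theorem OrientedModular.dist_modular (M : OrientedModular G o) {a b m j : V} (hm : IsInf o a b m)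
    (hj : IsSup o a b j) : G.dist m a = G.dist b j := by
  exact_mod_cast M.geoMetric_dist.modular M hm hj

end Multifac

/-! ### Boolean pairs as atomistic intervals -/

namespace Multifac

variable {V : Type*} {G : SimpleGraph V} {o : V → V → Prop}

/-- `q` is the join of the covers of `p` below `q`. -/
def Atomistic (o : V → V → Prop) (p q : V) : Prop :=
  Preceq o p q ∧ ∀ u, Preceq o p u → Preceq o u q → (∀ a, o p a → Preceq o a q → Preceq o a u) →
    u = q

theorem exists_first {p q : V} (h : Preceq o p q) (hne : p ≠ q) : ∃ a, o p a ∧ Preceq o a q := by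
  rcases Relation.ReflTransGen.cases_head h with rfl | h
  · exact absurd rfl hne
  · exact h

theorem exists_last {p q : V} (h : Preceq o p q) (hne : p ≠ q) : ∃ a, Preceq o p a ∧ o a q := by
  rcases Relation.ReflTransGen.cases_tail h with rfl | h
  · exact absurd rfl hne
  · exact h

namespace OrientedModular

variable (M : OrientedModular G o)
include M

theorem edge_ne {p q : V} (h : o p q) : p ≠ q := (M.adm.adj _ _ h).ne

theorem dist_edge {p q : V} (h : o p q) : G.dist p q = 1 :=
  SimpleGraph.dist_eq_one_iff_adj.2 (M.adm.adj _ _ h)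

theorem not_preceq_of_edge {p q : V} (h : o p q) : ¬ Preceq o q p :=
  fun h' => M.edge_ne h (M.antisymm (.of_edge h) h')

theorem edge_of_dist {p q : V} (h : Preceq o p q) (h1 : G.dist p q = 1) : o p q :=
  M.edge_iff.2 ⟨SimpleGraph.dist_eq_one_iff_adj.1 h1, h⟩

theorem eq_or_eq_of_edge {p m a : V} (h : o p a) (h1 : Preceq o p m) (h2 : Preceq o m a) :
    m = p ∨ m = a := by
  have := M.dist_add_of_preceq h1 h2
  rw [InInterval, M.dist_edge h] at this
  rcases Nat.eq_zero_or_pos (G.dist p m) with h0 | h0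
  · exact .inl (M.eq_of_dist h0).symm
  · exact .inr (M.eq_of_dist (by omega))

theorem inf_of_edge {p a c : V} (h : o p a) (hc : Preceq o p c) (hac : ¬ Preceq o a c) :
    IsInf o a c p := by
  obtain ⟨m, hm⟩ := M.exists_inf (.of_edge h) hc
  rcases M.eq_or_eq_of_edge h (hm.2.2 p (.of_edge h) hc) hm.1 with rfl | rfl
  · exact hm
  · exact absurd hm.2.1 hac

theorem sup_of_edge {p a c : V} (h : o a p) (hc : Preceq o c p) (hac : ¬ Preceq o c a) :
    IsSup o a c p :=
  isInf_rev.1 (M.reverse.inf_of_edge h (preceq_rev.2 hc) (fun h => hac (preceq_rev.1 h)))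

/-- Joining with an atom gives a cover. -/
theorem edge_sup {p a c j : V} (h : o p a) (hc : Preceq o p c) (hac : ¬ Preceq o a c)
    (hj : IsSup o c a j) : o c j := by
  have := M.dist_modular (M.inf_of_edge h hc hac) hj.symm
  rw [M.dist_edge h] at this
  exact M.edge_of_dist hj.1 this.symm

theorem atomistic_refl (p : V) : Atomistic o p p :=
  ⟨.refl p, fun _ h1 h2 _ => M.antisymm h2 h1⟩

theorem atomistic_edge {p q : V} (h : o p q) : Atomistic o p q :=
  ⟨.of_edge h, fun _ _ h2 h3 => M.antisymm h2 (h3 q h (.refl q))⟩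

/-- Starting from x = p, atoms outside x ∨ u are joined to x until x ∨ u = q. Such a step keeps the
meet with u: the new element covers x and is not below x ∨ u, so its meet with x ∨ u is still x. -/
theorem exists_complement {p q u : V} (h : Atomistic o p q) (hpu : Preceq o p u)
    (huq : Preceq o u q) : ∃ x, IsInf o x u p ∧ IsSup o x u q := by
  suffices H : ∀ (n : ℕ) (x : V), Preceq o x q → G.dist x q = n → IsInf o x u p →
      ∃ x, IsInf o x u p ∧ IsSup o x u q from
    H _ p h.1 rfl ⟨.refl p, hpu, fun n h _ => h⟩
  intro n
  induction n with
  | zero =>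
    intro x _ hn hx
    obtain rfl := M.eq_of_dist hn
    exact ⟨x, hx, .refl x, huq, fun _ h _ => h⟩
  | succ n ih =>
    intro x hxq hn hx
    obtain ⟨j, hj⟩ := M.exists_sup hxq huq
    by_cases hjq : j = q
    · exact ⟨x, hx, hjq ▸ hj⟩
    obtain ⟨a, ha1, ha2, ha3⟩ : ∃ a, o p a ∧ Preceq o a q ∧ ¬ Preceq o a j := by
      by_contra hcon
      push Not at hcon
      exact hjq (h.2 j (hpu.trans hj.2.1) (hj.2.2 q hxq huq) hcon)
    obtain ⟨y, hy⟩ := M.exists_sup hxq ha2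
    have hxy := M.edge_sup ha1 hx.1 (fun h => ha3 (h.trans hj.1)) hy
    have hyq := hy.2.2 q hxq ha2
    refine ih y hyq ?_ ?_
    · have := M.dist_add_of_preceq (.of_edge hxy) hyq
      rw [InInterval, M.dist_edge hxy] at this
      omega
    obtain ⟨m, hm⟩ := M.exists_inf (hx.1.trans hy.1) hpu
    have h1 := M.inf_of_edge hxy hj.1 (fun h => ha3 (hy.2.1.trans h))
    have h2 := hx.2.2 m (h1.2.2 m hm.1 (hm.2.1.trans hj.2.1)) hm.2.1
    rwa [← M.antisymm h2 (hm.2.2 p (hx.1.trans hy.1) hpu)]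

theorem atomistic_upper {p q c : V} (h : Atomistic o p q) (hpc : Preceq o p c)
    (hcq : Preceq o c q) : Atomistic o c q := by
  refine ⟨hcq, fun u h1 h2 h3 => h.2 u (hpc.trans h1) h2 fun a ha haq => ?_⟩
  by_cases hac : Preceq o a c
  · exact hac.trans h1
  obtain ⟨j, hj⟩ := M.exists_sup hcq haq
  exact hj.2.1.trans (h3 j (M.edge_sup ha hpc hac hj) (hj.2.2 q hcq haq))

/-- Let u ≤ c contain all atoms below c and let x be a complement of u. An atom below x ∧ c would
lie below x ∧ u = p, so x ∧ c = p. By the modular law u and c are equally far from p, hence equal.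
-/
theorem atomistic_lower {p q c : V} (h : Atomistic o p q) (hpc : Preceq o p c)
    (hcq : Preceq o c q) : Atomistic o p c := by
  refine ⟨hpc, fun u h1 h2 h3 => ?_⟩
  obtain ⟨x, hx1, hx2⟩ := M.exists_complement h h1 (h2.trans hcq)
  have hs : IsSup o x c q := ⟨hx2.1, hcq, fun n hn hn' => hx2.2.2 n hn (h2.trans hn')⟩
  obtain ⟨m, hm⟩ := M.exists_inf hx1.1 hpc
  have hpm := hm.2.2 p hx1.1 hpc
  by_cases hmp : p = m
  · subst hmp
    have e1 := M.dist_modular hx1.symm hx2.symm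
    have e2 := M.dist_modular hm.symm hs.symm
    have e3 := M.dist_add_of_preceq h1 h2
    unfold InInterval at e3
    exact M.eq_of_dist (by omega)
  · obtain ⟨a, ha1, ha2⟩ := exists_first hpm hmp
    have := h3 a ha1 (ha2.trans hm.2.1)
    exact absurd (hx1.2.2 a (ha2.trans hm.1) this) (M.not_preceq_of_edge ha1)

theorem atomistic_sup {z x y j : V} (hx : Atomistic o z x) (hy : Atomistic o z y)
    (hj : IsSup o x y j) : Atomistic o z j := by
  refine ⟨hx.1.trans hj.1, fun u h1 h2 h3 => M.antisymm h2 (hj.2.2 u ?_ ?_)⟩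
  · obtain ⟨m, hm⟩ := M.exists_inf h1 hx.1
    rw [← hx.2 m (hm.2.2 z h1 hx.1) hm.2.1 fun a ha hax => hm.2.2 a (h3 a ha (hax.trans hj.1)) hax]
    exact hm.1
  · obtain ⟨m, hm⟩ := M.exists_inf h1 hy.1
    rw [← hy.2 m (hm.2.2 z h1 hy.1) hm.2.1 fun a ha hax =>
      hm.2.2 a (h3 a ha (hax.trans hj.2.1)) hax]
    exact hm.1

end OrientedModular

theorem cube_mono {k : ℕ} {f : Finset (Fin k) → V}
    (hf : ∀ S i, i ∉ S → o (f S) (f (insert i S))) {S T : Finset (Fin k)} (h : S ⊆ T) :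
    Preceq o (f S) (f T) := by
  have key : ∀ U : Finset (Fin k), Preceq o (f S) (f (S ∪ U)) := by
    intro U
    induction U using Finset.induction_on with
    | empty => rw [Finset.union_empty]; exact .refl _
    | insert i U _ ih =>
      rw [Finset.union_insert]
      by_cases hi : i ∈ S ∪ U
      · rwa [Finset.insert_eq_of_mem hi]
      · exact ih.trans (.of_edge (hf _ _ hi))
  rw [← Finset.union_sdiff_of_subset h]
  exact key _

namespace OrientedModular

variable (M : OrientedModular G o)
include M

/-- This makes the cube vertices joins of its atoms: if an atom i outside insert k S lay below the
vertex of that set, two covers of the vertex of S would coincide, against injectivity. -/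
theorem cube_atom {k : ℕ} {f : Finset (Fin k) → V} (hinj : Function.Injective f)
    (hf : ∀ S i, i ∉ S → o (f S) (f (insert i S))) (S : Finset (Fin k)) :
    ∀ i, i ∉ S → ¬ Preceq o (f {i}) (f S) ∧ IsSup o (f S) (f {i}) (f (insert i S)) := by
  have step : ∀ (S : Finset (Fin k)) i, i ∉ S → ¬ Preceq o (f {i}) (f S) →
      IsSup o (f S) (f {i}) (f (insert i S)) := by
    intro S i hi hn
    have h1 : Preceq o (f {i}) (f (insert i S)) := cube_mono hf (by simp)
    exact M.sup_of_edge (hf S i hi) h1 hn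
  induction S using Finset.induction_on with
  | empty =>
    intro i hi
    have : ¬ Preceq o (f {i}) (f ∅) := M.not_preceq_of_edge (by simpa using hf ∅ i hi)
    exact ⟨this, step _ _ hi this⟩
  | insert k S hk ih =>
    intro i hi
    rw [Finset.mem_insert, not_or] at hi
    have : ¬ Preceq o (f {i}) (f (insert k S)) := by
      intro h
      have h1 := (ih i hi.2).2.2.2 _ (.of_edge (hf S k hk)) h
      rcases M.eq_or_eq_of_edge (hf S k hk) (.of_edge (hf S i hi.2)) h1 with h2 | h2
      · exact M.edge_ne (hf S i hi.2) h2.symm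
      · have h3 := hinj h2
        have : i ∈ insert k S := h3 ▸ Finset.mem_insert_self i S
        rw [Finset.mem_insert] at this
        tauto
    exact ⟨this, step _ _ (by simp [hi]) this⟩

/-- The interval itself need not be a Boolean lattice; only a spanning cube is required. It is built
by induction: take a cube for a coatom q' of q and double it by joining every vertex with an atom
that is not below q'. -/
theorem booleanPair_iff {p q : V} : BooleanPair o p q ↔ Atomistic o p q := by
  constructor
  · rintro ⟨k, f, hinj, hf, rfl, rfl⟩
    refine ⟨cube_mono hf (Finset.empty_subset _), fun u h1 h2 h3 => M.antisymm h2 ?_⟩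
    have key : ∀ S, Preceq o (f S) u := by
      intro S
      induction S using Finset.induction_on with
      | empty => exact h1
      | insert i S hi ih =>
        refine (M.cube_atom hinj hf S i hi).2.2.2 u ih (h3 _ ?_ (cube_mono hf (by simp)))
        simpa using hf ∅ i (by simp)
    exact key _
  · intro h
    obtain ⟨k, hk⟩ : ∃ k, G.dist p q = k := ⟨_, rfl⟩
    induction k generalizing q with
    | zero =>
      obtain rfl := M.eq_of_dist hk
      exact ⟨0, fun _ => p, Function.injective_of_subsingleton _, fun _ i => i.elim0, rfl, rfl⟩
    | succ k ih =>
      have hne : p ≠ q := by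
        rintro rfl
        simp at hk
      obtain ⟨q', hq1, hq2⟩ := exists_last h.1 hne
      have hd := M.dist_add_of_preceq hq1 (.of_edge hq2)
      rw [InInterval, M.dist_edge hq2] at hd
      obtain ⟨l, f, hinj, hf, hf0, hf1⟩ :=
        ih (M.atomistic_lower h hq1 (.of_edge hq2)) (by omega)
      obtain ⟨a, ha1, ha2, ha3⟩ : ∃ a, o p a ∧ Preceq o a q ∧ ¬ Preceq o a q' := by
        by_contra hcon
        push Not at hcon
        exact M.edge_ne hq2 (h.2 q' hq1 (.of_edge hq2) hcon)
      have hfp : ∀ S, Preceq o p (f S) := fun S => hf0 ▸ cube_mono hf (Finset.empty_subset S)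
      have hfq : ∀ S, Preceq o (f S) q' := fun S => hf1 ▸ cube_mono hf (Finset.subset_univ S)
      have hgex : ∀ S, ∃ g, IsSup o (f S) a g := fun S =>
        M.exists_sup ((hfq S).trans (.of_edge hq2)) ha2
      choose g hg using hgex
      have hna : ∀ S, ¬ Preceq o a (f S) := fun S h => ha3 (h.trans (hfq S))
      have hfg : ∀ S, o (f S) (g S) := fun S => M.edge_sup ha1 (hfp S) (hna S) (hg S)
      have hgn : ∀ S, ¬ Preceq o (g S) q' := fun S h => ha3 ((hg S).2.1.trans h)
      have hgg : ∀ S i, i ∉ S → o (g S) (g (insert i S)) := by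
        intro S i hi
        refine M.edge_sup (hf S i hi) (.of_edge (hfg S)) ?_ ?_
        · intro h
          rcases M.eq_or_eq_of_edge (hfg S) (.of_edge (hf S i hi)) h with e | e
          · exact M.edge_ne (hf S i hi) e.symm
          · exact hgn S (e ▸ hfq _)
        · refine ⟨(hg S).2.2 _ ?_ (hg _).2.1, (hg _).1, fun n h1 h2 =>
            (hg _).2.2 n h2 ((hg S).2.1.trans h1)⟩
          exact (Preceq.of_edge (hf S i hi)).trans (hg _).1
      have hginj : Function.Injective g := by
        intro S T hST
        have e : ∀ S, IsInf o (g S) q' (f S) := fun S => M.inf_of_edge (hfg S) (hfq S) (hgn S)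
        exact hinj (M.isInf_unique (hST ▸ e S) (e T))
      -- Coordinate 0 records whether the new atom has been joined; `r` reads off the remaining
      -- coordinates.
      let r : Finset (Fin (l + 1)) → Finset (Fin l) := fun S =>
        Finset.univ.filter fun j => j.succ ∈ S
      have hr : ∀ (S : Finset (Fin (l + 1))) (j : Fin l), j ∈ r S ↔ j.succ ∈ S := by
        intro S j
        simp [r]
      refine ⟨l + 1, fun S => if 0 ∈ S then g (r S) else f (r S), ?_, ?_, ?_, ?_⟩
      · intro S T hST
        have hboth : (0 ∈ S ↔ 0 ∈ T) ∧ r S = r T := by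
          dsimp only at hST
          by_cases h0 : (0 : Fin (l + 1)) ∈ S <;> by_cases h0' : (0 : Fin (l + 1)) ∈ T
          · rw [if_pos h0, if_pos h0'] at hST
            exact ⟨by tauto, hginj hST⟩
          · rw [if_pos h0, if_neg h0'] at hST
            exact absurd (hST ▸ hfq _) (hgn _)
          · rw [if_neg h0, if_pos h0'] at hST
            exact absurd (hST ▸ hfq _) (hgn _)
          · rw [if_neg h0, if_neg h0'] at hST
            exact ⟨by tauto, hinj hST⟩
        ext i
        refine Fin.cases hboth.1 (fun j => ?_) i
        rw [← hr, ← hr, hboth.2]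
      · intro S i
        refine Fin.cases (fun h0 => ?_) (fun j hj => ?_) i
        · have : r (insert 0 S) = r S := by
            ext j
            rw [hr, hr, Finset.mem_insert]
            simp [Fin.succ_ne_zero]
          simp only [if_neg h0, Finset.mem_insert_self, if_true, this]
          exact hfg _
        · have e : r (insert j.succ S) = insert j (r S) := by
            ext i
            rw [hr, Finset.mem_insert, Finset.mem_insert, hr, Fin.succ_inj]
          have hj' : j ∉ r S := by rwa [hr]
          have h0 : (0 ∈ insert j.succ S) ↔ (0 : Fin (l + 1)) ∈ S := by
            rw [Finset.mem_insert]
            simp [(Fin.succ_ne_zero j).symm]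
          simp only [h0, e]
          split_ifs
          · exact hgg _ _ hj'
          · exact hf _ _ hj'
      · have : r ∅ = ∅ := by
          ext j
          simp [hr]
        simp [this, hf0]
      · have : r Finset.univ = Finset.univ := by
          ext j
          simp [hr]
        simp only [Finset.mem_univ, if_true, this]
        have h1 : Preceq o (g Finset.univ) q :=
          (hg _).2.2 q ((hfq _).trans (.of_edge hq2)) ha2
        have h2 : Preceq o q' (g Finset.univ) := hf1 ▸ (hg Finset.univ).1
        rcases M.eq_or_eq_of_edge hq2 h2 h1 with e | e
        · exact absurd (e ▸ Preceq.refl _) (hgn Finset.univ)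
        · exact e

end OrientedModular

theorem booleanPair_of_rev {p q : V} (h : BooleanPair o p q) : BooleanPair (rev o) q p := by
  obtain ⟨k, f, hinj, hf, h0, h1⟩ := h
  refine ⟨k, fun S => f Sᶜ, hinj.comp compl_injective, fun S i hi => ?_, ?_, ?_⟩
  · have : Sᶜ = insert i (insert i S)ᶜ := by
      ext j
      simp only [Finset.mem_compl, Finset.mem_insert]
      by_cases h : j = i
      · simp [h, hi]
      · simp [h]
    change o (f (insert i S)ᶜ) (f Sᶜ)
    rw [this]
    exact hf _ _ (by simp)
  · simpa using h1
  · simpa using h0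

theorem booleanPair_rev {p q : V} : BooleanPair (rev o) q p ↔ BooleanPair o p q :=
  ⟨booleanPair_of_rev (o := rev o), booleanPair_of_rev⟩

theorem OrientedModular.atomistic_rev (M : OrientedModular G o) {p q : V} :
    Atomistic (rev o) q p ↔ Atomistic o p q := by
  rw [← M.booleanPair_iff, ← M.reverse.booleanPair_iff, booleanPair_rev]

end Multifac

/-! ### Gates in Boolean neighborhoods -/

namespace Multifac

variable {V : Type*} {G : SimpleGraph V} {o : V → V → Prop}

namespace OrientedModular

variable (M : OrientedModular G o)
include M

/-- The local criterion applies: a common neighbor of x and y is below one of them and above z, the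
latter by convexity of the filter when it is below both, or it is their join. -/
theorem upper_gated (z : V) : Gated G {x | Atomistic o z x} := by
  refine M.gated_of_local (z := z) (M.atomistic_refl z) (fun x hx => ?_) ?_
  · obtain ⟨w, hw⟩ := M.exists_walk_between hx.1
    exact ⟨w, fun y hy => M.atomistic_lower hx (hw y hy).1 (hw y hy).2⟩
  · intro x hx y hy hd w hxw hwy
    have hne : x ≠ y := by
      rintro rfl
      simp at hd
    have hx' : Atomistic o z x := hx
    have hy' : Atomistic o z y := hy
    rcases M.adm.total _ _ hxw with h1 | h1 <;> rcases M.adm.total _ _ hwy with h2 | h2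
    · exact M.atomistic_lower hy' (hx'.1.trans (.of_edge h1)) (.of_edge h2)
    · refine M.atomistic_sup hx' hy' (M.sup_of_edge h1 (.of_edge h2) fun h => ?_)
      rcases M.eq_or_eq_of_edge h2 h (.of_edge h1) with e | e
      · exact hne e
      · exact M.edge_ne h1 e
    · have : Preceq o z w := by
        refine M.mem_of_gated (M.upSet_gated z) hx'.1 hy'.1 ?_
        rw [InInterval, SimpleGraph.dist_eq_one_iff_adj.2 hxw,
          SimpleGraph.dist_eq_one_iff_adj.2 hwy, hd]
      exact M.atomistic_lower hx' this (.of_edge h1)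
    · exact M.atomistic_lower hx' (hy'.1.trans (.of_edge h2)) (.of_edge h1)

theorem lower_gated (z : V) : Gated G {x | Atomistic o x z} := by
  have := M.reverse.upper_gated z
  simpa only [M.atomistic_rev] using this

/-- Parallel edges have the same direction. -/
theorem edge_iff_of_parallel (e : ℕ) : ∀ z z₁ y y₁ : V, G.Adj z z₁ → G.Adj y y₁ →
    G.dist z y = e → G.dist z₁ y₁ = e → G.dist z y₁ = e + 1 → G.dist z₁ y = e + 1 →
    (o z z₁ ↔ o y y₁) := by
  induction e with
  | zero =>
    intro z z₁ y y₁ _ _ h1 h2 _ _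
    rw [M.eq_of_dist h1, M.eq_of_dist h2]
  | succ e ih =>
    intro z z₁ y y₁ hz hy h1 h2 h3 h4
    have hne : z ≠ y := by
      rintro rfl
      simp at h1
    obtain ⟨z₂, hz1, hz2⟩ := M.exists_step hne
    rw [G.dist_comm, G.dist_comm (u := y), h1] at hz2
    have t1 := M.triangle z₂ y y₁
    have t2 := M.triangle z z₂ y₁
    rw [SimpleGraph.dist_eq_one_iff_adj.2 hy] at t1
    rw [SimpleGraph.dist_eq_one_iff_adj.2 hz1] at t2
    have hne' : z₁ ≠ z₂ := by
      rintro rfl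
      omega
    -- The edge is moved across one 4-cycle along a geodesic from z to y, which shortens the
    -- distance to the edge y y₁ by one.
    obtain ⟨w, hw1, hw2, hw3⟩ := M.quadrangle (v := y₁) hz hz1 hne'
      (by rw [G.dist_comm, G.dist_comm (u := y₁)]; omega)
      (by rw [G.dist_comm, G.dist_comm (u := y₁)]; omega)
    rw [G.dist_comm, G.dist_comm (u := y₁)] at hw3
    have hwz : z ≠ w := by
      rintro rfl
      omega
    have d1 := M.dist_adj' hw2 y
    have d2 := M.dist_adj' hw1 y
    rw [← ih z₂ w y y₁ hw2 hy (by omega) (by omega) (by omega) (by omega)]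
    exact M.adm.fourCycle z z₁ w z₂ ⟨hz, hw1, hw2.symm, hz1.symm, hwz, hne'⟩

/-- The gates of the ends of an edge in a gated set containing a vertex `p` closer to the second
end and a vertex `q` closer to the first end. -/
theorem gates_parallel {K : Set V} {z z₁ y y₁ p q : V} (hz : G.Adj z z₁)
    (hy : y ∈ K) (hy₁ : y₁ ∈ K) (hg : ∀ x ∈ K, G.dist z x = G.dist z y + G.dist y x)
    (hg₁ : ∀ x ∈ K, G.dist z₁ x = G.dist z₁ y₁ + G.dist y₁ x) (hp : p ∈ K) (hq : q ∈ K)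
    (hzp : G.dist z₁ p + 1 = G.dist z p) (hzq : G.dist z q + 1 = G.dist z₁ q) :
    G.Adj y y₁ ∧ G.dist z₁ y₁ = G.dist z y ∧ G.dist y₁ p + 1 = G.dist y p ∧
      G.dist y q + 1 = G.dist y₁ q ∧ (o z z₁ ↔ o y y₁) := by
  have a1 := hg p hp
  have a2 := hg q hq
  have a3 := hg₁ p hp
  have a4 := hg₁ q hq
  have a5 := hg y₁ hy₁
  have a6 := hg₁ y hy
  have t1 := M.triangle z z₁ y₁
  have t2 := M.triangle z₁ z y
  have e := SimpleGraph.dist_eq_one_iff_adj.2 hz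
  have e' := SimpleGraph.dist_eq_one_iff_adj.2 hz.symm
  have c := G.dist_comm (u := y) (v := y₁)
  have hne : G.dist y y₁ ≠ 0 := by
    intro h
    obtain rfl := M.eq_of_dist h
    omega
  have hadj : G.Adj y y₁ := SimpleGraph.dist_eq_one_iff_adj.1 (by omega)
  refine ⟨hadj, by omega, by omega, by omega, ?_⟩
  exact M.edge_iff_of_parallel (G.dist z y) z z₁ y y₁ hz hadj rfl (by omega) (by omega) (by omega)

/-- Any vertex t that is closer to both c and z₁ than to z turns the directed path c, z, z₁ into a
square. -/
theorem square_of_dist {c z z₁ t : V} (h : o c z) (h₁ : o z z₁)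
    (hc : G.dist c t + 1 = G.dist z t) (hz : G.dist z₁ t + 1 = G.dist z t) :
    ∃ w, o w z₁ ∧ o c w ∧ w ≠ z := by
  have hne : c ≠ z₁ := by
    rintro rfl
    exact M.adm.asymm _ _ h h₁
  have e := M.adm.adj _ _ h
  have e₁ := M.adm.adj _ _ h₁
  obtain ⟨w, h1, h2, h3⟩ := M.quadrangle (v := t) e.symm e₁ hne
    (by rw [G.dist_comm, G.dist_comm (u := t)]; omega)
    (by rw [G.dist_comm, G.dist_comm (u := t)]; omega)
  have hwz : z ≠ w := by
    rintro rfl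
    omega
  exact ⟨w, (M.adm.fourCycle c z z₁ w ⟨e, e₁, h2, h1.symm, hne, hwz⟩).1 h,
    (M.adm.fourCycle z z₁ w c ⟨e₁, h2, h1.symm, e, hwz, hne.symm⟩).1 h₁, hwz.symm⟩

/-- The gate in the lower Boolean neighborhood of `z` of an element of the lower Boolean
neighborhood of `z'` belongs to the lower Boolean neighborhood of the next vertex on a geodesic
from `z` to `z'`. -/
theorem gate_lower {z z₁ z' a' g : V} (hz : G.Adj z z₁) (hz' : G.dist z₁ z' + 1 = G.dist z z')
    (ha : Atomistic o a' z') (hg : Atomistic o g z)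
    (hgate : ∀ x, Atomistic o x z → G.dist a' x = G.dist a' g + G.dist g x) :
    Atomistic o g z₁ := by
  obtain ⟨y, hy, hgy⟩ := M.lower_gated z' z
  obtain ⟨y₁, hy₁, hgy₁⟩ := M.lower_gated z' z₁
  have hy' : Atomistic o y z' := hy
  have hz0 := hgate z (M.atomistic_refl z)
  have hfar : G.dist z a' + 1 = G.dist z₁ a' →
      G.Adj y y₁ ∧ G.dist z₁ y₁ = G.dist z y ∧ o y y₁ ∧ o z z₁ := by
    intro h
    obtain ⟨h1, h2, h3, h4, h5⟩ :=
      M.gates_parallel hz hy hy₁ hgy hgy₁ (M.atomistic_refl z') ha hz' h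
    have : InInterval G y z' y₁ := by
      rw [InInterval, SimpleGraph.dist_eq_one_iff_adj.2 h1]
      omega
    have h6 := M.edge_iff.2 ⟨h1, (M.preceq_of_inInterval hy'.1 this).1⟩
    exact ⟨h1, h2, h6, h5.2 h6⟩
  rcases M.adm.total _ _ hz with h | h
  swap
  · have hclose : ¬ G.dist z a' + 1 = G.dist z₁ a' := fun hf =>
      M.adm.asymm _ _ h (hfar hf).2.2.2
    have hd := M.dist_adj' hz a'
    have e := hgate z₁ (M.atomistic_edge h)
    rw [G.dist_comm (u := a') (v := z₁)] at e
    rw [G.dist_comm (u := a') (v := z)] at hz0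
    have : InInterval G g z z₁ := by
      rw [InInterval, M.dist_edge h]
      omega
    obtain ⟨i1, i2⟩ := M.preceq_of_inInterval hg.1 this
    exact M.atomistic_lower hg i1 i2
  -- Now z is below z₁. Each coatom c of z above g must complete to a square with z₁; the target t
  -- is a', or z', or an atom found in the lower Boolean neighborhood of z'.
  have key : ∀ c, Preceq o g c → o c z → ∃ w, o w z₁ ∧ o c w ∧ w ≠ z := by
    intro c hgc hcz
    have hcz' := M.adm.adj _ _ hcz
    have hca : G.dist c a' + 1 = G.dist z a' := by
      have e := hgate c (M.atomistic_upper hg hgc (.of_edge hcz))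
      have e' := M.dist_add_of_preceq hgc (.of_edge hcz)
      rw [InInterval, M.dist_edge hcz] at e'
      rw [G.dist_comm (u := a') (v := c)] at e
      rw [G.dist_comm (u := a') (v := z)] at hz0
      omega
    rcases M.dist_adj' hz a' with hd | hd
    · exact M.square_of_dist hcz h hca hd.symm
    rcases M.dist_adj' hcz' z' with hd' | hd'
    swap
    · exact M.square_of_dist hcz h hd'.symm hz'
    -- Neither a' nor z' serves as target. Then c, z, z₁ have gates yc, y, y₁ at `z'` that form a
    -- directed path in a Boolean interval, and an atom over yc that is below y₁ but not below y is
    -- the target.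
    obtain ⟨f1, f2, f3, -⟩ := hfar hd.symm
    obtain ⟨yc, hyc, hgyc⟩ := M.lower_gated z' c
    have hyc' : Atomistic o yc z' := hyc
    obtain ⟨g1, g2, g3, g4, -⟩ := M.gates_parallel hcz' hyc hy hgyc hgy
      (M.atomistic_refl z') ha (p := z') (q := a') (by omega) (by omega)
    have : InInterval G yc z' y := by
      rw [InInterval, SimpleGraph.dist_eq_one_iff_adj.2 g1]
      omega
    have g5 := M.edge_iff.2 ⟨g1, (M.preceq_of_inInterval hyc'.1 this).1⟩
    have hat : Atomistic o yc y₁ :=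
      M.atomistic_lower hyc' ((Preceq.of_edge g5).trans (.of_edge f3)) hy₁.1
    obtain ⟨t, ht1, ht2, ht3⟩ : ∃ t, o yc t ∧ Preceq o t y₁ ∧ ¬ Preceq o t y := by
      by_contra hcon
      push Not at hcon
      exact M.edge_ne f3 (hat.2 y (.of_edge g5) (.of_edge f3) hcon)
    have htK : Atomistic o t z' :=
      M.atomistic_upper hyc' (.of_edge ht1) (ht2.trans hy₁.1)
    have hty : y ≠ t := by
      rintro rfl
      exact ht3 (.refl _)
    have e1 := hgy t htK
    have e2 := hgyc t htK
    have e3 := hgy₁ t htK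
    rw [M.dist_two g1 (M.adm.adj _ _ ht1) hty] at e1
    rw [M.dist_edge ht1] at e2
    have e4 := M.dist_add_of_preceq (.of_edge g5) (.of_edge f3)
    have e5 := M.dist_add_of_preceq (.of_edge ht1) ht2
    rw [InInterval, M.dist_edge g5, M.dist_edge f3] at e4
    rw [InInterval, M.dist_edge ht1, G.dist_comm (u := t)] at e5
    exact M.square_of_dist hcz h (t := t) (by omega) (by omega)
  -- Dually, let u ≥ g lie below all coatoms of z₁ above g. One of these is z; the others supplied
  -- by the squares give u ≤ z ∧ w = c for each coatom c of z above g, so u = g.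
  rw [← M.atomistic_rev]
  refine ⟨preceq_rev.2 (hg.1.trans (.of_edge h)), fun u h1 h2 h3 => ?_⟩
  rw [preceq_rev] at h1 h2
  have huz : Preceq o u z := preceq_rev.1 (h3 z h (preceq_rev.2 hg.1))
  refine (M.atomistic_rev.2 hg).2 u (preceq_rev.2 huz) (preceq_rev.2 h2) fun c hc hgc => ?_
  rw [preceq_rev] at hgc ⊢
  obtain ⟨w, hw1, hw2, hw3⟩ := key c hgc hc
  have huw : Preceq o u w := preceq_rev.1 (h3 w hw1 (preceq_rev.2 (hgc.trans (.of_edge hw2))))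
  refine (M.inf_of_edge hc (.of_edge hw2) fun hzw => ?_).2.2 u huz huw
  rcases M.eq_or_eq_of_edge h hzw (.of_edge hw1) with e | e
  · exact hw3 e
  · exact M.edge_ne hw1 e

theorem gate_upper {z z₁ z' a' g : V} (hz : G.Adj z z₁) (hz' : G.dist z₁ z' + 1 = G.dist z z')
    (ha : Atomistic o z' a') (hg : Atomistic o z g)
    (hgate : ∀ x, Atomistic o z x → G.dist a' x = G.dist a' g + G.dist g x) :
    Atomistic o z₁ g := by
  rw [← M.atomistic_rev]
  exact M.reverse.gate_lower hz hz' (M.atomistic_rev.2 ha) (M.atomistic_rev.2 hg)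
    fun x hx => hgate x (M.atomistic_rev.1 hx)

/-- The analogue of `gate_upper` for principal filters. -/
theorem gate_upSet {z z₁ z' a' g : V} (hz : G.Adj z z₁) (hz' : G.dist z₁ z' + 1 = G.dist z z')
    (ha : Preceq o z' a') (hg : Preceq o z g)
    (hgate : ∀ x, Preceq o z x → G.dist a' x = G.dist a' g + G.dist g x) :
    Preceq o z₁ g := by
  rcases M.adm.total _ _ hz with h | h
  swap
  · exact (Preceq.of_edge h).trans hg
  have hz0 := hgate z (.refl z)
  have hz1 := hgate z₁ (.of_edge h)
  have hd := M.dist_adj' hz a'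
  rcases hd with hd | hd
  · have : InInterval G z g z₁ := by
      rw [InInterval, M.dist_edge h, G.dist_comm (u := z₁), G.dist_comm (u := z)]
      rw [G.dist_comm (u := a') (v := z₁)] at hz1
      rw [G.dist_comm (u := a') (v := z)] at hz0
      omega
    exact (M.preceq_of_inInterval hg this).2
  · exfalso
    obtain ⟨y, hy, hgy⟩ := M.upSet_gated z' z
    obtain ⟨y₁, hy₁, hgy₁⟩ := M.upSet_gated z' z₁
    obtain ⟨h1, h2, h3, h4, h5⟩ :=
      M.gates_parallel hz hy hy₁ hgy hgy₁ (Preceq.refl z') ha hz' hd.symm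
    have : InInterval G z' y y₁ := by
      rw [InInterval, G.dist_comm (u := y₁) (v := y), SimpleGraph.dist_eq_one_iff_adj.2 h1,
        G.dist_comm (u := z'), G.dist_comm (u := z')]
      omega
    have h6 := M.edge_iff.2 ⟨h1.symm, (M.preceq_of_inInterval hy this).2⟩
    exact M.adm.asymm _ _ h6 (h5.1 h)

end OrientedModular

end Multifac

/-! ### Generic parameters and parametric maximization -/

namespace Multifac

variable {V : Type*}

/-- At a generic parameter the weighted sum of two differences of distances vanishes only if both
differences do. -/
def Generic (D : V → V → ℝ) (t : ℝ) : Prop :=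
  ∀ p q r s p' q' r' s', (1 - t) * (D p q - D r s) + t * (D p' q' - D r' s') = 0 →
    D p q = D r s ∧ D p' q' = D r' s'

theorem Generic.swap {D : V → V → ℝ} {t : ℝ} (h : Generic D t) : Generic D (1 - t) := by
  intro p q r s p' q' r' s' e
  exact (h p' q' r' s' p q r s (by linarith)).symm

/-- A subdivision of the unit interval whose open cells consist of generic parameters. -/
structure IsMesh (D : V → V → ℝ) (N : ℕ) (τ : ℕ → ℝ) : Prop where
  pos : 0 < N
  zero : τ 0 = 0
  one : τ N = 1
  lt : ∀ i < N, τ i < τ (i + 1)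
  generic : ∀ i < N, ∀ t, τ i < t → t < τ (i + 1) → Generic D t

/-- The midpoint of a cell. -/
noncomputable def mid (τ : ℕ → ℝ) (i : ℕ) : ℝ := (τ i + τ (i + 1)) / 2

/-- For fixed vertices the condition concerns one function affine in t, and two different zeros
would force both differences to vanish. So each choice of vertices excludes at most one parameter.
-/
theorem finite_not_generic [Finite V] (D : V → V → ℝ) : {t | ¬ Generic D t}.Finite := by
  have : {t | ¬ Generic D t} ⊆ ⋃ k : (V × V × V × V) × (V × V × V × V),
      {t | (1 - t) * (D k.1.1 k.1.2.1 - D k.1.2.2.1 k.1.2.2.2) +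
        t * (D k.2.1 k.2.2.1 - D k.2.2.2.1 k.2.2.2.2) = 0 ∧
        ¬ (D k.1.1 k.1.2.1 = D k.1.2.2.1 k.1.2.2.2 ∧
          D k.2.1 k.2.2.1 = D k.2.2.2.1 k.2.2.2.2)} := by
    intro t ht
    simp only [Set.mem_ofPred_eq, Generic] at ht
    push Not at ht
    obtain ⟨p, q, r, s, p', q', r', s', h1, h2⟩ := ht
    refine Set.mem_iUnion.2 ⟨⟨⟨p, q, r, s⟩, ⟨p', q', r', s'⟩⟩, h1, ?_⟩
    tauto
  refine (Set.finite_iUnion fun k => Set.Subsingleton.finite ?_).subset this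
  rintro t ⟨h1, h2⟩ t' ⟨h1', -⟩
  by_contra hne
  refine h2 ⟨sub_eq_zero.1 ?_, sub_eq_zero.1 ?_⟩ <;>
    refine (mul_eq_zero.1 ?_).resolve_left (sub_ne_zero.2 hne)
  · linear_combination t * h1' - t' * h1
  · linear_combination (1 - t') * h1 - (1 - t) * h1'

theorem exists_subdivision {Z : Set ℝ} (hZ : Z.Finite) : ∃ (N : ℕ) (τ : ℕ → ℝ), 0 < N ∧ τ 0 = 0 ∧
    τ N = 1 ∧ (∀ i < N, τ i < τ (i + 1)) ∧ ∀ i < N, ∀ t, τ i < t → t < τ (i + 1) → t ∉ Z := by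
  classical
  let s : Finset ℝ := insert 0 (insert 1 (hZ.toFinset.filter fun t => 0 < t ∧ t < 1))
  have hs : ∀ t, t ∈ s ↔ t = 0 ∨ t = 1 ∨ (t ∈ Z ∧ 0 < t ∧ t < 1) := by
    intro t
    simp [s]
  have hs01 : ∀ t ∈ s, 0 ≤ t ∧ t ≤ 1 := by
    intro t ht
    rcases (hs t).1 ht with rfl | rfl | ⟨-, h1, h2⟩
    · norm_num
    · norm_num
    · exact ⟨h1.le, h2.le⟩
  have h0 : (0 : ℝ) ∈ s := (hs 0).2 (.inl rfl)
  have h1 : (1 : ℝ) ∈ s := (hs 1).2 (.inr (.inl rfl))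
  have hcard : 1 < s.card := Finset.one_lt_card.2 ⟨0, h0, 1, h1, zero_ne_one⟩
  obtain ⟨N, hN⟩ : ∃ N, s.card = N + 1 := ⟨s.card - 1, by omega⟩
  let e := s.orderEmbOfFin hN
  have hmem : ∀ i, e i ∈ s := s.orderEmbOfFin_mem hN
  have hsurj : ∀ t ∈ s, ∃ i, e i = t := by
    intro t ht
    have : t ∈ Set.range (s.orderEmbOfFin hN) := by
      rw [Finset.range_orderEmbOfFin]
      exact ht
    exact this
  let τ : ℕ → ℝ := fun i => if h : i < N + 1 then e ⟨i, h⟩ else 0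
  have hτ : ∀ i (h : i < N + 1), τ i = e ⟨i, h⟩ := fun i h => dif_pos h
  refine ⟨N, τ, by omega, ?_, ?_, ?_, ?_⟩
  · obtain ⟨j, hj⟩ := hsurj 0 h0
    rw [hτ 0 (by omega)]
    refine le_antisymm ?_ (hs01 _ (hmem _)).1
    rw [← hj]
    exact e.monotone (Fin.zero_le j)
  · obtain ⟨j, hj⟩ := hsurj 1 h1
    rw [hτ N (by omega)]
    refine le_antisymm (hs01 _ (hmem _)).2 ?_
    rw [← hj]
    exact e.monotone (Fin.le_last j)
  · intro i hi
    rw [hτ i (by omega), hτ (i + 1) (by omega)]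
    exact e.strictMono (Fin.mk_lt_mk.2 (Nat.lt_succ_self i))
  · intro i hi t ht1 ht2 htZ
    rw [hτ i (by omega)] at ht1
    rw [hτ (i + 1) (by omega)] at ht2
    have hts : t ∈ s := (hs t).2 (.inr (.inr ⟨htZ, lt_of_le_of_lt (hs01 _ (hmem _)).1 ht1,
      lt_of_lt_of_le ht2 (hs01 _ (hmem _)).2⟩))
    obtain ⟨j, rfl⟩ := hsurj t hts
    have j1 := e.lt_iff_lt.1 ht1
    have j2 := e.lt_iff_lt.1 ht2
    rw [Fin.lt_def] at j1 j2
    simp only at j1 j2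
    omega

theorem exists_mesh [Finite V] (D : V → V → ℝ) : ∃ N τ, IsMesh D N τ := by
  obtain ⟨N, τ, h1, h2, h3, h4, h5⟩ := exists_subdivision (finite_not_generic D)
  exact ⟨N, τ, h1, h2, h3, h4, fun i hi t ht ht' => not_not.1 (h5 i hi t ht ht')⟩

/-- `(x, y)` maximizes `(1 - t) A x + t B y` over the relation `R`. -/
def IsOpt (R : V → V → Prop) (A B : V → ℝ) (t : ℝ) (x y : V) : Prop :=
  R x y ∧ ∀ x' y', R x' y' → (1 - t) * A x' + t * B y' ≤ (1 - t) * A x + t * B y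

theorem IsOpt.swap {R : V → V → Prop} {A B : V → ℝ} {t : ℝ} {x y : V} (h : IsOpt R A B t x y) :
    IsOpt (fun y x => R x y) B A (1 - t) y x :=
  ⟨h.1, fun y' x' h' => by linarith [h.2 x' y' h']⟩

theorem exists_isOpt [Finite V] {R : V → V → Prop} (A B : V → ℝ) (t : ℝ) {x₀ y₀ : V}
    (h : R x₀ y₀) : ∃ x y, IsOpt R A B t x y := by
  obtain ⟨⟨x, y⟩, hxy, hmax⟩ := Set.exists_max_image {p : V × V | R p.1 p.2}
    (fun p => (1 - t) * A p.1 + t * B p.2) (Set.toFinite _) ⟨(x₀, y₀), h⟩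
  exact ⟨x, y, hxy, fun x' y' h' => hmax (x', y') h'⟩

/-- All differences of values of `A` are differences of distances. -/
def DistDiff (D : V → V → ℝ) (A : V → ℝ) : Prop :=
  ∀ x x', ∃ p q r s, A x - A x' = D p q - D r s

theorem distDiff_left (D : V → V → ℝ) (z : V) : DistDiff D (D z) :=
  fun x x' => ⟨z, x, z, x', rfl⟩

theorem distDiff_right (D : V → V → ℝ) (z : V) : DistDiff D (fun x => D x z) :=
  fun x x' => ⟨x, z, x', z, rfl⟩

theorem Generic.eq_of_value_eq {D : V → V → ℝ} {t : ℝ} (ht : Generic D t) {A B : V → ℝ}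
    (hA : DistDiff D A) (hB : DistDiff D B) {x y x' y' : V}
    (h : (1 - t) * A x + t * B y = (1 - t) * A x' + t * B y') : A x = A x' ∧ B y = B y' := by
  obtain ⟨p, q, r, s, e1⟩ := hA x x'
  obtain ⟨p', q', r', s', e2⟩ := hB y y'
  have := ht p q r s p' q' r' s' (by rw [← e1, ← e2]; linarith)
  constructor <;> linarith

/-- Uncrossing two maximizers. -/
theorem uncross {D : V → V → ℝ} {t : ℝ} (ht : Generic D t) {A B : V → ℝ}
    (hA : DistDiff D A) (hB : DistDiff D B) {R R' : V → V → Prop} {x y x' y' p p' q q' : V}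
    (h : IsOpt R A B t x y) (h' : IsOpt R' A B t x' y') (hp : R' p p') (hq : R q q')
    (eA : A p + A q = A x + A x') (eB : B p' + B q' = B y + B y') : A p = A x' ∧ B p' = B y' := by
  -- The exchanged pairs have the same total value as the two maximizers, so neither can be worse
  -- than the maximizer that it replaces.
  refine ht.eq_of_value_eq hA hB (le_antisymm (h'.2 _ _ hp) ?_)
  have := h.2 _ _ hq
  have e : (1 - t) * (A p + A q) + t * (B p' + B q') =
    (1 - t) * (A x + A x') + t * (B y + B y') := by rw [eA, eB]
  linarith

namespace IsMesh

variable {D : V → V → ℝ} {N : ℕ} {τ : ℕ → ℝ} (hτ : IsMesh D N τ)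
include hτ

theorem le_of_le {i j : ℕ} (hij : i ≤ j) (hj : j ≤ N) : τ i ≤ τ j := by
  induction j, hij using Nat.le_induction with
  | base => exact le_rfl
  | succ j _ ih => exact (ih (by omega)).trans (hτ.lt j (by omega)).le

theorem nonneg {i : ℕ} (hi : i ≤ N) : 0 ≤ τ i := hτ.zero ▸ hτ.le_of_le (Nat.zero_le i) hi

theorem le_one {i : ℕ} (hi : i ≤ N) : τ i ≤ 1 := hτ.one ▸ hτ.le_of_le hi le_rfl

theorem lt_mid {i : ℕ} (hi : i < N) : τ i < mid τ i := by
  have := hτ.lt i hi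
  unfold mid
  linarith

theorem mid_lt {i : ℕ} (hi : i < N) : mid τ i < τ (i + 1) := by
  have := hτ.lt i hi
  unfold mid
  linarith

theorem mid_pos {i : ℕ} (hi : i < N) : 0 < mid τ i :=
  (hτ.nonneg hi.le).trans_lt (hτ.lt_mid hi)

theorem mid_lt_one {i : ℕ} (hi : i < N) : mid τ i < 1 :=
  (hτ.mid_lt hi).trans_le (hτ.le_one hi)

theorem generic_mid {i : ℕ} (hi : i < N) : Generic D (mid τ i) :=
  hτ.generic i hi _ (hτ.lt_mid hi) (hτ.mid_lt hi)

theorem sum_weights : ∑ i ∈ Finset.range N, (τ (i + 1) - τ i) = 1 := by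
  rw [Finset.sum_range_sub, hτ.one, hτ.zero, sub_zero]

/-- A maximizer at the midpoint of a cell is a maximizer in the whole closed cell. -/
theorem isOpt_cell {R : V → V → Prop} {A B : V → ℝ} (hA : DistDiff D A) (hB : DistDiff D B)
    {i : ℕ} (hi : i < N) {x y : V} (h : IsOpt R A B (mid τ i) x y) {t : ℝ} (h1 : τ i ≤ t)
    (h2 : t ≤ τ (i + 1)) : IsOpt R A B t x y := by
  refine ⟨h.1, fun x' y' h' => ?_⟩
  by_contra hlt
  push Not at hlt
  have hm := h.2 x' y' h'
  have hm1 := hτ.lt_mid hi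
  have hm2 := hτ.mid_lt hi
  obtain ⟨g, hg⟩ : ∃ g : ℝ → ℝ, ∀ s, g s = (1 - s) * (A x - A x') + s * (B y - B y') :=
    ⟨_, fun _ => rfl⟩
  have hg1 : 0 ≤ g (mid τ i) := by rw [hg]; linarith
  have hg2 : g t < 0 := by rw [hg]; linarith
  have hd : 0 < g (mid τ i) - g t := by linarith
  obtain ⟨l, hl⟩ : ∃ l, l = -g t / (g (mid τ i) - g t) := ⟨_, rfl⟩
  have hl0 : 0 < l := by rw [hl]; exact div_pos (by linarith) hd
  have hl1 : l ≤ 1 := by rw [hl, div_le_one hd]; linarith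
  -- The affine difference changes sign between the midpoint and t. Since l > 0 its zero lies in the
  -- open cell, even if t is an end, and genericity there makes both terms vanish.
  have hroot : g (l * mid τ i + (1 - l) * t) = 0 := by
    have e : l * (g (mid τ i) - g t) = -g t := by rw [hl]; field_simp
    have : g (l * mid τ i + (1 - l) * t) = l * (g (mid τ i) - g t) + g t := by
      simp only [hg]
      ring
    rw [this, e]
    ring
  have hgen := hτ.generic i hi (l * mid τ i + (1 - l) * t) (by nlinarith) (by nlinarith)
  rw [hg] at hroot
  obtain ⟨e1, e2⟩ := hgen.eq_of_value_eq hA hB (x := x) (y := y) (x' := x') (y' := y')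
    (by linarith)
  rw [hg, e1, e2] at hg2
  simp at hg2

/-- The slopes of the value function add up to its total increase. -/
theorem sum_slopes {R : V → V → Prop} {A B : V → ℝ} (hA : DistDiff D A) (hB : DistDiff D B)
    {x y : ℕ → V} (h : ∀ i < N, IsOpt R A B (mid τ i) (x i) (y i)) {xa ya xb yb : V}
    (ha : R xa ya) (hamax : ∀ x y, R x y → A x ≤ A xa)
    (hb : R xb yb) (hbmax : ∀ x y, R x y → B y ≤ B yb) :
    ∑ i ∈ Finset.range N, (τ (i + 1) - τ i) * (B (y i) - A (x i)) = B yb - A xa := by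
  -- The value function at the points of the mesh. It is affine on each cell with slope B(y) - A(x),
  -- so the sum telescopes from the maximum of A at t = 0 to that of B at t = 1.
  obtain ⟨φ, hφ⟩ : ∃ φ : ℕ → ℝ, ∀ j, φ j = if j < N then
    (1 - τ j) * A (x j) + τ j * B (y j) else B yb := ⟨_, fun _ => rfl⟩
  have step : ∀ i ∈ Finset.range N, (τ (i + 1) - τ i) * (B (y i) - A (x i)) =
      φ (i + 1) - φ i := by
    intro i hi
    rw [Finset.mem_range] at hi
    have hlt := (hτ.lt i hi).le
    have ho := hτ.isOpt_cell hA hB hi (h i hi) hlt le_rfl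
    have : φ (i + 1) = (1 - τ (i + 1)) * A (x i) + τ (i + 1) * B (y i) := by
      rw [hφ]
      split_ifs with h'
      · have ho' := hτ.isOpt_cell hA hB h' (h _ h') le_rfl (hτ.lt _ h').le
        exact le_antisymm (ho.2 _ _ ho'.1) (ho'.2 _ _ ho.1)
      · obtain rfl : i + 1 = N := by omega
        rw [hτ.one] at ho ⊢
        have := ho.2 _ _ hb
        have := hbmax _ _ ho.1
        linarith
    rw [this, hφ, if_pos hi]
    ring
  rw [Finset.sum_congr rfl step, Finset.sum_range_sub, hφ, hφ, if_neg (lt_irrefl N), if_pos hτ.pos]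
  have ho := hτ.isOpt_cell hA hB hτ.pos (h 0 hτ.pos) le_rfl (hτ.lt 0 hτ.pos).le
  rw [hτ.zero] at ho ⊢
  have := ho.2 _ _ ha
  have := hamax _ _ ho.1
  linarith

end IsMesh

end Multifac

/-! ### Fractional joins and their joint nonexpansiveness -/

namespace Multifac

variable {V : Type*} {G : SimpleGraph V} {o : V → V → Prop}

theorem GeoMetric.inf_sup {D : V → V → ℝ} (hD : GeoMetric G D) (M : OrientedModular G o)
    {z x y m j : V} (hzx : Preceq o z x) (hzy : Preceq o z y) (hm : IsInf o x y m)
    (hj : IsSup o x y j) : D z j + D z m = D z x + D z y := by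
  have h1 := hD.modular M hm hj
  have h2 := hD.chain M (hm.2.2 z hzx hzy) hm.1
  have h3 := hD.chain M hzy hj.2.1
  linarith

theorem GeoMetric.eq_of_le {D : V → V → ℝ} (hD : GeoMetric G D) (M : OrientedModular G o)
    {z x y : V} (hzx : Preceq o z x) (hxy : Preceq o x y) (h : D z y = D z x) : x = y := by
  have := hD.chain M hzx hxy
  exact hD.eq_of_zero (by linarith)

/-- Bounded pairs `x ≤ a`, `y ≤ b` above `z`. -/
def JoinFeasible (o : V → V → Prop) (z a b x y : V) : Prop :=
  Preceq o z x ∧ Preceq o x a ∧ Preceq o z y ∧ Preceq o y b ∧ ∃ w, Preceq o x w ∧ Preceq o y w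

/-- For a and b above z the parameter moves the emphasis from a to b: at t = 0 an optimal pair has x
= a, at t = 1 it has y = b. -/
def JoinOpt (o : V → V → Prop) (D : V → V → ℝ) (z a b : V) (t : ℝ) (x y : V) : Prop :=
  IsOpt (JoinFeasible o z a b) (D z) (D z) t x y

/-- `v` is the join of an optimal bounded pair. -/
def FracJoin (o : V → V → Prop) (D : V → V → ℝ) (z a b : V) (t : ℝ) (v : V) : Prop :=
  ∃ x y, JoinOpt o D z a b t x y ∧ IsSup o x y v

theorem joinFeasible_swap {z a b x y : V} :
    JoinFeasible o z a b x y ↔ JoinFeasible o z b a y x := by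
  unfold JoinFeasible
  constructor <;> rintro ⟨h1, h2, h3, h4, w, h5, h6⟩ <;> exact ⟨h3, h4, h1, h2, w, h6, h5⟩

theorem JoinOpt.swap {D : V → V → ℝ} {z a b x y : V} {t : ℝ} (h : JoinOpt o D z a b t x y) :
    JoinOpt o D z b a (1 - t) y x := by
  have := IsOpt.swap h
  simp only [joinFeasible_swap (a := a)] at this
  exact this

variable {D : V → V → ℝ}

theorem exists_joinOpt [Finite V] (D : V → V → ℝ) {z a b : V} (t : ℝ) (ha : Preceq o z a)
    (hb : Preceq o z b) : ∃ x y, JoinOpt o D z a b t x y :=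
  exists_isOpt _ _ t (x₀ := z) (y₀ := z) ⟨.refl z, ha, .refl z, hb, z, .refl z, .refl z⟩

theorem exists_fracJoin [Finite V] (M : OrientedModular G o) (D : V → V → ℝ) {z a b : V} (t : ℝ)
    (ha : Preceq o z a) (hb : Preceq o z b) : ∃ v, FracJoin o D z a b t v := by
  obtain ⟨x, y, h⟩ := exists_joinOpt D t ha hb
  obtain ⟨w, h1, h2⟩ := h.1.2.2.2.2
  obtain ⟨v, hv⟩ := M.exists_sup h1 h2
  exact ⟨v, x, y, h, hv⟩

variable (M : OrientedModular G o) (hD : GeoMetric G D)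
include M hD

/-- Uncross (x, y) and (x', y') into (x ∨ x', y ∧ y') and (x ∧ x', y ∨ y'). These stay bounded
because pairwise bounded triples are bounded, and distance from z is a valuation. -/
theorem joinOpt_mono {t : ℝ} (ht : Generic D t) {z a b b' x y x' y' : V}
    (hb : Preceq o b' b) (h : JoinOpt o D z a b t x y) (h' : JoinOpt o D z a b' t x' y') :
    Preceq o x x' ∧ Preceq o y' y := by
  obtain ⟨h1, h2, h3, h4, w, h5, h6⟩ := h.1
  obtain ⟨h1', h2', h3', h4', w', h5', h6'⟩ := h'.1
  obtain ⟨p, hp⟩ := M.exists_sup h2 h2'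
  obtain ⟨q, hq⟩ := M.exists_inf h1 h1'
  obtain ⟨p', hp'⟩ := M.exists_inf h3 h3'
  obtain ⟨q', hq'⟩ := M.exists_sup h4 (h4'.trans hb)
  have hzq := hq.2.2 z h1 h1'
  have hzp' := hp'.2.2 z h3 h3'
  have F1 : JoinFeasible o z a b' p p' := by
    obtain ⟨u, u1, u2, u3⟩ := M.triple_bounded h2 h2' h5' (hp'.2.1.trans h6') (hp'.1.trans h6) h5
    exact ⟨h1.trans hp.1, hp.2.2 a h2 h2', hzp', hp'.2.1.trans h4', u, hp.2.2 u u1 u2, u3⟩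
  have F2 : JoinFeasible o z a b q q' := by
    obtain ⟨u, u1, u2, u3⟩ := M.triple_bounded h4 (h4'.trans hb) h6' (hq.2.1.trans h5')
      (hq.1.trans h5) h6
    exact ⟨hzq, hq.1.trans h2, h3.trans hq'.1, hq'.2.2 b h4 (h4'.trans hb), u, u3,
      hq'.2.2 u u1 u2⟩
  have e1 := hD.inf_sup M h1 h1' hq hp
  have e2 := hD.inf_sup M h3 h3' hp' hq'
  obtain ⟨c1, c2⟩ := uncross ht (distDiff_left D z) (distDiff_left D z) h h' F1 F2 e1
    (by linarith)
  have d1 := hD.eq_of_le M h1' hp.2.1 c1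
  have d2 := hD.eq_of_le M hzp' hp'.2.1 c2.symm
  exact ⟨d1 ▸ hp.1, d2 ▸ hp'.1⟩

/-- Replacing x by x ∨ m keeps the pair bounded and is a strict gain unless m ≤ x, since the weight
1 - t is positive; likewise for y. -/
theorem joinOpt_inf {t : ℝ} (ht0 : 0 < t) (ht1 : t < 1) {z a b x y m : V}
    (h : JoinOpt o D z a b t x y) (hm : IsInf o a b m) : IsInf o x y m := by
  have key : ∀ {t : ℝ} {a b x y : V}, t < 1 → JoinOpt o D z a b t x y → IsInf o a b m →
      Preceq o m x := by
    intro t a b x y ht1 h hm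
    obtain ⟨h1, h2, h3, h4, w, h5, h6⟩ := h.1
    obtain ⟨p, hp⟩ := M.exists_sup h2 hm.1
    obtain ⟨u, u1, u2, u3⟩ := M.triple_bounded h2 hm.1 hm.2.1 h4 h6 h5
    have := h.2 p y ⟨h1.trans hp.1, hp.2.2 a h2 hm.1, h3, h4, u, hp.2.2 u u1 u2, u3⟩
    have e := hD.chain M h1 hp.1
    have e' := hD.nonneg x p
    have : (1 - t) * D x p ≤ 0 := by
      rw [← e] at this
      linarith
    have : D x p ≤ 0 := nonpos_of_mul_nonpos_right this (by linarith)
    have := hD.eq_of_zero (le_antisymm this e')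
    exact this ▸ hp.2.1
  have k1 := key ht1 h hm
  have k2 := key (t := 1 - t) (by linarith) h.swap hm.symm
  exact ⟨k1, k2, fun n hn1 hn2 => hm.2.2 n (hn1.trans h.1.2.1) (hn2.trans h.1.2.2.2.1)⟩

/-- Go from v to v' through j = x ∨ y'. By the modular law the two legs have lengths D(y, y') - D(m,
m') and D(x, x'). -/
theorem dist_sup_le {x y x' y' m m' v v' : V} (hx : Preceq o x x') (hy : Preceq o y' y)
    (hm : IsInf o x y m) (hm' : IsInf o x' y' m') (hmm : Preceq o m' m) (hv : IsSup o x y v)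
    (hv' : IsSup o x' y' v') : D v v' + D m m' ≤ D x x' + D y y' := by
  obtain ⟨j, hj⟩ := M.exists_sup (hx.trans hv'.1) hv'.2.1
  have hm'' : IsInf o x y' m' :=
    ⟨hmm.trans hm.1, hm'.2.1, fun n h1 h2 => hm'.2.2 n (h1.trans hx) h2⟩
  have hjv : Preceq o j v := hj.2.2 v hv.1 (hy.trans hv.2.1)
  have hjv' : Preceq o j v' := hj.2.2 v' (hx.trans hv'.1) hv'.2.1
  have a1 := hD.modular M hm.symm hv.symm
  have a2 := hD.modular M hm''.symm hj.symm
  have a3 := hD.modular M hm' hv'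
  have a4 := hD.modular M hm'' hj
  have b1 := hD.chain M hj.1 hjv
  have b2 := hD.chain M hj.2.1 hjv'
  have b3 := hD.chain M hmm hm.2.1
  have b4 := hD.chain M hm'.2.1 hy
  have b5 := hD.chain M hm''.1 hx
  have t := hD.triangle v j v'
  rw [hD.symm v j] at t
  rw [hD.symm m m', hD.symm y y']
  linarith

omit M hD

/-- The Lipschitz property of the meet and the fractional joins. -/
def JoinLip (o : V → V → Prop) (D : V → V → ℝ) (N : ℕ) (τ : ℕ → ℝ) (z a b z' a' b' : V) : Prop :=
  ∀ v v' : ℕ → V, (∀ i < N, FracJoin o D z a b (mid τ i) (v i)) →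
    (∀ i < N, FracJoin o D z' a' b' (mid τ i) (v' i)) → ∀ m m', IsInf o a b m → IsInf o a' b' m' →
    ∑ i ∈ Finset.range N, (τ (i + 1) - τ i) * D (v i) (v' i) + D m m' ≤ D a a' + D b b'

theorem JoinLip.symm (hD : GeoMetric G D) {N : ℕ} {τ : ℕ → ℝ} {z a b z' a' b' : V}
    (h : JoinLip o D N τ z a b z' a' b') : JoinLip o D N τ z' a' b' z a b := by
  intro v v' hv hv' m m' hm hm'
  have := h v' v hv' hv m' m hm' hm
  simpa only [hD.symm a' a, hD.symm b' b, hD.symm m m', hD.symm (v _) (v' _)] using this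

variable {N : ℕ} {τ : ℕ → ℝ} (hτ : IsMesh D N τ)
include hτ

theorem sum_joinOpt {z a b : V} (ha : Preceq o z a) (hb : Preceq o z b) (M : OrientedModular G o)
    (hD : GeoMetric G D) {x y : ℕ → V} (h : ∀ i < N, JoinOpt o D z a b (mid τ i) (x i) (y i)) :
    ∑ i ∈ Finset.range N, (τ (i + 1) - τ i) * (D z (y i) - D z (x i)) = D z b - D z a := by
  refine hτ.sum_slopes (distDiff_left D z) (distDiff_left D z) h (ya := z) (xb := z)
    ⟨ha, .refl a, .refl z, hb, a, .refl a, ha⟩ (fun x y h => ?_)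
    ⟨.refl z, ha, hb, .refl b, b, hb, .refl b⟩ (fun x y h => ?_)
  · have := hD.chain M h.1 h.2.1
    have := hD.nonneg x a
    linarith
  · have := hD.chain M h.2.2.1 h.2.2.2.1
    have := hD.nonneg y b
    linarith

/-- By monotonicity the bound of `dist_sup_le` is a difference of slopes of the two value functions,
minus D(m, m'). The weighted slopes sum to D(z, b) - D(z, a) and D(z, b') - D(z, a). -/
theorem joinLip_right (M : OrientedModular G o) (hD : GeoMetric G D) {z a b b' : V}
    (ha : Preceq o z a) (hb : Preceq o z b') (hbb : Preceq o b' b) :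
    JoinLip o D N τ z a b z a b' := by
  intro v v' hv hv' m m' hm hm'
  have : Nonempty V := ⟨z⟩
  choose! x y hxy hs using hv
  choose! x' y' hxy' hs' using hv'
  have S := sum_joinOpt hτ ha (hb.trans hbb) M hD hxy
  have S' := sum_joinOpt hτ ha hb M hD hxy'
  have W := hτ.sum_weights
  have key : ∀ i ∈ Finset.range N, (τ (i + 1) - τ i) * D (v i) (v' i) ≤
      (τ (i + 1) - τ i) * (D z (y i) - D z (x i)) -
        (τ (i + 1) - τ i) * (D z (y' i) - D z (x' i)) - (τ (i + 1) - τ i) * D m m' := by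
    intro i hi
    rw [Finset.mem_range] at hi
    obtain ⟨h1, h2⟩ := joinOpt_mono M hD (hτ.generic_mid hi) hbb (hxy i hi) (hxy' i hi)
    have hi1 := joinOpt_inf M hD (hτ.mid_pos hi) (hτ.mid_lt_one hi) (hxy i hi) hm
    have hi2 := joinOpt_inf M hD (hτ.mid_pos hi) (hτ.mid_lt_one hi) (hxy' i hi) hm'
    have h3 := dist_sup_le M hD h1 h2 hi1 hi2 (hm.2.2 m' hm'.1 (hm'.2.1.trans hbb)) (hs i hi)
      (hs' i hi)
    have c1 := hD.chain M (hxy i hi).1.1 h1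
    have c2 := hD.chain M (hxy' i hi).1.2.2.1 h2
    rw [hD.symm (y i) (y' i)] at h3
    have := mul_le_mul_of_nonneg_left h3 (sub_nonneg.2 (hτ.lt i hi).le)
    rw [← c1, ← c2]
    linarith
  have := Finset.sum_le_sum key
  rw [Finset.sum_sub_distrib, Finset.sum_sub_distrib, S, S', ← Finset.sum_mul, W] at this
  have e := hD.chain M hb hbb
  rw [hD.self, hD.symm b b']
  linarith

theorem joinLip_left (M : OrientedModular G o) (hD : GeoMetric G D) {z a a' b : V}
    (ha : Preceq o z a') (hb : Preceq o z b) (haa : Preceq o a' a) :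
    JoinLip o D N τ z a b z a' b := by
  intro v v' hv hv' m m' hm hm'
  have : Nonempty V := ⟨z⟩
  choose! x y hxy hs using hv
  choose! x' y' hxy' hs' using hv'
  have S := sum_joinOpt hτ (ha.trans haa) hb M hD hxy
  have S' := sum_joinOpt hτ ha hb M hD hxy'
  have W := hτ.sum_weights
  have key : ∀ i ∈ Finset.range N, (τ (i + 1) - τ i) * D (v i) (v' i) ≤
      (τ (i + 1) - τ i) * (D z (y' i) - D z (x' i)) -
        (τ (i + 1) - τ i) * (D z (y i) - D z (x i)) - (τ (i + 1) - τ i) * D m m' := by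
    intro i hi
    rw [Finset.mem_range] at hi
    obtain ⟨h2, h1⟩ :=
      joinOpt_mono M hD (hτ.generic_mid hi).swap haa (hxy i hi).swap (hxy' i hi).swap
    have hi1 := joinOpt_inf M hD (hτ.mid_pos hi) (hτ.mid_lt_one hi) (hxy i hi) hm
    have hi2 := joinOpt_inf M hD (hτ.mid_pos hi) (hτ.mid_lt_one hi) (hxy' i hi) hm'
    have h3 := dist_sup_le M hD h2 h1 hi1.symm hi2.symm
      (hm.2.2 m' (hm'.1.trans haa) hm'.2.1) (hs i hi).symm (hs' i hi).symm
    have c1 := hD.chain M (hxy' i hi).1.1 h1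
    have c2 := hD.chain M (hxy i hi).1.2.2.1 h2
    rw [hD.symm (x i) (x' i)] at h3
    have := mul_le_mul_of_nonneg_left h3 (sub_nonneg.2 (hτ.lt i hi).le)
    rw [← c1, ← c2]
    linarith
  have := Finset.sum_le_sum key
  rw [Finset.sum_sub_distrib, Finset.sum_sub_distrib, S, S', ← Finset.sum_mul, W] at this
  have e := hD.chain M ha haa
  rw [hD.self b, hD.symm a a']
  linarith

theorem JoinLip.trans (hD : GeoMetric G D) {z a b z₁ z₂ c e z' a' b' m₀ : V}
    (h₁ : JoinLip o D N τ z a b z₁ c e) (h₂ : JoinLip o D N τ z₂ c e z' a' b')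
    (hm : IsInf o c e m₀)
    (hw : ∀ i < N, ∃ w, FracJoin o D z₁ c e (mid τ i) w ∧ FracJoin o D z₂ c e (mid τ i) w)
    (ea : D a c + D c a' = D a a') (eb : D b e + D e b' = D b b') :
    JoinLip o D N τ z a b z' a' b' := by
  intro v v' hv hv' m m' hm1 hm2
  have : Nonempty V := ⟨z⟩
  choose! w hw1 hw2 using hw
  have k1 := h₁ v w hv hw1 m m₀ hm1 hm
  have k2 := h₂ w v' hw2 hv' m₀ m' hm hm2
  have k3 := hD.triangle m m₀ m'
  have : ∑ i ∈ Finset.range N, (τ (i + 1) - τ i) * D (v i) (v' i) ≤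
      ∑ i ∈ Finset.range N, (τ (i + 1) - τ i) * D (v i) (w i) +
      ∑ i ∈ Finset.range N, (τ (i + 1) - τ i) * D (w i) (v' i) := by
    rw [← Finset.sum_add_distrib]
    refine Finset.sum_le_sum fun i hi => ?_
    rw [← mul_add]
    exact mul_le_mul_of_nonneg_left (hD.triangle _ _ _)
      (sub_nonneg.2 (hτ.lt i (Finset.mem_range.1 hi)).le)
  linarith

/-- Change one coordinate at a time, descending to the meet with the new value and ascending again;
the meet is on a geodesic, so the bounds add up without loss. -/
theorem joinLip_same [Finite V] (M : OrientedModular G o) (hD : GeoMetric G D) {z a b a' b' : V}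
    (ha : Preceq o z a) (hb : Preceq o z b) (ha' : Preceq o z a') (hb' : Preceq o z b') :
    JoinLip o D N τ z a b z a' b' := by
  obtain ⟨c, hc⟩ := M.exists_inf ha ha'
  obtain ⟨e, he⟩ := M.exists_inf hb hb'
  have hzc := hc.2.2 z ha ha'
  have hze := he.2.2 z hb hb'
  have ec := hD.add _ _ _ (M.inInterval_inf hc)
  have ee := hD.add _ _ _ (M.inInterval_inf he)
  have tr : ∀ {a b c e a' b' : V}, Preceq o z c → Preceq o z e → JoinLip o D N τ z a b z c e →
      JoinLip o D N τ z c e z a' b' → D a c + D c a' = D a a' → D b e + D e b' = D b b' →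
      JoinLip o D N τ z a b z a' b' := by
    intro a b c e a' b' hc he h1 h2 e1 e2
    obtain ⟨m, hm⟩ := M.exists_inf hc he
    refine JoinLip.trans hτ hD h1 h2 hm (fun i _ => ?_) e1 e2
    obtain ⟨w, hw⟩ := exists_fracJoin M D (mid τ i) hc he
    exact ⟨w, hw, hw⟩
  have l1 : JoinLip o D N τ z a b z a b' :=
    tr ha hze (joinLip_right hτ M hD ha hze he.1)
      (joinLip_right hτ M hD ha hze he.2.1 |>.symm hD) (by rw [hD.self, zero_add]) ee
  have l2 : JoinLip o D N τ z a b' z a' b' :=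
    tr hzc hb' (joinLip_left hτ M hD hzc hb' hc.1)
      (joinLip_left hτ M hD hzc hb' hc.2.1 |>.symm hD) ec (by rw [hD.self, zero_add])
  exact tr ha hb' l1 l2 (by rw [hD.self, zero_add]) (by rw [hD.self, add_zero])

omit hτ

/-- Optimal pairs lie above a ∧ b, hence above z₁; there the objectives for z and z₁ differ by a
constant. -/
theorem FracJoin.of_le (M : OrientedModular G o) (hD : GeoMetric G D) {z z₁ a b v : V} {t : ℝ}
    (ht0 : 0 < t) (ht1 : t < 1) (hz : Preceq o z z₁) (ha : Preceq o z₁ a) (hb : Preceq o z₁ b)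
    (h : FracJoin o D z a b t v) : FracJoin o D z₁ a b t v := by
  obtain ⟨x, y, hxy, hv⟩ := h
  obtain ⟨m, hm⟩ := M.exists_inf ha hb
  have hi := joinOpt_inf M hD ht0 ht1 hxy hm
  have hzm := hm.2.2 z₁ ha hb
  have hx := hzm.trans hi.1
  have hy := hzm.trans hi.2.1
  refine ⟨x, y, ⟨⟨hx, hxy.1.2.1, hy, hxy.1.2.2.2⟩, fun x' y' h' => ?_⟩, hv⟩
  have := hxy.2 x' y' ⟨hz.trans h'.1, h'.2.1, hz.trans h'.2.2.1, h'.2.2.2⟩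
  rw [← hD.chain M hz hx, ← hD.chain M hz hy, ← hD.chain M hz h'.1,
    ← hD.chain M hz h'.2.2.1] at this
  linarith

/-- The meet and the fractional joins are jointly nonexpansive. -/
theorem joinLip [Finite V] (hτ : IsMesh D N τ) (M : OrientedModular G o) (hD : GeoMetric G D)
    {z a b z' a' b' : V}
    (ha : Preceq o z a) (hb : Preceq o z b) (ha' : Preceq o z' a') (hb' : Preceq o z' b') :
    JoinLip o D N τ z a b z' a' b' := by
  obtain ⟨n, hn⟩ : ∃ n, G.dist z z' = n := ⟨_, rfl⟩
  induction n generalizing z a b with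
  | zero =>
    obtain rfl := M.eq_of_dist hn
    exact joinLip_same hτ M hD ha hb ha' hb'
  | succ n ih =>
    have hne : z ≠ z' := by
      rintro rfl
      simp at hn
    obtain ⟨z₁, hz, hz'⟩ := M.exists_step hne
    rw [G.dist_comm, G.dist_comm (u := z')] at hz'
    -- The gates c, e of a', b' lie on geodesics from a, b and are above both z and z₁, so the base
    -- can move one step towards z' with c, e as intermediate pair.
    obtain ⟨c, hc, hgc⟩ := M.upSet_gated z a'
    obtain ⟨e, he, hge⟩ := M.upSet_gated z b'
    have hc : Preceq o z c := hc
    have he : Preceq o z e := he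
    have hc1 := M.gate_upSet hz hz' ha' hc hgc
    have he1 := M.gate_upSet hz hz' hb' he hge
    have l1 := joinLip_same hτ M hD ha hb hc he
    have l2 := ih hc1 he1 (by omega)
    obtain ⟨m₀, hm₀⟩ := M.exists_inf hc he
    refine JoinLip.trans hτ hD l1 l2 hm₀ (fun i hi => ?_) ?_ ?_
    · rcases M.adm.total _ _ hz with h | h
      · obtain ⟨w, hw⟩ := exists_fracJoin M D (mid τ i) hc he
        exact ⟨w, hw, hw.of_le M hD (hτ.mid_pos hi) (hτ.mid_lt_one hi) (.of_edge h) hc1 he1⟩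
      · obtain ⟨w, hw⟩ := exists_fracJoin M D (mid τ i) hc1 he1
        exact ⟨w, hw.of_le M hD (hτ.mid_pos hi) (hτ.mid_lt_one hi) (.of_edge h) hc he, hw⟩
    · have := hD.add a' a c (hgc a ha).symm
      rw [hD.symm a c, hD.symm c a', hD.symm a a']
      linarith
    · have := hD.add b' b e (hge b hb).symm
      rw [hD.symm b e, hD.symm e b', hD.symm b b']
      linarith

end Multifac

/-! ### Boolean intervals through a vertex and their joint nonexpansiveness -/

namespace Multifac

variable {V : Type*} {G : SimpleGraph V} {o : V → V → Prop} {D : V → V → ℝ}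

theorem GeoMetric.inf_sup' (hD : GeoMetric G D) (M : OrientedModular G o)
    {z x y m j : V} (hzx : Preceq o x z) (hzy : Preceq o y z) (hm : IsInf o x y m)
    (hj : IsSup o x y j) : D j z + D m z = D x z + D y z := by
  have h1 := hD.modular M hm hj
  have h2 := hD.chain M hj.2.1 (hj.2.2 z hzx hzy)
  have h3 := hD.chain M hm.1 hzx
  linarith

theorem OrientedModular.atomistic_inf (M : OrientedModular G o) {z x y m : V}
    (hx : Atomistic o x z) (hy : Atomistic o y z) (hm : IsInf o x y m) : Atomistic o m z := by
  rw [← M.atomistic_rev] at hx hy ⊢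
  exact M.reverse.atomistic_sup hx hy (isSup_rev.2 hm)

/-- Boolean intervals `[x, y]` between `a` and `b` that contain `z`. -/
def IntervalFeasible (o : V → V → Prop) (z a b x y : V) : Prop :=
  Preceq o a x ∧ Preceq o x z ∧ Preceq o z y ∧ Preceq o y b ∧ Atomistic o x y

def IntervalOpt (o : V → V → Prop) (D : V → V → ℝ) (z a b : V) (t : ℝ) (x y : V) : Prop :=
  IsOpt (IntervalFeasible o z a b) (fun x => D x z) (D z) t x y

theorem exists_intervalOpt [Finite V] (D : V → V → ℝ) {z a b : V} (t : ℝ) (ha : Atomistic o a z)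
    (hb : Preceq o z b) : ∃ x y, IntervalOpt o D z a b t x y :=
  exists_isOpt _ _ t (x₀ := a) (y₀ := z) ⟨.refl a, ha.1, .refl z, hb, ha⟩

variable (M : OrientedModular G o) (hD : GeoMetric G D)
include M hD

theorem intervalOpt_rev {z a b x y : V} {t : ℝ} (h : IntervalOpt o D z a b t x y) :
    IntervalOpt (rev o) D z b a (1 - t) y x := by
  have h1 := IsOpt.swap h
  have e1 : (fun y x => IntervalFeasible o z a b x y) = IntervalFeasible (rev o) z b a := by
    ext y x
    simp only [IntervalFeasible, preceq_rev, M.atomistic_rev]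
    tauto
  have e2 : D z = fun y => D y z := by
    funext y
    exact hD.symm z y
  rw [e1] at h1
  unfold IntervalOpt
  rw [← e2] at h1 ⊢
  exact h1

/-- Uncross two intervals into the one between the meets of their ends and the one between the
joins. Both are Boolean, by closure of Boolean pairs under subintervals and under joins or meets
with a common other end. -/
theorem intervalOpt_mono {t : ℝ} (ht : Generic D t) {z a b b' x y x' y' : V}
    (hb : Preceq o b' b) (h : IntervalOpt o D z a b t x y) (h' : IntervalOpt o D z a b' t x' y') :
    Preceq o x' x ∧ Preceq o y' y := by
  obtain ⟨h1, h2, h3, h4, h5⟩ := h.1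
  obtain ⟨h1', h2', h3', h4', h5'⟩ := h'.1
  obtain ⟨p, hp⟩ := M.exists_inf h1 h1'
  obtain ⟨q, hq⟩ := M.exists_sup h2 h2'
  obtain ⟨p', hp'⟩ := M.exists_inf h3 h3'
  obtain ⟨q', hq'⟩ := M.exists_sup h4 (h4'.trans hb)
  have hzp' := hp'.2.2 z h3 h3'
  have hqz := hq.2.2 z h2 h2'
  have F1 : IntervalFeasible o z a b' p p' :=
    ⟨hp.2.2 a h1 h1', hp.1.trans h2, hzp', hp'.2.1.trans h4',
      M.atomistic_inf (M.atomistic_lower h5 (h2.trans hzp') hp'.1)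
        (M.atomistic_lower h5' (h2'.trans hzp') hp'.2.1) hp⟩
  have F2 : IntervalFeasible o z a b q q' :=
    ⟨h1.trans hq.1, hqz, h3.trans hq'.1, hq'.2.2 b h4 (h4'.trans hb),
      M.atomistic_sup (M.atomistic_upper h5 hq.1 (hqz.trans h3))
        (M.atomistic_upper h5' hq.2.1 (hqz.trans h3')) hq'⟩
  have e1 := hD.inf_sup' M h2 h2' hp hq
  have e2 := hD.inf_sup M h3 h3' hp' hq'
  obtain ⟨c1, c2⟩ := uncross ht (distDiff_right D z) (distDiff_left D z) h h' F1 F2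
    (by linarith) (by linarith)
  have d2 := hD.eq_of_le M hzp' hp'.2.1 c2.symm
  have d1 : p = x' := by
    have := hD.chain M hp.2.1 h2'
    exact hD.eq_of_zero (by linarith)
  exact ⟨d1 ▸ hp.1, d2 ▸ hp'.1⟩

theorem intervalOpt_mono_left {t : ℝ} (ht : Generic D t) {z a a' b x y x' y' : V}
    (ha : Preceq o a a') (h : IntervalOpt o D z a b t x y) (h' : IntervalOpt o D z a' b t x' y') :
    Preceq o x x' ∧ Preceq o y y' := by
  obtain ⟨h1, h2⟩ := intervalOpt_mono M.reverse hD ht.swap (preceq_rev.2 ha)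
    (intervalOpt_rev M hD h) (intervalOpt_rev M hD h')
  exact ⟨preceq_rev.1 h2, preceq_rev.1 h1⟩

/-- Both [x, y] and [x, z₁] are Boolean, hence so is [x, y ∨ z₁]; with t > 0 this would be better
unless z₁ ≤ y. -/
theorem intervalOpt_center {t : ℝ} (ht0 : 0 < t) {z z₁ a b x y : V} (hz : Preceq o z z₁)
    (ha : Atomistic o a z₁) (hb : Preceq o z₁ b) (h : IntervalOpt o D z a b t x y) :
    Preceq o z₁ y := by
  obtain ⟨h1, h2, h3, h4, h5⟩ := h.1
  have hx := M.atomistic_upper ha h1 (h2.trans hz)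
  obtain ⟨j, hj⟩ := M.exists_sup h4 hb
  have := h.2 x j ⟨h1, h2, h3.trans hj.1, hj.2.2 b h4 hb, M.atomistic_sup h5 hx hj⟩
  have e := hD.chain M h3 hj.1
  have e' := hD.nonneg y j
  have : t * D y j ≤ 0 := by
    rw [← e] at this
    linarith
  have := hD.eq_of_zero (le_antisymm (nonpos_of_mul_nonpos_right this ht0) e')
  exact this ▸ hj.2.1

/-- Optimal intervals for either base contain both z and z₁, and on such intervals the two
objectives differ by a constant. -/
theorem intervalOpt_change [Finite V] {t : ℝ} (ht0 : 0 < t) (ht1 : t < 1) {z z₁ a b x y : V}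
    (hz : Preceq o z z₁) (ha : Atomistic o a z) (ha₁ : Atomistic o a z₁) (hb : Atomistic o z b)
    (hb₁ : Atomistic o z₁ b) (h : IntervalOpt o D z a b t x y) :
    IntervalOpt o D z₁ a b t x y := by
  have hy := intervalOpt_center M hD ht0 hz ha₁ hb₁.1 h
  obtain ⟨x₁, y₁, h₁⟩ := exists_intervalOpt D t ha₁ hb₁.1
  have hx₁ : Preceq o x₁ z := preceq_rev.1 (intervalOpt_center M.reverse hD (t := 1 - t)
    (by linarith) (preceq_rev.2 hz) (M.atomistic_rev.2 hb) (preceq_rev.2 ha.1)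
    (intervalOpt_rev M hD h₁))
  obtain ⟨f1, f2, f3, f4, f5⟩ := h.1
  obtain ⟨g1, g2, g3, g4, g5⟩ := h₁.1
  refine ⟨⟨f1, f2.trans hz, hy, f4, f5⟩, fun x' y' h' => (h₁.2 x' y' h').trans ?_⟩
  have := h.2 x₁ y₁ ⟨g1, hx₁, hz.trans g3, g4, g5⟩
  dsimp only at this ⊢
  rw [← hD.chain M hx₁ hz, ← hD.chain M f2 hz]
  rw [← hD.chain M hz g3, ← hD.chain M hz hy] at this
  linarith

omit M hD

/-- The Lipschitz property of the ends of the optimal intervals. -/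
def IntervalLip (o : V → V → Prop) (D : V → V → ℝ) (N : ℕ) (τ : ℕ → ℝ) (z a b z' a' b' : V) :
    Prop :=
  ∀ x y x' y' : ℕ → V, (∀ i < N, IntervalOpt o D z a b (mid τ i) (x i) (y i)) →
    (∀ i < N, IntervalOpt o D z' a' b' (mid τ i) (x' i) (y' i)) →
    ∑ i ∈ Finset.range N, (τ (i + 1) - τ i) * (D (x i) (x' i) + D (y i) (y' i)) ≤
      D a a' + D b b'

theorem IntervalLip.symm (hD : GeoMetric G D) {N : ℕ} {τ : ℕ → ℝ} {z a b z' a' b' : V}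
    (h : IntervalLip o D N τ z a b z' a' b') : IntervalLip o D N τ z' a' b' z a b := by
  intro x y x' y' hx hy
  have := h x' y' x y hy hx
  simpa only [hD.symm a' a, hD.symm b' b, hD.symm (x _) (x' _), hD.symm (y _) (y' _)] using this

variable {N : ℕ} {τ : ℕ → ℝ} (hτ : IsMesh D N τ)
include hτ

theorem sum_intervalOpt {z a b : V} (ha : Atomistic o a z) (hb : Atomistic o z b)
    (M : OrientedModular G o) (hD : GeoMetric G D) {x y : ℕ → V}
    (h : ∀ i < N, IntervalOpt o D z a b (mid τ i) (x i) (y i)) :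
    ∑ i ∈ Finset.range N, (τ (i + 1) - τ i) * (D z (y i) - D (x i) z) = D z b - D a z := by
  refine hτ.sum_slopes (distDiff_right D z) (distDiff_left D z) h (ya := z) (xb := z)
    ⟨.refl a, ha.1, .refl z, hb.1, ha⟩ (fun x y h => ?_)
    ⟨ha.1, .refl z, hb.1, .refl b, hb⟩ (fun x y h => ?_)
  · have := hD.chain M h.1 h.2.1
    have := hD.nonneg a x
    linarith
  · have := hD.chain M h.2.2.1 h.2.2.2.1
    have := hD.nonneg y b
    linarith

/-- Since both ends move in the same direction, the sum of their displacements is exactly a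
difference of slopes, and the slopes telescope. -/
theorem intervalLip_right (M : OrientedModular G o) (hD : GeoMetric G D) {z a b b' : V}
    (ha : Atomistic o a z) (hb : Atomistic o z b) (hb' : Atomistic o z b')
    (hbb : Preceq o b' b) : IntervalLip o D N τ z a b z a b' := by
  intro x y x' y' h h'
  have S := sum_intervalOpt hτ ha hb M hD h
  have S' := sum_intervalOpt hτ ha hb' M hD h'
  have key : ∀ i ∈ Finset.range N, (τ (i + 1) - τ i) * (D (x i) (x' i) + D (y i) (y' i)) =
      (τ (i + 1) - τ i) * (D z (y i) - D (x i) z) -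
        (τ (i + 1) - τ i) * (D z (y' i) - D (x' i) z) := by
    intro i hi
    rw [Finset.mem_range] at hi
    obtain ⟨h1, h2⟩ := intervalOpt_mono M hD (hτ.generic_mid hi) hbb (h i hi) (h' i hi)
    have c1 := hD.chain M h1 (h i hi).1.2.1
    have c2 := hD.chain M (h' i hi).1.2.2.1 h2
    rw [hD.symm (x i) (x' i), hD.symm (y i) (y' i), ← c1, ← c2]
    ring
  rw [Finset.sum_congr rfl key, Finset.sum_sub_distrib, S, S']
  have e := hD.chain M hb'.1 hbb
  rw [hD.self, hD.symm b b']
  linarith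

theorem intervalLip_left (M : OrientedModular G o) (hD : GeoMetric G D) {z a a' b : V}
    (ha : Atomistic o a z) (ha' : Atomistic o a' z) (hb : Atomistic o z b)
    (haa : Preceq o a a') : IntervalLip o D N τ z a b z a' b := by
  intro x y x' y' h h'
  have S := sum_intervalOpt hτ ha hb M hD h
  have S' := sum_intervalOpt hτ ha' hb M hD h'
  have key : ∀ i ∈ Finset.range N, (τ (i + 1) - τ i) * (D (x i) (x' i) + D (y i) (y' i)) =
      (τ (i + 1) - τ i) * (D z (y' i) - D (x' i) z) -
        (τ (i + 1) - τ i) * (D z (y i) - D (x i) z) := by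
    intro i hi
    rw [Finset.mem_range] at hi
    obtain ⟨h1, h2⟩ := intervalOpt_mono_left M hD (hτ.generic_mid hi) haa (h i hi) (h' i hi)
    have c1 := hD.chain M h1 (h' i hi).1.2.1
    have c2 := hD.chain M (h i hi).1.2.2.1 h2
    rw [← c1, ← c2]
    ring
  rw [Finset.sum_congr rfl key, Finset.sum_sub_distrib, S, S']
  have e := hD.chain M haa ha'.1
  rw [hD.self]
  linarith

theorem IntervalLip.trans (hD : GeoMetric G D) {z a b z₁ z₂ c e z' a' b' : V}
    (h₁ : IntervalLip o D N τ z a b z₁ c e) (h₂ : IntervalLip o D N τ z₂ c e z' a' b')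
    (hw : ∀ i < N, ∃ x y, IntervalOpt o D z₁ c e (mid τ i) x y ∧
      IntervalOpt o D z₂ c e (mid τ i) x y)
    (ea : D a c + D c a' = D a a') (eb : D b e + D e b' = D b b') :
    IntervalLip o D N τ z a b z' a' b' := by
  intro x y x' y' h h'
  have : Nonempty V := ⟨z⟩
  choose! u w hw1 hw2 using hw
  have k1 := h₁ x y u w h hw1
  have k2 := h₂ u w x' y' hw2 h'
  have : ∑ i ∈ Finset.range N, (τ (i + 1) - τ i) * (D (x i) (x' i) + D (y i) (y' i)) ≤
      ∑ i ∈ Finset.range N, (τ (i + 1) - τ i) * (D (x i) (u i) + D (y i) (w i)) +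
      ∑ i ∈ Finset.range N, (τ (i + 1) - τ i) * (D (u i) (x' i) + D (w i) (y' i)) := by
    rw [← Finset.sum_add_distrib]
    refine Finset.sum_le_sum fun i hi => ?_
    rw [← mul_add]
    refine mul_le_mul_of_nonneg_left ?_ (sub_nonneg.2 (hτ.lt i (Finset.mem_range.1 hi)).le)
    have := hD.triangle (x i) (u i) (x' i)
    have := hD.triangle (y i) (w i) (y' i)
    linarith
  linarith

theorem intervalLip_same [Finite V] (M : OrientedModular G o) (hD : GeoMetric G D)
    {z a b a' b' : V} (ha : Atomistic o a z) (hb : Atomistic o z b) (ha' : Atomistic o a' z)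
    (hb' : Atomistic o z b') : IntervalLip o D N τ z a b z a' b' := by
  obtain ⟨c, hc⟩ := M.exists_sup ha.1 ha'.1
  obtain ⟨e, he⟩ := M.exists_inf hb.1 hb'.1
  have hzc := M.atomistic_upper ha hc.1 (hc.2.2 z ha.1 ha'.1)
  have hze := M.atomistic_lower hb (he.2.2 z hb.1 hb'.1) he.1
  have ec := hD.add _ _ _ (M.inInterval_sup hc)
  have ee := hD.add _ _ _ (M.inInterval_inf he)
  have tr : ∀ {a b c e a' b' : V}, Atomistic o c z → Atomistic o z e →
      IntervalLip o D N τ z a b z c e → IntervalLip o D N τ z c e z a' b' →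
      D a c + D c a' = D a a' → D b e + D e b' = D b b' → IntervalLip o D N τ z a b z a' b' := by
    intro a b c e a' b' hc he h1 h2 e1 e2
    refine IntervalLip.trans hτ hD h1 h2 (fun i _ => ?_) e1 e2
    obtain ⟨x, y, hw⟩ := exists_intervalOpt D (mid τ i) hc he.1
    exact ⟨x, y, hw, hw⟩
  have l1 : IntervalLip o D N τ z a b z a b' :=
    tr ha hze (intervalLip_right hτ M hD ha hb hze he.1)
      (intervalLip_right hτ M hD ha hb' hze he.2.1 |>.symm hD) (by rw [hD.self, zero_add]) ee
  have l2 : IntervalLip o D N τ z a b' z a' b' :=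
    tr hzc hb' (intervalLip_left hτ M hD ha hzc hb' hc.1)
      (intervalLip_left hτ M hD ha' hzc hb' hc.2.1 |>.symm hD) ec (by rw [hD.self, zero_add])
  exact tr ha hb' l1 l2 (by rw [hD.self, zero_add]) (by rw [hD.self, add_zero])

/-- The ends of the optimal intervals are jointly nonexpansive. -/
theorem intervalLip [Finite V] (M : OrientedModular G o) (hD : GeoMetric G D)
    {z a b z' a' b' : V} (ha : Atomistic o a z) (hb : Atomistic o z b) (ha' : Atomistic o a' z')
    (hb' : Atomistic o z' b') : IntervalLip o D N τ z a b z' a' b' := by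
  obtain ⟨n, hn⟩ : ∃ n, G.dist z z' = n := ⟨_, rfl⟩
  induction n generalizing z a b with
  | zero =>
    obtain rfl := M.eq_of_dist hn
    exact intervalLip_same hτ M hD ha hb ha' hb'
  | succ n ih =>
    have hne : z ≠ z' := by
      rintro rfl
      simp at hn
    obtain ⟨z₁, hz, hz'⟩ := M.exists_step hne
    rw [G.dist_comm, G.dist_comm (u := z')] at hz'
    obtain ⟨c, hc, hgc⟩ := M.lower_gated z a'
    obtain ⟨e, he, hge⟩ := M.upper_gated z b'
    have hc : Atomistic o c z := hc
    have he : Atomistic o z e := he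
    -- The gates of a' and b' remain Boolean neighbors of the next base z₁, which is what permits
    -- moving the base.
    have hc1 := M.gate_lower hz hz' ha' hc hgc
    have he1 := M.gate_upper hz hz' hb' he hge
    have l1 := intervalLip_same hτ M hD ha hb hc he
    have l2 := ih hc1 he1 (by omega)
    refine IntervalLip.trans hτ hD l1 l2 (fun i hi => ?_) ?_ ?_
    · have t0 := hτ.mid_pos hi
      have t1 := hτ.mid_lt_one hi
      rcases M.adm.total _ _ hz with h | h
      · obtain ⟨x, y, hw⟩ := exists_intervalOpt D (mid τ i) hc he.1
        exact ⟨x, y, hw, intervalOpt_change M hD t0 t1 (.of_edge h) hc hc1 he he1 hw⟩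
      · obtain ⟨x, y, hw⟩ := exists_intervalOpt D (mid τ i) hc1 he1.1
        exact ⟨x, y, intervalOpt_change M hD t0 t1 (.of_edge h) hc1 hc he1 he hw, hw⟩
    · have := hD.add a' a c (hgc a ha).symm
      rw [hD.symm a c, hD.symm c a', hD.symm a a']
      linarith
    · have := hD.add b' b e (hge b hb).symm
      rw [hD.symm b e, hD.symm e b', hD.symm b b']
      linarith

end Multifac

/-! ### Convexity of the location function and the local-to-global principle -/

namespace Multifac

variable {V : Type*} {G : SimpleGraph V} {o : V → V → Prop}

/-- The multifacility location function for an arbitrary distance function. -/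
noncomputable def costD [Fintype V] (D : V → V → ℝ) {n : ℕ} (c : Sym2 (V ⊕ Fin n) → ℚ≥0)
    (ρ : Fin n → V) : ℝ :=
  (∑ s : V, ∑ j : Fin n, (c s(Sum.inl s, Sum.inr j) : ℝ) * D s (ρ j)) +
    ∑ i : Fin n, ∑ j ∈ Finset.Ioi i, (c s(Sum.inr i, Sum.inr j) : ℝ) * D (ρ i) (ρ j)

section Cost

variable [Fintype V] {D : V → V → ℝ} {n : ℕ} {c : Sym2 (V ⊕ Fin n) → ℚ≥0}

/-- Linearity of the location function in the distance function, as an inequality. -/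
theorem sum_costD_le {ι : Type*} (K : Finset ι) (w : ι → ℝ) (X Y : ι → Fin n → V)
    (α β : Fin n → V)
    (hs : ∀ s j, ∑ k ∈ K, w k * (D s (X k j) + D s (Y k j)) ≤ D s (α j) + D s (β j))
    (hp : ∀ i j, ∑ k ∈ K, w k * (D (X k i) (X k j) + D (Y k i) (Y k j)) ≤
      D (α i) (α j) + D (β i) (β j)) :
    ∑ k ∈ K, w k * (costD D c (X k) + costD D c (Y k)) ≤ costD D c α + costD D c β := by
  have e1 : ∑ k ∈ K, w k * (costD D c (X k) + costD D c (Y k)) =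
      (∑ s : V, ∑ j : Fin n, (c s(Sum.inl s, Sum.inr j) : ℝ) *
        ∑ k ∈ K, w k * (D s (X k j) + D s (Y k j))) +
      ∑ i : Fin n, ∑ j ∈ Finset.Ioi i, (c s(Sum.inr i, Sum.inr j) : ℝ) *
        ∑ k ∈ K, w k * (D (X k i) (X k j) + D (Y k i) (Y k j)) := by
    simp only [Finset.mul_sum]
    have h1 : ∀ s : V, ∑ j : Fin n, ∑ k ∈ K, (c s(Sum.inl s, Sum.inr j) : ℝ) *
        (w k * (D s (X k j) + D s (Y k j))) = ∑ k ∈ K, ∑ j : Fin n,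
        (c s(Sum.inl s, Sum.inr j) : ℝ) * (w k * (D s (X k j) + D s (Y k j))) :=
      fun s => Finset.sum_comm
    have h2 : ∀ i : Fin n, ∑ j ∈ Finset.Ioi i, ∑ k ∈ K, (c s(Sum.inr i, Sum.inr j) : ℝ) *
        (w k * (D (X k i) (X k j) + D (Y k i) (Y k j))) = ∑ k ∈ K, ∑ j ∈ Finset.Ioi i,
        (c s(Sum.inr i, Sum.inr j) : ℝ) * (w k * (D (X k i) (X k j) + D (Y k i) (Y k j))) :=
      fun i => Finset.sum_comm
    simp only [h1, h2]
    rw [Finset.sum_comm, Finset.sum_comm (s := Finset.univ) (t := K), ← Finset.sum_add_distrib]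
    refine Finset.sum_congr rfl fun k _ => ?_
    unfold costD
    rw [add_add_add_comm, mul_add, ← Finset.sum_add_distrib, ← Finset.sum_add_distrib,
      Finset.mul_sum, Finset.mul_sum]
    congr 1 <;> refine Finset.sum_congr rfl fun i _ => ?_ <;>
      rw [← Finset.sum_add_distrib, Finset.mul_sum] <;>
      exact Finset.sum_congr rfl fun j _ => by ring
  have e2 : costD D c α + costD D c β =
      (∑ s : V, ∑ j : Fin n, (c s(Sum.inl s, Sum.inr j) : ℝ) * (D s (α j) + D s (β j))) +
      ∑ i : Fin n, ∑ j ∈ Finset.Ioi i, (c s(Sum.inr i, Sum.inr j) : ℝ) *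
        (D (α i) (α j) + D (β i) (β j)) := by
    unfold costD
    simp only [mul_add, Finset.sum_add_distrib]
    ring
  rw [e1, e2]
  refine add_le_add ?_ ?_ <;> refine Finset.sum_le_sum fun i _ => Finset.sum_le_sum fun j _ =>
    mul_le_mul_of_nonneg_left ?_ (NNRat.cast_nonneg _)
  · exact hs i j
  · exact hp i j

variable {N : ℕ} {τ : ℕ → ℝ} (hτ : IsMesh D N τ) (M : OrientedModular G o) (hD : GeoMetric G D)
include hτ M hD

theorem sum_cost_fracJoin_le {z α β m : Fin n → V} {v : ℕ → Fin n → V}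
    (ha : ∀ i, Preceq o (z i) (α i)) (hb : ∀ i, Preceq o (z i) (β i))
    (hm : ∀ i, IsInf o (α i) (β i) (m i))
    (hv : ∀ k < N, ∀ i, FracJoin o D (z i) (α i) (β i) (mid τ k) (v k i)) :
    ∑ k ∈ Finset.range N, (τ (k + 1) - τ k) * costD D c (v k) + costD D c m ≤
      costD D c α + costD D c β := by
  have W := hτ.sum_weights
  have split : ∀ (g : ℕ → ℝ) (a : ℝ), ∑ k ∈ Finset.range N, (τ (k + 1) - τ k) * (g k + a) =
      ∑ k ∈ Finset.range N, (τ (k + 1) - τ k) * g k + a := by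
    intro g a
    simp only [mul_add, Finset.sum_add_distrib, ← Finset.sum_mul, W, one_mul]
  rw [← split]
  refine sum_costD_le _ _ v (fun _ => m) α β (fun s j => ?_) (fun i j => ?_)
  · rw [split]
    refine joinLip hτ M hD (z := s) (a := s) (b := s) (.refl s) (.refl s) (ha j) (hb j)
      (fun _ => s) (fun k => v k j) (fun k _ => ?_) (fun k hk => hv k hk j) s (m j)
      ⟨.refl s, .refl s, fun _ h _ => h⟩ (hm j)
    -- A fixed vertex s enters as the data z = a = b = s, for which (s, s) is the only feasible
    -- pair.
    obtain ⟨u, x, y, h, hu⟩ := exists_fracJoin M D (mid τ k) (z := s) (.refl s) (.refl s)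
    obtain rfl := M.antisymm h.1.1 h.1.2.1
    obtain rfl := M.antisymm h.1.2.2.1 h.1.2.2.2.1
    exact ⟨_, _, h, .refl _, .refl _, fun _ h _ => h⟩
  · rw [split]
    exact joinLip hτ M hD (ha i) (hb i) (ha j) (hb j) _ _ (fun k hk => hv k hk i)
      (fun k hk => hv k hk j) _ _ (hm i) (hm j)

theorem sum_cost_interval_le {z α β : Fin n → V} {x y : ℕ → Fin n → V}
    (ha : ∀ i, Atomistic o (α i) (z i)) (hb : ∀ i, Atomistic o (z i) (β i))
    (h : ∀ k < N, ∀ i, IntervalOpt o D (z i) (α i) (β i) (mid τ k) (x k i) (y k i)) :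
    ∑ k ∈ Finset.range N, (τ (k + 1) - τ k) * (costD D c (x k) + costD D c (y k)) ≤
      costD D c α + costD D c β := by
  refine sum_costD_le _ _ x y α β (fun s j => ?_) (fun i j => ?_)
  · refine intervalLip hτ M hD (z := s) (a := s) (b := s) (M.atomistic_refl s)
      (M.atomistic_refl s) (ha j) (hb j) (fun _ => s) (fun _ => s) (fun k => x k j)
      (fun k => y k j) (fun k _ => ?_) (fun k hk => h k hk j)
    obtain ⟨u, v, h⟩ := exists_intervalOpt D (mid τ k) (M.atomistic_refl s) (.refl s)
    obtain rfl := M.antisymm h.1.1 h.1.2.1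
    obtain rfl := M.antisymm h.1.2.2.1 h.1.2.2.2.1
    exact h
  · exact intervalLip hτ M hD (ha i) (hb i) (ha j) (hb j) _ _ _ _ (fun k hk => h k hk i)
      (fun k hk => h k hk j)

end Cost

theorem IsMesh.exists_lt {D : V → V → ℝ} {N : ℕ} {τ : ℕ → ℝ} (hτ : IsMesh D N τ) {g : ℕ → ℝ}
    {a : ℝ} (h : ∑ k ∈ Finset.range N, (τ (k + 1) - τ k) * g k ≤ a) (h0 : a < g 0) :
    ∃ k < N, g k < a := by
  by_contra hne
  push Not at hne
  have W := hτ.sum_weights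
  have : ∑ k ∈ Finset.range N, (τ (k + 1) - τ k) * a <
      ∑ k ∈ Finset.range N, (τ (k + 1) - τ k) * g k := by
    refine Finset.sum_lt_sum (fun k hk => ?_) ⟨0, Finset.mem_range.2 hτ.pos, ?_⟩
    · rw [Finset.mem_range] at hk
      exact mul_le_mul_of_nonneg_left (hne k hk) (sub_nonneg.2 (hτ.lt k hk).le)
    · exact mul_lt_mul_of_pos_left h0 (sub_pos.2 (hτ.lt 0 hτ.pos))
  rw [← Finset.sum_mul, W, one_mul] at this
  exact this.not_ge h

/-- Neighboring locations. -/
def Near (o : V → V → Prop) {n : ℕ} (x y : Fin n → V) : Prop :=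
  (∀ i, Atomistic o (x i) (y i)) ∨ (∀ i, Atomistic o (y i) (x i))

/-- A step to a neighbor of value less than `F`. -/
def StepBelow (o : V → V → Prop) {n : ℕ} (f : (Fin n → V) → ℝ) (F : ℝ) (x y : Fin n → V) : Prop :=
  Near o x y ∧ f y < F

theorem near_rev (M : OrientedModular G o) {n : ℕ} {x y : Fin n → V} :
    Near (rev o) x y ↔ Near o x y := by
  simp only [Near, M.atomistic_rev]
  exact or_comm

theorem sum_dist_lt {n : ℕ} {a b a' b' : Fin n → V} (h : ∀ i, G.dist (a' i) (b' i) ≤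
    G.dist (a i) (b i)) {i : Fin n} (hi : G.dist (a' i) (b' i) ≠ G.dist (a i) (b i)) :
    ∑ i, G.dist (a' i) (b' i) < ∑ i, G.dist (a i) (b i) :=
  Finset.sum_lt_sum (fun i _ => h i) ⟨i, Finset.mem_univ i, lt_of_le_of_ne (h i) hi⟩

section Peak

variable [Fintype V] {D : V → V → ℝ} {n : ℕ} (c : Sym2 (V ⊕ Fin n) → ℚ≥0)
  (M : OrientedModular G o) (hD : GeoMetric G D) {F : ℝ}
include M hD

/-- The averaged cost of the pairs (x k, y k) is at most the cost of α and β. A suitable k gives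
either a direct detour α, x k, y k, β, or an end strictly closer to z that is below F, and then
induction applies. The cost of z plays no role. -/
theorem peak_through (z α β : Fin n → V)
    (ha : ∀ i, Atomistic o (α i) (z i)) (hb : ∀ i, Atomistic o (z i) (β i))
    (hα : costD D c α ≤ F) (hβ : costD D c β < F) :
    Relation.ReflTransGen (StepBelow o (costD D c) F) α β := by
  obtain ⟨r, hr⟩ : ∃ r, ∑ i, G.dist (α i) (z i) + ∑ i, G.dist (z i) (β i) = r := ⟨_, rfl⟩
  induction r using Nat.strong_induction_on generalizing α β with
  | _ r ih =>
    subst hr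
    obtain ⟨N, τ, hτ⟩ := exists_mesh D
    choose x y hxy using fun (k : ℕ) (i : Fin n) =>
      exists_intervalOpt D (mid τ k) (ha i) (hb i).1
    have hS := sum_cost_interval_le (c := c) hτ M hD ha hb (fun k _ i => hxy k i)
    have ax : ∀ k i, Atomistic o (α i) (x k i) :=
      fun k i => M.atomistic_lower (ha i) (hxy k i).1.1 (hxy k i).1.2.1
    have xz : ∀ k i, Atomistic o (x k i) (z i) :=
      fun k i => M.atomistic_upper (ha i) (hxy k i).1.1 (hxy k i).1.2.1
    have zy : ∀ k i, Atomistic o (z i) (y k i) :=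
      fun k i => M.atomistic_lower (hb i) (hxy k i).1.2.2.1 (hxy k i).1.2.2.2.1
    have yb : ∀ k i, Atomistic o (y k i) (β i) :=
      fun k i => M.atomistic_upper (hb i) (hxy k i).1.2.2.1 (hxy k i).1.2.2.2.1
    have left : ∀ k, costD D c (x k) < F → x k ≠ α →
        Relation.ReflTransGen (StepBelow o (costD D c) F) α β := by
      intro k hk hne
      obtain ⟨i, hi⟩ := Function.ne_iff.1 hne
      refine .head ⟨.inl (ax k), hk⟩ (ih _ ?_ (x k) β (xz k) hb hk.le hβ rfl)
      have hd := fun i => M.dist_add_of_preceq (ax k i).1 (xz k i).1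
      refine add_lt_add_left (sum_dist_lt (fun i => ?_) (i := i) ?_) _
      · have := hd i
        unfold InInterval at this
        omega
      · intro e
        have := hd i
        unfold InInterval at this
        exact hi (M.eq_of_dist (by omega)).symm
    have right : ∀ k, costD D c (y k) < F → y k ≠ β →
        Relation.ReflTransGen (StepBelow o (costD D c) F) α β := by
      intro k hk hne
      obtain ⟨i, hi⟩ := Function.ne_iff.1 hne
      refine .tail (ih _ ?_ α (y k) ha (zy k) hα hk rfl) ⟨.inl (yb k), hβ⟩
      have hd := fun i => M.dist_add_of_preceq (zy k i).1 (yb k i).1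
      refine add_lt_add_right (sum_dist_lt (fun i => ?_) (i := i) ?_) _
      · have := hd i
        unfold InInterval at this
        omega
      · intro e
        have := hd i
        unfold InInterval at this
        exact hi (M.eq_of_dist (by omega))
    -- The closed first cell contains t = 0, where only the length below z counts.
    have hx0 : x 0 = α := by
      funext i
      have h := hτ.isOpt_cell (distDiff_right D (z i)) (distDiff_left D (z i)) hτ.pos (hxy 0 i)
        le_rfl (hτ.lt 0 hτ.pos).le
      rw [hτ.zero] at h
      have h1 := h.2 (α i) (z i) ⟨.refl _, (ha i).1, .refl _, (hb i).1, ha i⟩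
      have h2 := hD.chain M (ax 0 i).1 (xz 0 i).1
      have h3 := hD.nonneg (α i) (x 0 i)
      exact (hD.eq_of_zero (by linarith)).symm
    rcases lt_or_ge (costD D c (y 0)) F with h0 | h0
    · by_cases hy : y 0 = β
      · refine .single ⟨.inl fun i => ?_, hβ⟩
        have := (hxy 0 i).1.2.2.2.2
        rwa [hx0, hy] at this
      · exact right 0 h0 hy
    -- As x 0 = α and y 0 costs at least F, the first pair exceeds the average bound, so another
    -- pair is strictly below it.
    obtain ⟨k, -, hk⟩ := hτ.exists_lt hS (by rw [hx0]; linarith)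
    rcases lt_or_ge (costD D c (x k)) F with h1 | h1
    · rcases lt_or_ge (costD D c (y k)) F with h2 | h2
      · exact .head ⟨.inl (ax k), h1⟩ (.head ⟨.inl fun i => (hxy k i).1.2.2.2.2, h2⟩
          (.single ⟨.inl (yb k), hβ⟩))
      · refine left k h1 fun e => ?_
        rw [e] at hk
        linarith
    · refine right k (by linarith) fun e => ?_
      rw [e] at hk
      linarith

/-- If the meet costs less than F, pass through it. Otherwise the fractional joins cost on average
less than F; one different from α and β lies between them and splits the task into two with smaller
distance. In the exceptional case where the first one is β, α and β are neighbors. -/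
theorem peak_above (z α β : Fin n → V)
    (ha : ∀ i, Atomistic o (z i) (α i)) (hb : ∀ i, Atomistic o (z i) (β i))
    (hα : costD D c α ≤ F) (hβ : costD D c β < F) :
    Relation.ReflTransGen (StepBelow o (costD D c) F) α β := by
  obtain ⟨r, hr⟩ : ∃ r, ∑ i, G.dist (α i) (β i) = r := ⟨_, rfl⟩
  induction r using Nat.strong_induction_on generalizing α β with
  | _ r ih =>
    subst hr
    obtain ⟨N, τ, hτ⟩ := exists_mesh D
    choose m hm using fun i => M.exists_inf (ha i).1 (hb i).1
    choose v x y hxy hv using fun (k : ℕ) (i : Fin n) =>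
      exists_fracJoin M D (mid τ k) (ha i).1 (hb i).1
    have hS := sum_cost_fracJoin_le (c := c) hτ M hD (fun i => (ha i).1) (fun i => (hb i).1) hm
      (fun k _ i => ⟨_, _, hxy k i, hv k i⟩)
    have hzm := fun i => (hm i).2.2 _ (ha i).1 (hb i).1
    rcases lt_or_ge (costD D c m) F with h1 | h1
    · exact .head ⟨.inr fun i => M.atomistic_upper (ha i) (hzm i) (hm i).1, h1⟩
        (.single ⟨.inl fun i => M.atomistic_upper (hb i) (hzm i) (hm i).2.1, hβ⟩)
    have hzv : ∀ k i, Atomistic o (z i) (v k i) := fun k i => by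
      obtain ⟨⟨h1, h2, h3, h4, -⟩, -⟩ := hxy k i
      exact M.atomistic_sup (M.atomistic_lower (ha i) h1 h2) (M.atomistic_lower (hb i) h3 h4)
        (hv k i)
    have hint : ∀ k < N, ∀ i, InInterval G (α i) (β i) (v k i) := fun k hk i => by
      have hi := joinOpt_inf M hD (hτ.mid_pos hk) (hτ.mid_lt_one hk) (hxy k i) (hm i)
      have e1 := M.dist_modular hi (hv k i)
      have e2 := M.dist_modular hi.symm (hv k i).symm
      have c1 := M.dist_add_of_preceq hi.1 (hxy k i).1.2.1
      have c2 := M.dist_add_of_preceq hi.2.1 (hxy k i).1.2.2.2.1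
      have c3 := M.inInterval_inf (hm i)
      have t1 := M.triangle (α i) (x k i) (v k i)
      have t2 := M.triangle (v k i) (y k i) (β i)
      have t3 := M.triangle (α i) (v k i) (β i)
      unfold InInterval at *
      rw [G.dist_comm (u := α i) (v := x k i)] at t1
      rw [G.dist_comm (u := v k i) (v := y k i)] at t2
      rw [G.dist_comm (u := α i) (v := m i)] at c3
      omega
    have middle : ∀ k < N, costD D c (v k) < F → v k ≠ α → v k ≠ β →
        Relation.ReflTransGen (StepBelow o (costD D c) F) α β := by
      intro k hk hF hne1 hne2
      obtain ⟨i, hi⟩ := Function.ne_iff.1 hne1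
      obtain ⟨j, hj⟩ := Function.ne_iff.1 hne2
      refine (ih _ ?_ α (v k) ha (hzv k) hα hF rfl).trans
        (ih _ ?_ (v k) β (hzv k) hb hF.le hβ rfl)
      · refine sum_dist_lt (fun i => ?_) (i := j) fun e => ?_
        · have := hint k hk i
          unfold InInterval at this
          omega
        · have := hint k hk j
          unfold InInterval at this
          exact hj (M.eq_of_dist (by omega))
      · refine sum_dist_lt (fun i => ?_) (i := i) fun e => ?_
        · have := hint k hk i
          unfold InInterval at this
          omega
        · have := hint k hk i
          unfold InInterval at this
          exact hi (M.eq_of_dist (by omega)).symm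
    by_cases hv0 : v 0 = β
    · refine .single ⟨.inl fun i => M.atomistic_upper (hb i) (ha i).1 ?_, hβ⟩
      have h := hτ.isOpt_cell (distDiff_left D (z i)) (distDiff_left D (z i)) hτ.pos (hxy 0 i)
        le_rfl (hτ.lt 0 hτ.pos).le
      rw [hτ.zero] at h
      have h1 := h.2 (α i) (z i) ⟨(ha i).1, .refl _, .refl _, (hb i).1, α i, .refl _, (ha i).1⟩
      have h2 := hD.chain M h.1.1 h.1.2.1
      have h3 := hD.nonneg (x 0 i) (α i)
      have h4 := hD.eq_of_zero (p := x 0 i) (q := α i) (by linarith)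
      have h5 := (hv 0 i).1
      rwa [h4, hv0] at h5
    by_cases h2 : costD D c (v 0) < F ∧ v 0 ≠ α
    · exact middle 0 hτ.pos h2.1 h2.2 hv0
    have h3 : costD D c α + costD D c β - F < costD D c (v 0) := by
      rw [not_and_or, not_lt, not_not] at h2
      rcases h2 with h2 | h2
      · linarith
      · rw [h2]
        linarith
    -- The strict bound is below the costs of both α and F, and at most that of β, so this v k
    -- differs from α and β.
    obtain ⟨k, hk, hlt⟩ := hτ.exists_lt (g := fun k => costD D c (v k)) (by linarith) h3
    refine middle k hk (by linarith) ?_ ?_ <;> intro e <;> simp only [e] at hlt <;> linarith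

theorem peak (z α β : Fin n → V) (ha : Near o α z) (hb : Near o z β)
    (hα : costD D c α ≤ F) (hβ : costD D c β < F) :
    Relation.ReflTransGen (StepBelow o (costD D c) F) α β := by
  have hrev : StepBelow (rev o) (costD D c) F = StepBelow o (costD D c) F := by
    ext x y
    rw [StepBelow, StepBelow, near_rev M]
  rcases ha with ha | ha <;> rcases hb with hb | hb
  · exact peak_through c M hD z α β ha hb hα hβ
  · rw [← hrev]
    exact peak_above c M.reverse hD z α β (fun i => M.atomistic_rev.2 (ha i))
      (fun i => M.atomistic_rev.2 (hb i)) hα hβ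
  · exact peak_above c M hD z α β ha hb hα hβ
  · rw [← hrev]
    exact peak_through c M.reverse hD z α β (fun i => M.atomistic_rev.2 (ha i))
      (fun i => M.atomistic_rev.2 (hb i)) hα hβ

/-- Work back from σ: the tail already stays below F, so each vertex of height F is followed by one
below F and can be bypassed as a peak. -/
theorem lower_chain {ρ σ : Fin n → V}
    (h : Relation.ReflTransGen (fun x y => Near o x y ∧ costD D c y ≤ F) ρ σ)
    (hρ : costD D c ρ ≤ F) (hσ : costD D c σ < F) :
    Relation.ReflTransGen (StepBelow o (costD D c) F) ρ σ := by
  induction h using Relation.ReflTransGen.head_induction_on with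
  | refl => exact .refl
  | @head x y hxy _ ih =>
    have hy := ih hxy.2
    rcases hxy.2.lt_or_eq with h1 | h1
    · exact .head ⟨hxy.1, h1⟩ hy
    rcases Relation.ReflTransGen.cases_head hy with rfl | ⟨y', h2, h3⟩
    · exact absurd h1 hσ.ne
    · exact (peak c M hD y x y' hxy.1 h2.1 hρ h2.2).trans h3

end Peak

theorem near_update (M : OrientedModular G o) {n : ℕ} (ρ : Fin n → V) (i : Fin n) (v : V) :
    Relation.ReflTransGen (Near o) ρ (Function.update ρ i v) := by
  have h := (SimpleGraph.reachable_iff_reflTransGen _ _).1 (M.conn.preconnected (ρ i) v)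
  induction h with
  | refl => rw [Function.update_eq_self]
  | @tail b d _ hbd ih =>
    refine ih.tail ?_
    have key : ∀ {b d}, o b d → ∀ j, Atomistic o (Function.update ρ i b j)
        (Function.update ρ i d j) := by
      intro b d h j
      rcases eq_or_ne j i with rfl | hj
      · simpa using M.atomistic_edge h
      · simpa [hj] using M.atomistic_refl (ρ j)
    exact (M.adm.total _ _ hbd).imp key key

theorem near_connected (M : OrientedModular G o) {n : ℕ} (ρ σ : Fin n → V) :
    Relation.ReflTransGen (Near o) ρ σ := by
  have key : ∀ S : Finset (Fin n), Relation.ReflTransGen (Near o) ρ (S.piecewise σ ρ) := by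
    intro S
    induction S using Finset.induction_on with
    | empty => simpa using Relation.ReflTransGen.refl
    | insert i S _ ih =>
      rw [Finset.piecewise_insert]
      exact ih.trans (near_update M _ _ _)
  simpa using key Finset.univ

/-- A location that is optimal among its neighbors is optimal. -/
theorem local_optimal [Fintype V] {D : V → V → ℝ} {n : ℕ} (c : Sym2 (V ⊕ Fin n) → ℚ≥0)
    (M : OrientedModular G o) (hD : GeoMetric G D) {ρ : Fin n → V}
    (h : ∀ ρ', Near o ρ ρ' → costD D c ρ ≤ costD D c ρ') (σ : Fin n → V) :
    costD D c ρ ≤ costD D c σ := by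
  by_contra hlt
  push Not at hlt
  -- Attained costs that bound the height of some path from ρ to σ; an element of least cost is
  -- chosen.
  let K : Set (Fin n → V) := {a | costD D c ρ ≤ costD D c a ∧
    Relation.ReflTransGen (fun x y => Near o x y ∧ costD D c y ≤ costD D c a) ρ σ}
  have hK : K.Nonempty := by
    obtain ⟨a, -, ha⟩ := Set.exists_max_image Set.univ (costD D c) (Set.toFinite _) ⟨ρ, trivial⟩
    exact ⟨a, ha ρ trivial, Relation.ReflTransGen.mono (fun x y hxy => ⟨hxy, ha y trivial⟩) _ _
      (near_connected M ρ σ)⟩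
  obtain ⟨a, ⟨ha1, ha2⟩, hmin⟩ := Set.exists_min_image K (costD D c) (Set.toFinite _) hK
  have hchain := lower_chain c M hD ha2 ha1 (hlt.trans_le ha1)
  rcases ha1.lt_or_eq with h1 | h1
  -- There are finitely many costs, so a path strictly below the least height stays below the next
  -- smaller attained cost, a contradiction.
  · obtain ⟨b, hb, hmax⟩ := Set.exists_max_image {b | costD D c b < costD D c a} (costD D c)
      (Set.toFinite _) ⟨ρ, h1⟩
    exact hb.not_ge (hmin b ⟨hmax ρ h1, Relation.ReflTransGen.mono
      (fun x y hxy => ⟨hxy.1, hmax y hxy.2⟩) _ _ hchain⟩)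
  · rcases Relation.ReflTransGen.cases_head hchain with rfl | ⟨y, h2, -⟩
    · exact lt_irrefl _ hlt
    · exact (h y h2.1).not_gt (h1 ▸ h2.2)

end Multifac

/-! ### Edge lengths, orbits and Q-neighbors -/

namespace Multifac

variable {V : Type*} {G : SimpleGraph V} {o : V → V → Prop}

/-- A nonnegative edge length for which opposite edges of 4-cycles have the same length. -/
structure EdgeLength (G : SimpleGraph V) (h : Sym2 V → ℝ) : Prop where
  nonneg : ∀ e ∈ G.edgeSet, 0 ≤ h e
  parallel : ∀ u v v' u', IsFourCycle G u v v' u' → h s(u, v) = h s(u', v')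

namespace EdgeLength

variable {h : Sym2 V → ℝ} (hh : EdgeLength G h)
include hh

theorem sum_nonneg {p q : V} (w : G.Walk p q) : 0 ≤ (w.edges.map h).sum := by
  refine List.sum_nonneg fun x hx => ?_
  obtain ⟨e, he, rfl⟩ := List.mem_map.1 hx
  exact hh.nonneg e (w.edges_subset_edgeSet he)

theorem wdist_le {p q : V} (w : G.Walk p q) : wdist G h p q ≤ (w.edges.map h).sum :=
  ciInf_le ⟨0, by rintro _ ⟨w, rfl⟩; exact hh.sum_nonneg w⟩ w

variable (M : OrientedModular G o)
include M

/-- Two geodesics with different first edges are compared through a quadrangle at p, whose opposite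
sides have equal length. -/
theorem geodesic_unique : ∀ (n : ℕ) (p q : V) (w w' : G.Walk p q), G.dist p q = n →
    w.length = n → w'.length = n → (w.edges.map h).sum = (w'.edges.map h).sum := by
  intro n
  induction n with
  | zero =>
    intro p q w w' _ hw hw'
    rw [← SimpleGraph.Walk.length_edges, List.length_eq_zero_iff] at hw hw'
    rw [hw, hw']
  | succ n ih =>
    intro p q w w' hn hw hw'
    cases w with
    | nil => simp at hw
    | @cons _ u _ e w =>
      cases w' with
      | nil => simp at hw'
      | @cons _ u' _ e' w' =>
        rw [SimpleGraph.Walk.length_cons] at hw hw'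
        have d1 := G.dist_le w
        have d2 := G.dist_le w'
        have d3 := M.dist_adj' e q
        have d4 := M.dist_adj' e' q
        simp only [SimpleGraph.Walk.edges_cons, List.map_cons, List.sum_cons]
        by_cases hu : u = u'
        · subst hu
          rw [ih u q w w' (by omega) (by omega) (by omega)]
        obtain ⟨y, y1, y2, y3⟩ := M.quadrangle (v := q) e e' hu
          (by rw [G.dist_comm, G.dist_comm (u := q)]; omega)
          (by rw [G.dist_comm, G.dist_comm (u := q)]; omega)
        rw [G.dist_comm, G.dist_comm (u := q)] at y3
        obtain ⟨r, hr⟩ := M.conn.exists_walk_length_eq_dist y q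
        have hpy : p ≠ y := by
          rintro rfl
          omega
        rw [ih u q w (.cons y1 r) (by omega) (by omega)
            (by rw [SimpleGraph.Walk.length_cons]; omega),
          ih u' q w' (.cons y2 r) (by omega) (by omega)
            (by rw [SimpleGraph.Walk.length_cons]; omega)]
        simp only [SimpleGraph.Walk.edges_cons, List.map_cons, List.sum_cons]
        rw [hh.parallel p u y u' ⟨e, y1, y2.symm, e'.symm, hpy, hu⟩,
          hh.parallel p u' y u ⟨e', y2, y1.symm, e.symm, hpy, Ne.symm hu⟩]
        ring

/-- Induct on r. If its first edge approaches q, the geodesic may be assumed to start with it; if it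
recedes, going back along it and then along w is a geodesic from the next vertex. -/
theorem geodesic_le {p q : V} (r : G.Walk p q) : ∀ w : G.Walk p q, w.length = G.dist p q →
    (w.edges.map h).sum ≤ (r.edges.map h).sum := by
  induction r with
  | nil =>
    intro w hw
    rw [SimpleGraph.dist_self, ← SimpleGraph.Walk.length_edges, List.length_eq_zero_iff] at hw
    rw [hw]
    rfl
  | @cons p u q e r ih =>
    intro w hw
    have he := hh.nonneg _ (G.mem_edgeSet.2 e)
    simp only [SimpleGraph.Walk.edges_cons, List.map_cons, List.sum_cons]
    rcases M.dist_adj' e q with hd | hd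
    · obtain ⟨w', hw'⟩ := M.conn.exists_walk_length_eq_dist u q
      have h1 := ih w' hw'
      have h2 := hh.geodesic_unique M _ p q w (.cons e w') rfl hw
        (by rw [SimpleGraph.Walk.length_cons]; omega)
      simp only [SimpleGraph.Walk.edges_cons, List.map_cons, List.sum_cons] at h2
      linarith
    · have h1 := ih (.cons e.symm w) (by rw [SimpleGraph.Walk.length_cons]; omega)
      simp only [SimpleGraph.Walk.edges_cons, List.map_cons, List.sum_cons] at h1
      rw [Sym2.eq_swap] at h1
      linarith

theorem wdist_geodesic {p q : V} (w : G.Walk p q) (hw : w.length = G.dist p q) :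
    wdist G h p q = (w.edges.map h).sum :=
  le_antisymm (hh.wdist_le w) (have := Nonempty.intro w; le_ciInf fun r => hh.geodesic_le M r w hw)

theorem wdist_nonneg (p q : V) : 0 ≤ wdist G h p q := by
  obtain ⟨w, hw⟩ := M.conn.exists_walk_length_eq_dist p q
  rw [hh.wdist_geodesic M w hw]
  exact hh.sum_nonneg w

theorem wdist_self (p : V) : wdist G h p p = 0 := by
  rw [hh.wdist_geodesic M (.nil : G.Walk p p) (by simp)]
  rfl

theorem wdist_symm (p q : V) : wdist G h p q = wdist G h q p := by
  obtain ⟨w, hw⟩ := M.conn.exists_walk_length_eq_dist p q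
  rw [hh.wdist_geodesic M w hw, hh.wdist_geodesic M w.reverse (by simp [hw, G.dist_comm])]
  simp

theorem wdist_triangle (p q r : V) : wdist G h p r ≤ wdist G h p q + wdist G h q r := by
  obtain ⟨w, hw⟩ := M.conn.exists_walk_length_eq_dist p q
  obtain ⟨w', hw'⟩ := M.conn.exists_walk_length_eq_dist q r
  rw [hh.wdist_geodesic M w hw, hh.wdist_geodesic M w' hw']
  refine (hh.wdist_le (w.append w')).trans ?_
  simp [SimpleGraph.Walk.edges_append]

theorem wdist_add {x y z : V} (hz : InInterval G x y z) :
    wdist G h x z + wdist G h z y = wdist G h x y := by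
  obtain ⟨w, hw⟩ := M.conn.exists_walk_length_eq_dist x z
  obtain ⟨w', hw'⟩ := M.conn.exists_walk_length_eq_dist z y
  rw [hh.wdist_geodesic M w hw, hh.wdist_geodesic M w' hw', hh.wdist_geodesic M (w.append w')]
  · simp [SimpleGraph.Walk.edges_append]
  · rw [SimpleGraph.Walk.length_append, hw, hw']
    exact hz

theorem wdist_eq_of_zero {p q : V} (hpq : wdist G h p q = 0) (s : V) :
    wdist G h s p = wdist G h s q := by
  have h1 := hh.wdist_triangle M s p q
  have h2 := hh.wdist_triangle M s q p
  rw [hh.wdist_symm M q p] at h2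
  linarith

theorem geoMetric (hpos : ∀ e ∈ G.edgeSet, 0 < h e) : GeoMetric G (wdist G h) where
  self := hh.wdist_self M
  symm := hh.wdist_symm M
  triangle := hh.wdist_triangle M
  pos p q hne := by
    obtain ⟨w, hw⟩ := M.conn.exists_walk_length_eq_dist p q
    rw [hh.wdist_geodesic M w hw]
    cases w with
    | nil => exact absurd rfl hne
    | cons e w =>
      simp only [SimpleGraph.Walk.edges_cons, List.map_cons, List.sum_cons]
      have := hpos _ (G.mem_edgeSet.2 e)
      have := hh.sum_nonneg w
      linarith
  add _ _ _ := hh.wdist_add M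

theorem wdist_sum {ι : Type*} {K : Finset ι} {κ : ι → ℝ} {g : ι → Sym2 V → ℝ}
    (hg : ∀ k ∈ K, EdgeLength G (g k)) (e : ∀ e ∈ G.edgeSet, h e = ∑ k ∈ K, κ k * g k e)
    (p q : V) : wdist G h p q = ∑ k ∈ K, κ k * wdist G (g k) p q := by
  obtain ⟨w, hw⟩ := M.conn.exists_walk_length_eq_dist p q
  rw [hh.wdist_geodesic M w hw,
    Finset.sum_congr rfl fun k hk => by rw [(hg k hk).wdist_geodesic M w hw]]
  clear hw
  induction w with
  | nil => simp
  | cons e' w ih =>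
    simp only [SimpleGraph.Walk.edges_cons, List.map_cons, List.sum_cons, mul_add,
      Finset.sum_add_distrib]
    rw [ih, e _ e']

theorem cost_eq_of_zero [Fintype V] {n : ℕ} (c : Sym2 (V ⊕ Fin n) → ℚ≥0) {ρ ρ' : Fin n → V}
    (hz : ∀ i, wdist G h (ρ i) (ρ' i) = 0) : cost G h c ρ = cost G h c ρ' := by
  unfold cost
  have e1 : ∀ s j, wdist G h s (ρ j) = wdist G h s (ρ' j) :=
    fun s j => hh.wdist_eq_of_zero M (hz j) s
  have e2 : ∀ i j, wdist G h (ρ i) (ρ' j) = wdist G h (ρ' i) (ρ' j) := fun i j => by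
    rw [hh.wdist_symm M, hh.wdist_eq_of_zero M (hz i), hh.wdist_symm M]
  simp only [e1, e2]

theorem cost_sum [Fintype V] {n : ℕ} (c : Sym2 (V ⊕ Fin n) → ℚ≥0) (ρ : Fin n → V) {ι : Type*}
    {K : Finset ι} {κ : ι → ℝ} {g : ι → Sym2 V → ℝ} (hg : ∀ k ∈ K, EdgeLength G (g k))
    (e : ∀ e ∈ G.edgeSet, h e = ∑ k ∈ K, κ k * g k e) :
    cost G h c ρ = ∑ k ∈ K, κ k * cost G (g k) c ρ := by
  have h1 : ∀ s : V, ∑ j : Fin n, ∑ k ∈ K, (c s(Sum.inl s, Sum.inr j) : ℝ) *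
      (κ k * wdist G (g k) s (ρ j)) = ∑ k ∈ K, ∑ j : Fin n,
      (c s(Sum.inl s, Sum.inr j) : ℝ) * (κ k * wdist G (g k) s (ρ j)) :=
    fun s => Finset.sum_comm
  have h2 : ∀ i : Fin n, ∑ j ∈ Finset.Ioi i, ∑ k ∈ K, (c s(Sum.inr i, Sum.inr j) : ℝ) *
      (κ k * wdist G (g k) (ρ i) (ρ j)) = ∑ k ∈ K, ∑ j ∈ Finset.Ioi i,
      (c s(Sum.inr i, Sum.inr j) : ℝ) * (κ k * wdist G (g k) (ρ i) (ρ j)) :=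
    fun i => Finset.sum_comm
  unfold cost
  simp only [hh.wdist_sum M hg e, Finset.mul_sum, h1, h2]
  rw [Finset.sum_comm, Finset.sum_comm (s := Finset.univ) (t := K), ← Finset.sum_add_distrib]
  refine Finset.sum_congr rfl fun k _ => ?_
  rw [mul_add, Finset.mul_sum, Finset.mul_sum]
  congr 1 <;> refine Finset.sum_congr rfl fun i _ => ?_ <;> rw [Finset.mul_sum] <;>
    exact Finset.sum_congr rfl fun j _ => by ring

end EdgeLength

theorem IsFourCycle.flip {u v v' u' : V} (h : IsFourCycle G u v v' u') :
    IsFourCycle G u' v' v u :=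
  ⟨h.2.2.1.symm, h.2.1.symm, h.1.symm, h.2.2.2.1.symm, h.2.2.2.2.2.symm, h.2.2.2.2.1.symm⟩

theorem Opposite.symm {e e' : Sym2 V} (h : Opposite G e e') : Opposite G e' e := by
  obtain ⟨u, v, v', u', h, h1, h2⟩ := h
  exact ⟨u', v', v, u, h.flip, h2, h1⟩

theorem Projective.symm {e e' : Sym2 V} (h : Projective G e e') : Projective G e' e := by
  induction h with
  | refl => exact .refl
  | tail _ h ih => exact .head h.symm ih

/-- The orbit of an edge. -/
def orbit (G : SimpleGraph V) (e : Sym2 V) : Set (Sym2 V) :=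
  {e' | e' ∈ G.edgeSet ∧ Projective G e e'}

theorem IsOrbit.eq_orbit {Q : Set (Sym2 V)} (hQ : IsOrbit G Q) {e : Sym2 V} (he : e ∈ Q) :
    Q = orbit G e := by
  obtain ⟨e₀, h0, rfl⟩ := hQ
  ext e'
  exact ⟨fun h => ⟨h.1, he.2.symm.trans h.2⟩, fun h => ⟨h.1, he.2.trans h.2⟩⟩

theorem IsOrbit.subset {Q : Set (Sym2 V)} (hQ : IsOrbit G Q) {e : Sym2 V} (he : e ∈ Q) :
    e ∈ G.edgeSet := by
  obtain ⟨e₀, h0, rfl⟩ := hQ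
  exact he.1

theorem IsOrbit.nonempty {Q : Set (Sym2 V)} (hQ : IsOrbit G Q) : ∃ e, e ∈ Q := by
  obtain ⟨e₀, h0, rfl⟩ := hQ
  exact ⟨e₀, h0, .refl⟩

theorem IsOrbit.mem_of_parallel {Q : Set (Sym2 V)} (hQ : IsOrbit G Q) {u v v' u' : V}
    (h : IsFourCycle G u v v' u') (hu : s(u, v) ∈ Q) : s(u', v') ∈ Q := by
  obtain ⟨e₀, h0, rfl⟩ := hQ
  exact ⟨h.2.2.1.symm, hu.2.tail ⟨u, v, v', u', h, rfl, rfl⟩⟩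

theorem IsOrbit.parallel_iff {Q : Set (Sym2 V)} (hQ : IsOrbit G Q) {u v v' u' : V}
    (h : IsFourCycle G u v v' u') : s(u, v) ∈ Q ↔ s(u', v') ∈ Q :=
  ⟨hQ.mem_of_parallel h, hQ.mem_of_parallel h.flip⟩

open Classical in
/-- The indicator function of a set of edges. -/
noncomputable def ind (Q : Set (Sym2 V)) (e : Sym2 V) : ℝ := if e ∈ Q then 1 else 0

theorem ind_congr {Q : Set (Sym2 V)} {e e' : Sym2 V} (h : e ∈ Q ↔ e' ∈ Q) : ind Q e = ind Q e' := by
  by_cases he : e ∈ Q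
  · rw [ind, ind, if_pos he, if_pos (h.1 he)]
  · rw [ind, ind, if_neg he, if_neg fun h' => he (h.2 h')]

theorem IsOrbit.edgeLength {Q : Set (Sym2 V)} (hQ : IsOrbit G Q) : EdgeLength G (ind Q) where
  nonneg e _ := by unfold ind; split_ifs <;> norm_num
  parallel u v v' u' h := ind_congr (hQ.parallel_iff h)

theorem IsOrbit.edgeLength_compl {Q : Set (Sym2 V)} (hQ : IsOrbit G Q) :
    EdgeLength G (ind Qᶜ) where
  nonneg e _ := by unfold ind; split_ifs <;> norm_num
  parallel u v v' u' h := ind_congr (not_congr (hQ.parallel_iff h))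

theorem OrbitInvariant.edgeLength {h : Sym2 V → ℝ} (hinv : OrbitInvariant G h)
    (hpos : ∀ e ∈ G.edgeSet, 0 < h e) : EdgeLength G h where
  nonneg e he := (hpos e he).le
  parallel u v v' u' hc := hinv (orbit G s(u, v)) ⟨s(u, v), hc.1, rfl⟩ _ ⟨hc.1, .refl⟩ _
    ⟨hc.2.2.1.symm, .single ⟨u, v, v', u', hc, rfl, rfl⟩⟩

/-- An orbit-invariant function is a combination of the indicators of the orbits. -/
theorem OrbitInvariant.decompose [Finite V] {h : Sym2 V → ℝ} (hinv : OrbitInvariant G h)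
    (hpos : ∀ e ∈ G.edgeSet, 0 < h e) : ∃ (K : Finset (Set (Sym2 V))) (κ : Set (Sym2 V) → ℝ),
    (∀ Q, Q ∈ K ↔ IsOrbit G Q) ∧ (∀ Q ∈ K, 0 < κ Q) ∧
      ∀ e ∈ G.edgeSet, h e = ∑ Q ∈ K, κ Q * ind Q e := by
  have : Finite (Set (Sym2 V)) := inferInstance
  have hK : ∀ Q, Q ∈ (Set.toFinite {Q | IsOrbit G Q}).toFinset ↔ IsOrbit G Q := fun Q => by simp
  have hκ : ∀ Q, ∃ x : ℝ, IsOrbit G Q → ∀ e ∈ Q, h e = x := by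
    intro Q
    by_cases hQ : IsOrbit G Q
    · obtain ⟨e, he⟩ := hQ.nonempty
      exact ⟨h e, fun _ e' he' => hinv Q hQ e' he' e he⟩
    · exact ⟨0, fun h => absurd h hQ⟩
  choose κ hκ using hκ
  refine ⟨_, κ, hK, fun Q hQ => ?_, fun e he => ?_⟩
  · rw [hK] at hQ
    obtain ⟨e, he⟩ := hQ.nonempty
    rw [← hκ Q hQ e he]
    exact hpos e (hQ.subset he)
  · have ho : IsOrbit G (orbit G e) := ⟨e, he, rfl⟩
    have hm : e ∈ orbit G e := ⟨he, .refl⟩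
    rw [Finset.sum_eq_single_of_mem _ ((hK _).2 ho)]
    · rw [ind, if_pos hm, mul_one]
      exact hκ _ ho e hm
    · intro Q hQ hne
      rw [hK] at hQ
      rw [ind, if_neg fun h => hne (hQ.eq_orbit h), mul_zero]

section Upper

variable (M : OrientedModular G o)
include M

theorem mem_upper {p q : V} : q ∈ upper o p ↔ Atomistic o p q := M.booleanPair_iff

theorem coveringGraph_adj_of_edge {p a b : V} (h : o a b) (ha : a ∈ upper o p)
    (hb : b ∈ upper o p) : (coveringGraph o (upper o p)).Adj a b :=
  .inl ⟨ha, hb, .of_edge h, M.edge_ne h, fun _ _ h1 h2 => M.eq_or_eq_of_edge h h1 h2⟩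

theorem edge_of_covers {p a b : V} (h : Covers o (upper o p) a b) : o a b := by
  obtain ⟨ha, hb, hab, hne, hc⟩ := h
  rw [mem_upper M] at ha hb
  obtain ⟨c, h1, h2⟩ := exists_first hab hne
  rcases hc c ((mem_upper M).2 (M.atomistic_lower hb (ha.1.trans (.of_edge h1)) h2))
    (.of_edge h1) h2 with rfl | rfl
  · exact absurd rfl (M.edge_ne h1)
  · exact h1

theorem coveringGraph_le {p : V} : coveringGraph o (upper o p) ≤ G := by
  rintro a b (h | h)
  · exact M.adm.adj _ _ (edge_of_covers M h)
  · exact (M.adm.adj _ _ (edge_of_covers M h)).symm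

/-- The covering graph of `L⁺_p` contains a geodesic of `G`. -/
theorem exists_covering_walk {p q : V} (hq : q ∈ upper o p) :
    ∃ w : (coveringGraph o (upper o p)).Walk p q, w.length = G.dist p q := by
  rw [mem_upper M] at hq
  have key : ∀ a, Preceq o p a → Preceq o a q →
      ∃ w : (coveringGraph o (upper o p)).Walk p a, w.length = G.dist p a := by
    intro a ha
    induction ha with
    | refl => exact fun _ => ⟨.nil, by simp⟩
    | @tail b c hb hbc ih =>
      intro hc
      have hbq := Preceq.trans (.of_edge hbc) hc
      obtain ⟨w, hw⟩ := ih hbq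
      refine ⟨w.concat (coveringGraph_adj_of_edge M hbc
        ((mem_upper M).2 (M.atomistic_lower hq hb hbq))
        ((mem_upper M).2 (M.atomistic_lower hq (Preceq.trans hb (.of_edge hbc)) hc))), ?_⟩
      have := M.dist_add_of_preceq hb (.of_edge hbc)
      rw [InInterval, M.dist_edge hbc] at this
      rw [SimpleGraph.Walk.length_concat, hw, this]
  exact key q hq.1 (.refl q)

theorem wdist_upperRestrict {p q : V} {Q Q' : Set (Sym2 V)} (hQ : IsOrbit G Q)
    (hQ' : IsOrbit G Q') (hne : Q' ≠ Q) (hq : q ∈ upperRestrict o p Q) :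
    wdist G (ind Q') p q = 0 := by
  obtain ⟨w₀, -⟩ := exists_covering_walk M hq.1
  obtain ⟨w, hw⟩ := w₀.reachable.exists_walk_length_eq_dist
  have hw' := hq.2 w hw
  refine le_antisymm ?_ (hQ'.edgeLength.wdist_nonneg M p q)
  refine (hQ'.edgeLength.wdist_le (w.transfer G fun e he => hQ.subset (hw' e he).1)).trans ?_
  rw [SimpleGraph.Walk.edges_transfer]
  refine (List.sum_eq_zero fun x hx => ?_).le
  obtain ⟨e, he, rfl⟩ := List.mem_map.1 hx
  rw [ind, if_neg]
  exact fun h => hne ((hQ'.eq_orbit h).trans (hQ.eq_orbit (hw' e he).1).symm)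

/-- Edges of a cube in the same direction are linked by its square faces. -/
theorem cube_parallel {k : ℕ} {f : Finset (Fin k) → V} (hinj : Function.Injective f)
    (hf : ∀ S i, i ∉ S → o (f S) (f (insert i S))) {g : Sym2 V → ℝ} (hg : EdgeLength G g)
    (S : Finset (Fin k)) : ∀ i ∉ S, g s(f S, f (insert i S)) = g s(f ∅, f {i}) := by
  induction S using Finset.induction_on with
  | empty =>
    intro i _
    rfl
  | insert j S hj ih =>
    intro i hi
    rw [Finset.mem_insert, not_or] at hi
    rw [← ih i hi.2]
    have a1 := M.adm.adj _ _ (hf S j hj)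
    have a2 := M.adm.adj _ _ (hf (insert j S) i (by simp [hi]))
    have a3 := M.adm.adj _ _ (hf (insert i S) j (by simp [Ne.symm hi.1, hj]))
    have a4 := M.adm.adj _ _ (hf S i hi.2)
    rw [Finset.insert_comm] at a3
    refine hg.parallel _ _ _ _ ⟨a2, a3.symm, a4.symm, a1, ?_, ?_⟩
    · intro e
      have : i ∈ insert j S := hinj e ▸ Finset.mem_insert_self i S
      simp [hi] at this
    · intro e
      have : i ∈ S := hinj e ▸ Finset.mem_insert_self i _
      exact hi.2 this

theorem cube_wdist_zero {k : ℕ} {f : Finset (Fin k) → V} (hinj : Function.Injective f)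
    (hf : ∀ S i, i ∉ S → o (f S) (f (insert i S))) {g : Sym2 V → ℝ} (hg : EdgeLength G g)
    (T U : Finset (Fin k)) (hU : ∀ i ∈ U, g s(f ∅, f {i}) = 0) :
    wdist G g (f T) (f (T ∪ U)) = 0 := by
  induction U using Finset.induction_on with
  | empty => rw [Finset.union_empty, hg.wdist_self M]
  | insert i U _ ih =>
    have h1 := ih fun j hj => hU j (Finset.mem_insert_of_mem hj)
    rw [Finset.union_insert]
    by_cases hi : i ∈ T ∪ U
    · rwa [Finset.insert_eq_of_mem hi]
    refine le_antisymm ((hg.wdist_triangle M _ (f (T ∪ U)) _).trans ?_) (hg.wdist_nonneg M _ _)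
    have h2 := hg.wdist_le (.cons (M.adm.adj _ _ (hf _ i hi)) .nil)
    simp only [SimpleGraph.Walk.edges_cons, SimpleGraph.Walk.edges_nil, List.map_cons,
      List.map_nil, List.sum_cons, List.sum_nil, add_zero] at h2
    rw [cube_parallel M hinj hf hg _ i hi, hU i (Finset.mem_insert_self i U)] at h2
    linarith

/-- The projection of an element of `L⁺_p` to `L⁺_p|Q`. -/
theorem exists_upperRestrict {p q : V} {Q : Set (Sym2 V)} (hQ : IsOrbit G Q)
    (hq : q ∈ upper o p) : ∃ r ∈ upperRestrict o p Q, wdist G (ind Q) r q = 0 := by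
  classical
  obtain ⟨k, f, hinj, hf, rfl, rfl⟩ := id hq
  -- Keep the cube directions that belong to Q: then p and f S are joined by edges in Q, and f S and
  -- q by edges outside Q.
  let S : Finset (Fin k) := Finset.univ.filter fun i => s(f ∅, f {i}) ∈ Q
  have h1 : wdist G (ind Q) (f S) (f Finset.univ) = 0 := by
    have := cube_wdist_zero M hinj hf hQ.edgeLength S Sᶜ (fun i hi => ?_)
    · rwa [Finset.union_compl] at this
    · rw [ind, if_neg]
      simpa [S] using hi
  have h2 : wdist G (ind Qᶜ) (f ∅) (f S) = 0 := by
    have := cube_wdist_zero M hinj hf hQ.edgeLength_compl ∅ S (fun i hi => ?_)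
    · rwa [Finset.empty_union] at this
    · rw [ind, if_neg]
      simpa [S] using hi
  have hS : f S ∈ upper o (f ∅) := by
    rw [mem_upper M] at hq ⊢
    exact M.atomistic_lower hq (cube_mono hf (Finset.empty_subset S))
      (cube_mono hf (Finset.subset_univ S))
  refine ⟨f S, ⟨hS, fun w hw e he => ⟨?_, w.edges_subset_edgeSet he⟩⟩, h1⟩
  obtain ⟨w₀, hw₀⟩ := exists_covering_walk M hS
  -- A shortest walk in the covering graph is a geodesic of G, and all geodesics with these ends
  -- have the same number of edges outside Q, here zero.
  have hlen : (w.mapLe (coveringGraph_le M)).length = G.dist (f ∅) (f S) := by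
    refine le_antisymm ?_ (G.dist_le _)
    rw [SimpleGraph.Walk.length_map, hw, ← hw₀]
    exact SimpleGraph.dist_le w₀
  have hsum := hQ.edgeLength_compl.wdist_geodesic M _ hlen
  rw [h2, SimpleGraph.Walk.edges_mapLe_eq_edges] at hsum
  by_contra heQ
  have hle : ind Qᶜ e ≤ (w.edges.map (ind Qᶜ)).sum := by
    refine List.single_le_sum (fun x hx => ?_) _ (List.mem_map_of_mem he)
    obtain ⟨e', -, rfl⟩ := List.mem_map.1 hx
    unfold ind
    split_ifs <;> norm_num
  rw [← hsum, ind, if_pos (show e ∈ Qᶜ from heQ)] at hle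
  linarith

end Upper

theorem lower_eq (o : V → V → Prop) (p : V) : lower o p = upper (rev o) p := by
  ext q
  exact booleanPair_rev.symm

theorem coveringGraph_rev (o : V → V → Prop) (L : Set V) :
    coveringGraph (rev o) L = coveringGraph o L := by
  have key : ∀ a b, Covers (rev o) L a b ↔ Covers o L b a := by
    intro a b
    unfold Covers
    simp only [preceq_rev]
    constructor <;> rintro ⟨h1, h2, h3, h4, h5⟩ <;>
      exact ⟨h2, h1, h3, h4.symm, fun c hc h h' => (h5 c hc h' h).symm⟩
  ext a b
  change Covers (rev o) L a b ∨ Covers (rev o) L b a ↔ Covers o L a b ∨ Covers o L b a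
  rw [key, key, or_comm]

theorem lowerRestrict_eq (o : V → V → Prop) (p : V) (Q : Set (Sym2 V)) :
    lowerRestrict o p Q = upperRestrict (rev o) p Q := by
  unfold lowerRestrict upperRestrict restrict
  rw [← lower_eq, coveringGraph_rev]

theorem isNeighbor_iff (M : OrientedModular G o) {n : ℕ} {ρ ρ' : Fin n → V} :
    IsNeighbor o ρ ρ' ↔ Near o ρ ρ' := by
  unfold IsNeighbor Near upper lower
  simp only [Set.mem_ofPred_eq, M.booleanPair_iff]

theorem IsQNeighbor.isNeighbor {Q : Set (Sym2 V)} {n : ℕ} {ρ ρ' : Fin n → V}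
    (h : IsQNeighbor o Q ρ ρ') : IsNeighbor o ρ ρ' :=
  h.imp (fun h i => (h i).1) (fun h i => (h i).1)

theorem wdist_isQNeighbor (M : OrientedModular G o) {Q Q' : Set (Sym2 V)} (hQ : IsOrbit G Q)
    (hQ' : IsOrbit G Q') (hne : Q' ≠ Q) {n : ℕ} {ρ ρ' : Fin n → V} (h : IsQNeighbor o Q ρ ρ')
    (i : Fin n) : wdist G (ind Q') (ρ i) (ρ' i) = 0 := by
  rcases h with h | h
  · exact wdist_upperRestrict M hQ hQ' hne (h i)
  · refine wdist_upperRestrict M.reverse hQ hQ' hne ?_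
    rw [← lowerRestrict_eq]
    exact h i

theorem exists_isQNeighbor (M : OrientedModular G o) {Q : Set (Sym2 V)} (hQ : IsOrbit G Q)
    {n : ℕ} {ρ ρ' : Fin n → V} (h : IsNeighbor o ρ ρ') :
    ∃ r, IsQNeighbor o Q ρ r ∧ ∀ i, wdist G (ind Q) (r i) (ρ' i) = 0 := by
  rcases h with h | h
  · choose r h1 h2 using fun i => exists_upperRestrict M hQ (h i)
    exact ⟨r, .inl h1, h2⟩
  · choose r h1 h2 using fun i => exists_upperRestrict M.reverse hQ (lower_eq o (ρ i) ▸ h i)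
    exact ⟨r, .inr fun i => lowerRestrict_eq o (ρ i) Q ▸ h1 i, h2⟩

section Local

variable [Fintype V] (M : OrientedModular G o) {h : Sym2 V → ℝ} (hinv : OrbitInvariant G h)
  (hpos : ∀ e ∈ G.edgeSet, 0 < h e) {n : ℕ} (c : Sym2 (V ⊕ Fin n) → ℚ≥0) (ρ : Fin n → V)
include M hinv hpos

/-- In the orbit decomposition of the cost only the Q-summand changes, and its coefficient is
positive; so the comparison does not depend on h. -/
theorem cost_isQNeighbor_iff {Q : Set (Sym2 V)} (hQ : IsOrbit G Q) {ρ' : Fin n → V}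
    (hρ : IsQNeighbor o Q ρ ρ') :
    cost G h c ρ ≤ cost G h c ρ' ↔ cost G (ind Q) c ρ ≤ cost G (ind Q) c ρ' := by
  classical
  obtain ⟨K, κ, hK, hκ, hd⟩ := hinv.decompose hpos
  have hs := fun ρ => (hinv.edgeLength hpos).cost_sum M c ρ
    (fun Q hQ => ((hK Q).1 hQ).edgeLength) hd
  have hQK := (hK Q).2 hQ
  have e : ∑ Q' ∈ K.erase Q, κ Q' * cost G (ind Q') c ρ =
      ∑ Q' ∈ K.erase Q, κ Q' * cost G (ind Q') c ρ' := by
    refine Finset.sum_congr rfl fun Q' hQ' => ?_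
    rw [Finset.mem_erase, hK] at hQ'
    rw [hQ'.2.edgeLength.cost_eq_of_zero M c fun i => wdist_isQNeighbor M hQ hQ'.2 hQ'.1 hρ i]
  rw [hs, hs, ← Finset.add_sum_erase K _ hQK, ← Finset.add_sum_erase K _ hQK, e,
    add_le_add_iff_right, mul_le_mul_iff_right₀ (hκ Q hQK)]

/-- Optimality among the neighbors is optimality among the `Q`-neighbors for all orbits `Q`. -/
theorem neighbor_optimal_iff :
    (∀ ρ', IsNeighbor o ρ ρ' → cost G h c ρ ≤ cost G h c ρ') ↔
      ∀ Q, IsOrbit G Q → ∀ ρ', IsQNeighbor o Q ρ ρ' →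
        cost G (ind Q) c ρ ≤ cost G (ind Q) c ρ' := by
  constructor
  · exact fun H Q hQ ρ' hρ =>
      (cost_isQNeighbor_iff M hinv hpos c ρ hQ hρ).1 (H ρ' hρ.isNeighbor)
  · intro H ρ' hρ
    obtain ⟨K, κ, hK, hκ, hd⟩ := hinv.decompose hpos
    have hs := fun ρ => (hinv.edgeLength hpos).cost_sum M c ρ
      (fun Q hQ => ((hK Q).1 hQ).edgeLength) hd
    rw [hs, hs]
    refine Finset.sum_le_sum fun Q hQ => mul_le_mul_of_nonneg_left ?_ (hκ Q hQ).le
    rw [hK] at hQ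
    -- The projection r has the same Q-summand as ρ', so the hypothesis bounds each summand
    -- separately.
    obtain ⟨r, h1, h2⟩ := exists_isQNeighbor M hQ hρ
    rw [← hQ.edgeLength.cost_eq_of_zero M c h2]
    exact H Q hQ r h1

theorem isOptimal_iff :
    IsOptimal G h c ρ ↔ ∀ ρ', IsNeighbor o ρ ρ' → cost G h c ρ ≤ cost G h c ρ' := by
  constructor
  · exact fun H ρ' _ => H ρ'
  · exact fun H => local_optimal c M ((hinv.edgeLength hpos).geoMetric M hpos)
      fun ρ' hρ => H ρ' ((isNeighbor_iff M).2 hρ)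

end Local

end Multifac

theorem mainTheorem7 {V : Type*} [Fintype V] (G : SimpleGraph V)
    (hconn : G.Connected) (hmod : Multifac.IsModular G)
    (o : V → V → Prop) (ho : Multifac.IsAdmissible G o)
    (h : Sym2 V → ℝ) (hinv : Multifac.OrbitInvariant G h) (hpos : ∀ e ∈ G.edgeSet, 0 < h e)
    (n : ℕ) (c : Sym2 (V ⊕ Fin n) → ℚ≥0) (ρ : Fin n → V) :
    List.TFAE [
      Multifac.IsOptimal G h c ρ,
      Multifac.IsOptimal G (fun _ => 1) c ρ,
      ∀ ρ', Multifac.IsNeighbor o ρ ρ' → Multifac.cost G h c ρ ≤ Multifac.cost G h c ρ',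
      ∀ ρ', Multifac.IsNeighbor o ρ ρ' →
        Multifac.cost G (fun _ => 1) c ρ ≤ Multifac.cost G (fun _ => 1) c ρ',
      ∀ Q, Multifac.IsOrbit G Q → ∀ ρ', Multifac.IsQNeighbor o Q ρ ρ' →
        Multifac.cost G (fun _ => 1) c ρ ≤ Multifac.cost G (fun _ => 1) c ρ'] := by
  have M : Multifac.OrientedModular G o := ⟨hconn, hmod, ho⟩
  have hinv1 : Multifac.OrbitInvariant G fun _ => 1 := fun _ _ _ _ _ _ => rfl
  have hpos1 : ∀ e ∈ G.edgeSet, (0 : ℝ) < (fun _ => 1) e := fun _ _ => one_pos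
  tfae_have 1 ↔ 3 := Multifac.isOptimal_iff M hinv hpos c ρ
  tfae_have 2 ↔ 4 := Multifac.isOptimal_iff M hinv1 hpos1 c ρ
  -- Both conditions reduce to the same family of conditions on orbit indicators, free of the edge
  -- length.
  tfae_have 3 ↔ 4 := (Multifac.neighbor_optimal_iff M hinv hpos c ρ).trans
    (Multifac.neighbor_optimal_iff M hinv1 hpos1 c ρ).symm
  tfae_have 4 ↔ 5 := (Multifac.neighbor_optimal_iff M hinv1 hpos1 c ρ).trans
    (forall_congr' fun _ => forall_congr' fun hQ => forall_congr' fun _ => forall_congr' fun hρ =>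
      (Multifac.cost_isQNeighbor_iff M hinv1 hpos1 c ρ hQ hρ).symm)
  tfae_finish
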